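/- Let $p$ be a prime, $n\ge 1$, and let $\mathbb{Q}_p^n$ carry the norm $|x|_p=\max_j|x_j|_p$ and the Haar measure $|\cdot|_h$ (also written $dx$) normalized so that the closed unit ball has measure $1$. For $\gamma\in\mathbb{Z}$ put $B_\gamma(x)=\{y:|y-x|_p\le p^\gamma\}$. All functions are real-valued, and locally integrable functions are identified when they agree almost everywhere. Notation. For $0\le\alpha<n$, a measurable $f$ and a ball $B$, $$\mathcal{M}_\alpha^p(f)(x)=\sup_{\gamma\in\mathbb{Z}}\frac{1}{|B_\gamma(x)|_h^{1-\alpha/n}}\int_{B_\gamma(x)}|f(y)|\,dy\in[0,\infty],$$ and $\mathcal{M}_{\alpha,B}^p(f)(x)$ is the same supremum restricted to those $\gamma$ with $B_\gamma(x)\subset B$. The nonlinear commutator is $[b,\mathcal{M}_\alpha^p](f)=b\,\mathcal{M}_\alpha^p(f)-\mathcal{M}_\alpha^p(bf)$. $\Lambda_\beta(\mathbb{Q}_p^n)$ is the set of measurable $f$ with $\sup_{x\ne y}|f(x)-f(y)|/|x-y|_p^\beta<\infty$. For a measurable $q:\mathbb{Q}_p^n\to\mathbb{R}$ let $q_-,q_+$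 be its essential infimum and supremum, and $q_\pm(B)$ those over a ball $B$. Let $\mathscr{P}$ be the set of measurable $q(\cdot)$ with $1<q_-\le q(x)\le q_+<\infty$ for all $x$, and $\mathscr{C}^{\log}$ the set of $q(\cdot)\in\mathscr{P}$ for which there is $C>0$ such that $\gamma\,(q_-(B_\gamma(x))-q_+(B_\gamma(x)))\le C$ for all $\gamma\in\mathbb{Z}$, $x\in\mathbb{Q}_p^n$, and $|q(x)-q(y)|\le C/\log_p(p+\min\{|x|_p,|y|_p\})$ for all $x,y\in\mathbb{Q}_p^n$. The space $L^{q(\cdot)}(\mathbb{Q}_p^n)$ consists of the measurable $f$ with $\int(|f(x)|/\eta)^{q(x)}dx<\infty$ for some $\eta>0$, with the norm $\|f\|_{L^{q(\cdot)}}=\inf\{\eta>0:\int(|f(x)|/\eta)^{q(x)}dx\le1\}$. The commutator $[b,\mathcal{M}_\alpha^p]$ is bounded from $L^{r(\cdot)}$ to $L^{q(\cdot)}$ if there is a constant $C$ such that, for every $f\in L^{r(\cdot)}$, both $\mathcal{M}_\alpha^p(f)$ and $\mathcal{M}_\alpha^p(bf)$ are finite almost everywhere, $[b,\mathcal{M}_\alpha^p](f)\in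 L^{q(\cdot)}$, and $\|[b,\mathcal{M}_\alpha^p](f)\|_{L^{q(\cdot)}}\le C\|f\|_{L^{r(\cdot)}}$. Theorem. Let $0<\beta<1$, $0<\alpha<\alpha+\beta<n$, and let $b$ be a locally integrable function on $\mathbb{Q}_p^n$. Call a pair $(r(\cdot),q(\cdot))$ admissible if $r(\cdot),q(\cdot)\in\mathscr{C}^{\log}$, $r(\cdot)\in\mathscr{P}$, $r_+<\frac{n}{\alpha+\beta}$ and $1/q(\cdot)=1/r(\cdot)-(\alpha+\beta)/n$. The following assertions are equivalent: (A.1) $b\in\Lambda_\beta(\mathbb{Q}_p^n)$ and $b\ge0$ (that is, $b$ agrees almost everywhere with a nonnegative function in $\Lambda_\beta(\mathbb{Q}_p^n)$). (A.2) $[b,\mathcal{M}_\alpha^p]$ is bounded from $L^{r(\cdot)}(\mathbb{Q}_p^n)$ to $L^{q(\cdot)}(\mathbb{Q}_p^n)$ for all admissible pairs $(r(\cdot),q(\cdot))$. (A.3) $[b,\mathcal{M}_\alpha^p]$ is bounded from $L^{r(\cdot)}(\mathbb{Q}_p^n)$ to $L^{q(\cdot)}(\mathbb{Q}_p^n)$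 for some admissible pair $(r(\cdot),q(\cdot))$. (A.4) For some admissible pair $(r(\cdot),q(\cdot))$, $$\sup_{\gamma\in\mathbb{Z},\,x\in\mathbb{Q}_p^n}\frac{1}{|B_\gamma(x)|_h^{\beta/n}}\,\frac{\big\|\big(b-|B_\gamma(x)|_h^{-\alpha/n}\mathcal{M}_{\alpha,B_\gamma(x)}^p(b)\big)\chi_{B_\gamma(x)}\big\|_{L^{q(\cdot)}(\mathbb{Q}_p^n)}}{\|\chi_{B_\gamma(x)}\|_{L^{q(\cdot)}(\mathbb{Q}_p^n)}}<\infty.$$ (A.5) The inequality in (A.4) holds for all admissible pairs $(r(\cdot),q(\cdot))$. -/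

import Mathlib

open MeasureTheory
open scoped ENNReal NNReal

noncomputable section

namespace PadicVar

/-- `ℚ_[p]` carries its Borel σ-algebra. -/
instance instMeasurableSpacePadic (p : ℕ) [Fact p.Prime] : MeasurableSpace ℚ_[p] := borel ℚ_[p]

instance instBorelSpacePadic (p : ℕ) [Fact p.Prime] : BorelSpace ℚ_[p] := ⟨rfl⟩

/-- The space `ℚ_p^n`; its norm is `|x|_p = max_j |x_j|_p`. -/
abbrev Qpn (p : ℕ) [Fact p.Prime] (n : ℕ) : Type := Fin n → ℚ_[p]

section Basic

variable {p : ℕ} [Fact p.Prime] {n : ℕ}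

/-- The ball `B_γ(a) = {x : |x - a|_p ≤ p ^ γ}`. -/
def pball (γ : ℤ) (a : Qpn p n) : Set (Qpn p n) := Metric.closedBall a ((p : ℝ) ^ γ)

variable (p n) in
/-- The unit ball of `ℚ_p^n` as a compact set with non-empty interior. -/
def unitBall : TopologicalSpace.PositiveCompacts (Qpn p n) where
  carrier := Metric.closedBall 0 1
  isCompact' := isCompact_closedBall 0 1
  interior_nonempty' :=
    ⟨0, Metric.ball_subset_interior_closedBall (Metric.mem_ball_self one_pos)⟩

variable (p n) in
/-- The Haar measure on `ℚ_p^n` with `|B_0(0)| = 1`. -/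
def haar : Measure (Qpn p n) := Measure.addHaarMeasure (unitBall p n)

/-! ### Fractional maximal functions and the nonlinear commutator -/

/-- `M_α f (x) = sup_γ |B_γ(x)|^{-(1 - α/n)} ∫_{B_γ(x)} |f|`, with values in `[0, ∞]`. -/
def fracMax (α : ℝ) (f : Qpn p n → ℝ) (x : Qpn p n) : ℝ≥0∞ :=
  ⨆ γ : ℤ, (∫⁻ y in pball γ x, ‖f y‖ₑ ∂(haar p n)) / (haar p n (pball γ x)) ^ (1 - α / n)

/-- `M_{α,S} f (x)`: the supremum is over those balls `B_γ(x)` that are contained in `S`. -/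
def fracMaxOn (α : ℝ) (S : Set (Qpn p n)) (f : Qpn p n → ℝ) (x : Qpn p n) : ℝ≥0∞ :=
  ⨆ (γ : ℤ) (_ : pball γ x ⊆ S),
    (∫⁻ y in pball γ x, ‖f y‖ₑ ∂(haar p n)) / (haar p n (pball γ x)) ^ (1 - α / n)

/-- `[b, M_α] f (x) = b(x) M_α f (x) - M_α (b f) (x)`, meaningful where both maximal functions
are finite (this is demanded almost everywhere in `CommutatorBounded`). -/
def commutator (α : ℝ) (b f : Qpn p n → ℝ) (x : Qpn p n) : ℝ :=
  b x * (fracMax α f x).toReal - (fracMax α (fun y => b y * f y) x).toReal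

/-! ### Variable exponents and variable exponent Lebesgue spaces -/

/-- The class of measurable exponents with `1 < q₋ ≤ q(x) ≤ q₊ < ∞` for all `x`, where `q₋`, `q₊`
are the essential infimum and supremum. (Real-valued `essInf` and `essSup` are `0` for functions
that are not essentially bounded below, respectively above; these are excluded by the bounds.) -/
structure MemP (q : Qpn p n → ℝ) : Prop where
  measurable : Measurable q
  one_lt : 1 < essInf q (haar p n)
  le_apply : ∀ x, essInf q (haar p n) ≤ q x
  apply_le : ∀ x, q x ≤ essSup q (haar p n)

/-- The local log-Hölder condition `γ (q₋(B_γ(x)) - q₊(B_γ(x))) ≤ C`. -/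
def LogHolderZero (q : Qpn p n → ℝ) : Prop :=
  ∃ C : ℝ, 0 < C ∧ ∀ (γ : ℤ) (x : Qpn p n),
    (γ : ℝ) * (essInf q ((haar p n).restrict (pball γ x)) -
      essSup q ((haar p n).restrict (pball γ x))) ≤ C

/-- The log-Hölder condition at infinity. -/
def LogHolderInfty (q : Qpn p n → ℝ) : Prop :=
  ∃ C : ℝ, 0 < C ∧ ∀ x y : Qpn p n,
    |q x - q y| ≤ C / Real.logb p (p + min ‖x‖ ‖y‖)

/-- The class `C^log` of globally log-Hölder continuous exponents. -/
structure MemClog (q : Qpn p n → ℝ) : Prop where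
  memP : MemP q
  zero : LogHolderZero q
  infty : LogHolderInfty q

/-- The modular `F_q(f / η) = ∫ (|f(x)| / η)^{q(x)} dx`. -/
def modular (q f : Qpn p n → ℝ) (η : ℝ) : ℝ≥0∞ :=
  ∫⁻ x, ENNReal.ofReal ((|f x| / η) ^ q x) ∂(haar p n)

/-- Membership in `L^{q(·)}`. -/
def MemLvar (q f : Qpn p n → ℝ) : Prop :=
  AEStronglyMeasurable f (haar p n) ∧ ∃ η : ℝ, 0 < η ∧ modular q f η < ∞

/-- The Luxemburg norm `inf {η > 0 : F_q(f / η) ≤ 1}` (equal to `∞` if there is no such `η`). -/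
def luxNorm (q f : Qpn p n → ℝ) : ℝ≥0∞ :=
  ⨅ (η : ℝ) (_ : 0 < η ∧ modular q f η ≤ 1), ENNReal.ofReal η

/-- Boundedness of `[b, M_α]` from `L^{r(·)}` to `L^{q(·)}`: for each `f` in `L^{r(·)}` the
commutator is defined almost everywhere, lies in `L^{q(·)}`, and has norm at most `C ‖f‖`. -/
def CommutatorBounded (α : ℝ) (b r q : Qpn p n → ℝ) : Prop :=
  ∃ C : ℝ≥0, ∀ f : Qpn p n → ℝ, MemLvar r f →
    (∀ᵐ x ∂(haar p n), fracMax α f x < ∞ ∧ fracMax α (fun y => b y * f y) x < ∞) ∧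
    MemLvar q (commutator α b f) ∧
    luxNorm q (commutator α b f) ≤ C * luxNorm r f

/-- The pairs of exponents with `r, q ∈ C^log`, `r ∈ P`, `r₊ < n / s` and
`1 / q(·) = 1 / r(·) - s / n`. -/
structure AdmissiblePair (s : ℝ) (r q : Qpn p n → ℝ) : Prop where
  r_mem_Clog : MemClog r
  q_mem_Clog : MemClog q
  r_mem_P : MemP r
  r_lt : essSup r (haar p n) < n / s
  rel : ∀ x, 1 / q x = 1 / r x - s / n

/-! ### The oscillation condition -/

/-- The function `(b - |B|^{-α/n} M_{α,B}(b)) χ_B`. For locally integrable `b` and `α > 0` the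
maximal function is finite almost everywhere on the ball `B`, by Lebesgue differentiation. -/
def oscFun (α : ℝ) (b : Qpn p n → ℝ) (B : Set (Qpn p n)) : Qpn p n → ℝ :=
  B.indicator fun y => b y - (haar p n B).toReal ^ (-α / n) * (fracMaxOn α B b y).toReal

/-- The supremum over all balls `B` of
`|B|^{-β/n} ‖(b - |B|^{-α/n} M_{α,B}(b)) χ_B‖_{q(·)} / ‖χ_B‖_{q(·)}`. -/
def oscSup (α β : ℝ) (b q : Qpn p n → ℝ) : ℝ≥0∞ :=
  ⨆ (γ : ℤ) (x : Qpn p n),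
    1 / (haar p n (pball γ x)) ^ (β / n) *
      (luxNorm q (oscFun α b (pball γ x)) / luxNorm q ((pball γ x).indicator fun _ => 1))

/-! ### Lipschitz spaces -/

/-- The norm `sup_{x ≠ y} |f(x) - f(y)| / |x - y|_p^β`. -/
def lipNorm (β : ℝ) (f : Qpn p n → ℝ) : ℝ≥0∞ :=
  ⨆ (x : Qpn p n) (y : Qpn p n) (_ : x ≠ y), ENNReal.ofReal (|f x - f y| / ‖x - y‖ ^ β)

/-- Membership in the homogeneous Lipschitz space `Λ_β`. -/
def MemLip (β : ℝ) (f : Qpn p n → ℝ) : Prop :=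
  Measurable f ∧ lipNorm β f < ∞

end Basic

end PadicVar

end

/-! Lipschitz regularity gives boundedness through a pointwise estimate. If `|b(x) - b(y)| ≤ L |x -
y|^β`, then on a ball `B` around `x` replacing `b(y)` by `b(x)` costs at most `L |B|^(β/n)`. This
factor raises the order of the maximal function from `α` to `α + β`. For `b ≥ 0` it follows that
`|[b, M_α] f| ≤ L M_{α+β} f` wherever the terms are finite (`enorm_commutator_le`).

What remains is the variable exponent bound for `M_{α+β}`
(`AdmissiblePair.exists_lintegral_fracMaxE_le`). For constant exponents it is Hedberg's inequality
combined with the Hardy–Littlewood theorem, whose weak type estimate is elementary because balls are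
nested or disjoint. For variable exponents a function of modular at most `1` is cut at height `1`.
The large part at small scales is handled by Jensen's inequality, the local log-Hölder condition
keeping `|B|^(-(r(x) - r₋(B)))` bounded. The small part, and the unit averages of the large part,
are bounded by `1`. For these the exponents may be replaced by their limits at infinity, up to an
integrable error.

Boundedness gives the oscillation condition by testing on `χ_B`. On `B` one has `M_α χ_B =
|B|^(α/n)` and `M_α(b χ_B) = M_{α,B}(b)`, and Hölder's inequality compares the two norms of `χ_B`.

For the return to `b`, let `c_B` be the mean of `|b|` over `B`. Since `B` competes in the restricted
supremum, `c_B ≤ |B|^(-α/n) M_{α,B}(b)`, so the deficit `(c_B - b)₊` is bounded by the oscillation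
function. The mean of `b` is at most `c_B`, so the excess `(b - c_B)₊` has no larger mean than the
deficit. Hence the mean of `|b - c_B|` is `O(|B|^(β/n))`. Campanato's argument makes the `c_B`
converge to a Lipschitz function equal to `b` almost everywhere. It is nonnegative because each
`c_B` is. -/

namespace PadicVar

/-! ### Ultrametric balls and their Haar measure. -/

section Balls

variable {p : ℕ} [Fact p.Prime] {n : ℕ}

lemma one_lt_prime_real (p : ℕ) [Fact p.Prime] : (1 : ℝ) < p := by
  exact_mod_cast (Fact.out : p.Prime).one_lt

lemma prime_real_pos (p : ℕ) [Fact p.Prime] : (0 : ℝ) < p :=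
  zero_lt_one.trans (one_lt_prime_real p)

lemma mem_pball {γ : ℤ} {x y : Qpn p n} : y ∈ pball γ x ↔ ‖y - x‖ ≤ (p : ℝ) ^ γ := by
  rw [pball, Metric.mem_closedBall, dist_eq_norm]

lemma zpow_prime_pos (γ : ℤ) : 0 < (p : ℝ) ^ γ := zpow_pos (prime_real_pos p) γ

lemma mem_pball_comm {γ : ℤ} {x y : Qpn p n} : y ∈ pball γ x ↔ x ∈ pball γ y := by
  rw [mem_pball, mem_pball, norm_sub_rev]

lemma norm_sub_le_max_qpn (x y z : Qpn p n) : ‖x - z‖ ≤ max ‖x - y‖ ‖y - z‖ := by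
  have := dist_triangle_max x y z
  simpa only [dist_eq_norm] using this

lemma pball_eq_of_mem {γ : ℤ} {x y : Qpn p n} (h : y ∈ pball γ x) : pball γ y = pball γ x := by
  ext z
  rw [mem_pball] at *
  constructor
  · intro hz
    exact (norm_sub_le_max_qpn z y x).trans (max_le hz h)
  · intro hz
    refine (norm_sub_le_max_qpn z x y).trans (max_le hz ?_)
    rwa [norm_sub_rev]

lemma pball_mono {γ γ' : ℤ} (h : γ ≤ γ') (x : Qpn p n) : pball γ x ⊆ pball γ' x :=
  Metric.closedBall_subset_closedBall (zpow_le_zpow_right₀ (one_lt_prime_real p).le h)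

lemma isCompact_pball (γ : ℤ) (x : Qpn p n) : IsCompact (pball γ x) := isCompact_closedBall _ _

lemma measurableSet_pball (γ : ℤ) (x : Qpn p n) : MeasurableSet (pball γ x) :=
  Metric.isClosed_closedBall.measurableSet

lemma pball_mem_nhds (γ : ℤ) (x : Qpn p n) : pball γ x ∈ nhds x :=
  Metric.closedBall_mem_nhds x (zpow_prime_pos γ)

instance instIsAddHaarMeasureHaar : (haar p n).IsAddHaarMeasure :=
  inferInstanceAs (Measure.addHaarMeasure (unitBall p n)).IsAddHaarMeasure

/-- Scaling by `p ^ (γ + 1)` moves the ball into the `p`-adic integers, where the residue modulo `p`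
of each coordinate selects one of `p ^ n` smaller balls. -/
lemma pball_succ_eq_iUnion (γ : ℤ) (a : Qpn p n) :
    pball (γ + 1) a = ⋃ i : Fin n → Fin p,
      pball γ (a + fun j => (p : ℚ_[p]) ^ (-(γ + 1)) * ((i j : ℕ) : ℚ_[p])) := by
  have hp0 : (p : ℚ_[p]) ≠ 0 := by exact_mod_cast (Fact.out : p.Prime).ne_zero
  have hpos := zpow_prime_pos (p := p)
  ext y
  simp only [Set.mem_iUnion, mem_pball]
  constructor
  · intro hy
    rw [pi_norm_le_iff_of_nonneg (hpos _).le] at hy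
    have hz : ∀ j, ‖(p : ℚ_[p]) ^ (γ + 1) * (y j - a j)‖ ≤ 1 := fun j => by
      rw [norm_mul, Padic.norm_p_zpow, zpow_neg, inv_mul_le_iff₀ (hpos _), mul_one]
      exact hy j
    obtain ⟨z, hzy⟩ : ∃ z : Fin n → ℤ_[p], ∀ j,
        (z j : ℚ_[p]) = (p : ℚ_[p]) ^ (γ + 1) * (y j - a j) := ⟨fun j => ⟨_, hz j⟩, fun _ => rfl⟩
    refine ⟨fun j => ⟨(z j).zmodRepr, (z j).zmodRepr_lt_p⟩, ?_⟩
    rw [pi_norm_le_iff_of_nonneg (hpos _).le]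
    intro j
    have h1 : ‖z j - ((z j).zmodRepr : ℤ_[p])‖ < 1 :=
      PadicInt.mem_nonunits.1 ((z j).sub_zmodRepr_mem)
    rw [PadicInt.norm_def] at h1
    have h2 : (y - (a + fun j => (p : ℚ_[p]) ^ (-(γ + 1)) * (((z j).zmodRepr : ℕ) : ℚ_[p]))) j
        = (p : ℚ_[p]) ^ (-(γ + 1)) * ((z j - ((z j).zmodRepr : ℤ_[p]) : ℤ_[p]) : ℚ_[p]) := by
      simp only [Pi.sub_apply, Pi.add_apply, PadicInt.coe_sub, PadicInt.coe_natCast, hzy]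
      rw [mul_sub, ← mul_assoc, ← zpow_add₀ hp0]
      simp [sub_sub]
    -- Nonzero norms are powers of `p`, so being at most `p ^ γ` is the same as being strictly below
    -- `p ^ (γ + 1)`.
    rw [h2, Padic.norm_le_pow_iff_norm_lt_pow_add_one, norm_mul, Padic.norm_p_zpow, neg_neg]
    exact mul_lt_of_lt_one_right (hpos _) h1
  · rintro ⟨i, hi⟩
    refine (norm_sub_le_max_qpn y _ a).trans (max_le (hi.trans ?_) ?_)
    · exact zpow_le_zpow_right₀ (one_lt_prime_real p).le (by lia)
    · rw [pi_norm_le_iff_of_nonneg (hpos _).le]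
      intro j
      simp only [add_sub_cancel_left, norm_mul, Padic.norm_p_zpow, neg_neg]
      refine mul_le_of_le_one_right (hpos _).le ?_
      exact_mod_cast Padic.norm_int_le_one (p := p) ((i j : ℕ) : ℤ)

lemma pairwise_disjoint_pball_succ (γ : ℤ) (a : Qpn p n) :
    Pairwise (Function.onFun Disjoint fun i : Fin n → Fin p =>
      pball γ (a + fun j => (p : ℚ_[p]) ^ (-(γ + 1)) * ((i j : ℕ) : ℚ_[p]))) := by
  have hpos := zpow_prime_pos (p := p)
  intro i i' hii
  rw [Function.onFun, Set.disjoint_left]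
  intro y hy hy'
  refine hii (funext fun j => ?_)
  have h := pball_eq_of_mem hy ▸ (mem_pball_comm.1 hy')
  rw [mem_pball, pi_norm_le_iff_of_nonneg (hpos _).le] at h
  have hj := h j
  simp only [Pi.sub_apply, Pi.add_apply, add_sub_add_left_eq_sub, ← mul_sub] at hj
  rw [Padic.norm_le_pow_iff_norm_lt_pow_add_one, norm_mul, Padic.norm_p_zpow, neg_neg,
    mul_lt_iff_lt_one_right (hpos _)] at hj
  have hj' : ‖((((i' j : ℕ) : ℤ) - ((i j : ℕ) : ℤ) : ℤ) : ℚ_[p])‖ < 1 := by push_cast; exact hj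
  rw [Padic.norm_intCast_lt_one_iff] at hj'
  have h2 : ((i' j : ℕ) : ℤ) ≡ ((i j : ℕ) : ℤ) [ZMOD p] :=
    (Int.modEq_iff_dvd.2 hj').symm
  rw [Int.natCast_modEq_iff] at h2
  exact Fin.ext (h2.eq_of_lt_of_lt (i' j).2 (i j).2).symm

/-- The measure `p ^ (n γ)` of a ball of radius `p ^ γ`. -/
noncomputable def ballVol (p n : ℕ) (γ : ℤ) : ℝ≥0∞ := (p : ℝ≥0∞) ^ ((n : ℝ) * γ)

lemma prime_ne_zero (p : ℕ) [Fact p.Prime] : (p : ℝ≥0∞) ≠ 0 := by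
  exact_mod_cast (Fact.out : p.Prime).ne_zero

lemma one_le_prime (p : ℕ) [Fact p.Prime] : 1 ≤ (p : ℝ≥0∞) := by
  exact_mod_cast (Fact.out : p.Prime).one_lt.le

lemma haar_pball_eq_center (γ : ℤ) (x : Qpn p n) :
    haar p n (pball γ x) = haar p n (pball γ 0) := by
  have : pball γ x = (fun y => x + y) '' pball γ (0 : Qpn p n) := by
    rw [Set.image_add_left]
    ext y
    simp [mem_pball, neg_add_eq_sub]
  rw [this, Set.image_add_left, measure_preimage_add]

lemma haar_pball_succ (γ : ℤ) (x : Qpn p n) :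
    haar p n (pball (γ + 1) x) = (p : ℝ≥0∞) ^ (n : ℝ) * haar p n (pball γ x) := by
  rw [pball_succ_eq_iUnion, measure_iUnion (pairwise_disjoint_pball_succ γ x)
    fun i => measurableSet_pball _ _, tsum_fintype]
  simp_rw [haar_pball_eq_center γ]
  simp

lemma haar_pball (γ : ℤ) (x : Qpn p n) : haar p n (pball γ x) = ballVol p n γ := by
  have h0 : haar p n (pball 0 0) = 1 := by
    have : pball 0 (0 : Qpn p n) = (unitBall p n : Set (Qpn p n)) := by
      rw [pball, zpow_zero]
      rfl
    rw [this]
    exact Measure.addHaarMeasure_self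
  have hstep : ∀ γ : ℤ, ballVol p n (γ + 1) = (p : ℝ≥0∞) ^ (n : ℝ) * ballVol p n γ := fun γ => by
    rw [ballVol, ballVol, ← ENNReal.rpow_add _ _ (prime_ne_zero p) (ENNReal.natCast_ne_top p)]
    congr 1; push_cast; ring
  rw [haar_pball_eq_center]
  induction γ using Int.induction_on with
  | zero => simp [h0, ballVol]
  | succ k ih => rw [haar_pball_succ, ih, hstep]
  | pred k ih =>
    have h1 := haar_pball_succ (-(k : ℤ) - 1) (0 : Qpn p n)
    have h2 := hstep (-(k : ℤ) - 1)
    rw [sub_add_cancel] at h1 h2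
    rw [ih, h2] at h1
    have hc0 : (p : ℝ≥0∞) ^ (n : ℝ) ≠ 0 := by simp [(Fact.out : p.Prime).ne_zero]
    have hct : (p : ℝ≥0∞) ^ (n : ℝ) ≠ ∞ := by simp
    exact ((ENNReal.mul_right_inj hc0 hct).1 h1).symm

variable (p n) in
lemma ballVol_ne_zero (γ : ℤ) : ballVol p n γ ≠ 0 := by
  rw [ballVol]
  exact (ENNReal.rpow_pos (pos_iff_ne_zero.2 (prime_ne_zero p)) (ENNReal.natCast_ne_top p)).ne'

variable (p n) in
lemma ballVol_ne_top (γ : ℤ) : ballVol p n γ ≠ ∞ := by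
  rw [ballVol]
  exact ENNReal.rpow_ne_top_of_ne_zero (prime_ne_zero p) (ENNReal.natCast_ne_top p)

variable (p n) in
lemma ballVol_mono {γ γ' : ℤ} (h : γ ≤ γ') : ballVol p n γ ≤ ballVol p n γ' := by
  apply ENNReal.rpow_le_rpow_of_exponent_le (one_le_prime p)
  gcongr

end Balls

/-! ### Ball averages and the weak type inequality. -/

section Averages

variable {p : ℕ} [Fact p.Prime] {n : ℕ}

/-- The average of `F` over the ball `B_γ(x)`. -/
noncomputable def ballAvg (γ : ℤ) (F : Qpn p n → ℝ≥0∞) (x : Qpn p n) : ℝ≥0∞ :=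
  (∫⁻ y in pball γ x, F y ∂(haar p n)) / ballVol p n γ

/-- The Hardy–Littlewood maximal function over balls centred at the point. -/
noncomputable def hlMax (F : Qpn p n → ℝ≥0∞) (x : Qpn p n) : ℝ≥0∞ := ⨆ γ : ℤ, ballAvg γ F x

lemma ballAvg_le_hlMax (γ : ℤ) (F : Qpn p n → ℝ≥0∞) (x : Qpn p n) :
    ballAvg γ F x ≤ hlMax F x := le_iSup (fun γ => ballAvg γ F x) γ

lemma ballAvg_mul_ballVol (γ : ℤ) (F : Qpn p n → ℝ≥0∞) (x : Qpn p n) :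
    ballAvg γ F x * ballVol p n γ = ∫⁻ y in pball γ x, F y ∂(haar p n) :=
  ENNReal.div_mul_cancel (ballVol_ne_zero p n γ) (ballVol_ne_top p n γ)

lemma ballAvg_eq_of_mem {γ γ' : ℤ} (h : γ ≤ γ') (F : Qpn p n → ℝ≥0∞) {x y : Qpn p n}
    (hy : y ∈ pball γ x) : ballAvg γ' F y = ballAvg γ' F x := by
  rw [ballAvg, ballAvg, pball_eq_of_mem (pball_mono h x hy)]

/-- Balls of equal radius coincide as soon as they meet. Every maximal function is therefore a
countable supremum of continuous functions, which settles its measurability even when the function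
averaged is not measurable. -/
lemma isLocallyConstant_ballAvg (γ : ℤ) (F : Qpn p n → ℝ≥0∞) :
    IsLocallyConstant (ballAvg γ F) := by
  rw [IsLocallyConstant.iff_eventually_eq]
  intro x
  filter_upwards [pball_mem_nhds γ x] with y hy
  exact ballAvg_eq_of_mem le_rfl F hy

lemma measurable_ballAvg (γ : ℤ) (F : Qpn p n → ℝ≥0∞) : Measurable (ballAvg γ F) :=
  (isLocallyConstant_ballAvg γ F).continuous.measurable

lemma measurable_hlMax (F : Qpn p n → ℝ≥0∞) : Measurable (hlMax F) :=
  Measurable.iSup fun γ => measurable_ballAvg γ F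

lemma ballAvg_mono_ae {γ : ℤ} {F G : Qpn p n → ℝ≥0∞} {x : Qpn p n}
    (h : ∀ᵐ y ∂((haar p n).restrict (pball γ x)), F y ≤ G y) : ballAvg γ F x ≤ ballAvg γ G x := by
  rw [ballAvg, ballAvg]
  gcongr ?_ / _
  exact lintegral_mono_ae h

lemma ballAvg_mono {F G : Qpn p n → ℝ≥0∞} (h : F ≤ G) (γ : ℤ) (x : Qpn p n) :
    ballAvg γ F x ≤ ballAvg γ G x := ballAvg_mono_ae (Filter.Eventually.of_forall h)

lemma ballAvg_congr_ae {F G : Qpn p n → ℝ≥0∞} (h : F =ᵐ[haar p n] G) (γ : ℤ) (x : Qpn p n) :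
    ballAvg γ F x = ballAvg γ G x := by
  rw [ballAvg, ballAvg, lintegral_congr_ae (ae_restrict_of_ae h)]

lemma ballAvg_add {F G : Qpn p n → ℝ≥0∞} (hF : AEMeasurable F (haar p n)) (γ : ℤ) (x : Qpn p n) :
    ballAvg γ (fun y => F y + G y) x = ballAvg γ F x + ballAvg γ G x := by
  rw [ballAvg, lintegral_add_left' hF.restrict, ENNReal.add_div]; rfl

lemma ballAvg_const (c : ℝ≥0∞) (γ : ℤ) (x : Qpn p n) : ballAvg γ (fun _ => c) x = c := by
  rw [ballAvg, setLIntegral_const, haar_pball]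
  exact ENNReal.mul_div_cancel_right (ballVol_ne_zero p n γ) (ballVol_ne_top p n γ)

lemma ballAvg_le_lintegral_div (γ : ℤ) (F : Qpn p n → ℝ≥0∞) (x : Qpn p n) :
    ballAvg γ F x ≤ (∫⁻ y, F y ∂(haar p n)) / ballVol p n γ := by
  rw [ballAvg]
  gcongr ?_ / _
  exact setLIntegral_le_lintegral _ _

lemma hlMax_mono {F G : Qpn p n → ℝ≥0∞} (h : F ≤ G) (x : Qpn p n) : hlMax F x ≤ hlMax G x :=
  iSup_mono fun γ => ballAvg_mono h γ x

lemma hlMax_add_const_le {F : Qpn p n → ℝ≥0∞} (c : ℝ≥0∞) (x : Qpn p n) :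
    hlMax (fun y => c + F y) x ≤ c + hlMax F x := by
  refine iSup_le fun γ => ?_
  rw [ballAvg_add aemeasurable_const, ballAvg_const]
  gcongr
  exact ballAvg_le_hlMax γ F x

/-- Jensen's inequality for averages over balls. -/
lemma ballAvg_rpow_le {F : Qpn p n → ℝ≥0∞} (hF : AEMeasurable F (haar p n)) {t : ℝ} (ht : 1 ≤ t)
    (γ : ℤ) (x : Qpn p n) : ballAvg γ F x ^ t ≤ ballAvg γ (fun y => F y ^ t) x := by
  have ht0 : 0 < t := zero_lt_one.trans_le ht
  -- For the normalized measure on the ball, Jensen's inequality is the monotonicity of `L^t` norms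
  -- in the exponent.
  let ν : Measure (Qpn p n) := (ballVol p n γ)⁻¹ • (haar p n).restrict (pball γ x)
  have : IsProbabilityMeasure ν := ⟨by
    simp only [ν, Measure.smul_apply, Measure.restrict_apply_univ, haar_pball, smul_eq_mul]
    exact ENNReal.inv_mul_cancel (ballVol_ne_zero p n γ) (ballVol_ne_top p n γ)⟩
  have hν : ∀ G : Qpn p n → ℝ≥0∞, ∫⁻ y, G y ∂ν = ballAvg γ G x := fun G => by
    rw [lintegral_smul_measure, smul_eq_mul, mul_comm]; rfl
  have hFν : AEStronglyMeasurable F ν := (hF.restrict.smul_measure _).aestronglyMeasurable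
  have h := eLpNorm'_le_eLpNorm'_of_exponent_le zero_lt_one ht ν hFν
  simp only [eLpNorm', enorm_eq_self, ENNReal.rpow_one, div_one, hν] at h
  calc ballAvg γ F x ^ t ≤ (ballAvg γ (fun y => F y ^ t) x ^ (1 / t)) ^ t := by gcongr
    _ = _ := by rw [← ENNReal.rpow_mul, one_div_mul_cancel ht0.ne', ENNReal.rpow_one]

/-- Averaging at scale `γ` preserves the integral over a set that is a union of balls of
radius `p ^ γ`. -/
lemma setLIntegral_ballAvg {F : Qpn p n → ℝ≥0∞} (hF : AEMeasurable F (haar p n)) {γ : ℤ}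
    {E : Set (Qpn p n)} (hE : MeasurableSet E) (hinv : ∀ x ∈ E, pball γ x ⊆ E) :
    ∫⁻ x in E, ballAvg γ F x ∂(haar p n) = ∫⁻ x in E, F x ∂(haar p n) := by
  have hV0 := ballVol_ne_zero p n γ
  have hVt := ballVol_ne_top p n γ
  -- Tonelli on the pairs at distance at most `p ^ γ` with first entry in `E`. Since `E` absorbs
  -- balls of this radius, the fibre over `y ∈ E` is the full ball around `y`, and the fibre over `y
  -- ∉ E` is empty.
  let D : Set (Qpn p n × Qpn p n) := {z | z.1 ∈ E ∧ z.2 ∈ pball γ z.1}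
  have hD : MeasurableSet D := by
    have h : {z : Qpn p n × Qpn p n | z.2 ∈ pball γ z.1} = {z | ‖z.2 - z.1‖ ≤ (p : ℝ) ^ γ} := by
      ext z; exact mem_pball
    have h' : IsClosed {z : Qpn p n × Qpn p n | z.2 ∈ pball γ z.1} := by
      rw [h]; exact isClosed_le (by fun_prop) continuous_const
    exact (measurable_fst hE).inter h'.measurableSet
  have hmeas : AEMeasurable (fun z => D.indicator (fun z => F z.2) z)
      ((haar p n).prod (haar p n)) := (hF.comp_snd).indicator hD
  have hswap := lintegral_lintegral_swap (f := fun x y => D.indicator (fun z => F z.2) (x, y)) hmeas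
  have h1 : ∀ x, ∫⁻ y, D.indicator (fun z => F z.2) (x, y) ∂(haar p n)
      = E.indicator (fun x => ballAvg γ F x * ballVol p n γ) x := fun x => by
    by_cases hx : x ∈ E
    · rw [Set.indicator_of_mem hx, ballAvg_mul_ballVol, ← lintegral_indicator
        (measurableSet_pball γ x)]
      refine lintegral_congr fun y => ?_
      classical
      rw [Set.indicator_apply, Set.indicator_apply]
      exact if_congr (and_iff_right hx) rfl rfl
    · simp [Set.indicator, D, hx]
  have h2 : ∀ y, ∫⁻ x, D.indicator (fun z => F z.2) (x, y) ∂(haar p n)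
      = E.indicator (fun y => F y * ballVol p n γ) y := fun y => by
    by_cases hy : y ∈ E
    · rw [Set.indicator_of_mem hy, ← haar_pball γ y, ← setLIntegral_const,
        ← lintegral_indicator (measurableSet_pball γ y)]
      refine lintegral_congr fun x => ?_
      have : (x ∈ E ∧ y ∈ pball γ x) ↔ x ∈ pball γ y :=
        ⟨fun h => mem_pball_comm.1 h.2, fun h => ⟨hinv y hy h, mem_pball_comm.1 h⟩⟩
      classical
      rw [Set.indicator_apply, Set.indicator_apply]
      exact if_congr this rfl rfl
    · have : ∀ x, ¬ (x ∈ E ∧ y ∈ pball γ x) := fun x h => hy (hinv x h.1 h.2)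
      simp [Set.indicator, D, hy, this]
  simp only [h1, h2] at hswap
  rw [lintegral_indicator hE, lintegral_indicator hE, lintegral_mul_const' _ _ hVt,
    lintegral_mul_const' _ _ hVt] at hswap
  exact (ENNReal.mul_left_inj hV0 hVt).1 hswap

lemma natCast_le_ballVol (hn : 0 < n) (k : ℕ) : (k : ℝ≥0∞) ≤ ballVol p n k := by
  have h1 : ballVol p n k = ((p ^ (n * k) : ℕ) : ℝ≥0∞) := by
    rw [ballVol]
    have : (n : ℝ) * ((k : ℤ) : ℝ) = ((n * k : ℕ) : ℝ) := by push_cast; ring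
    rw [this, ENNReal.rpow_natCast]; push_cast; rfl
  rw [h1]
  have h2 : k ≤ n * k := Nat.le_mul_of_pos_left k hn
  exact_mod_cast (Nat.lt_pow_self (Fact.out : p.Prime).one_lt).le.trans
    (Nat.pow_le_pow_right (Fact.out : p.Prime).pos h2)

/-- The weak type `(1,1)` inequality. -/
lemma hlMax_weak_type (hn : 0 < n) {F : Qpn p n → ℝ≥0∞} (hF : AEMeasurable F (haar p n))
    {l : ℝ≥0∞} (hl : l ≠ 0) :
    l * haar p n {x | l < hlMax F x} ≤ ∫⁻ x, F x ∂(haar p n) := by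
  rcases eq_or_ne (∫⁻ x, F x ∂(haar p n)) ∞ with hI | hI
  · rw [hI]; exact le_top
  -- The points whose largest scale with average above `l` is `γ`. These sets are disjoint, and each
  -- is a union of balls of its own radius, so no covering lemma is needed and the constant is `1`.
  let E : ℤ → Set (Qpn p n) := fun γ =>
    {x | l < ballAvg γ F x ∧ ∀ γ' > γ, ballAvg γ' F x ≤ l}
  have hEm : ∀ γ, MeasurableSet (E γ) := fun γ => by
    have h : E γ = {x | l < ballAvg γ F x} ∩ ⋂ γ' > γ, {x | ballAvg γ' F x ≤ l} := by
      ext x; simp [E]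
    rw [h]
    exact (measurableSet_lt measurable_const (measurable_ballAvg γ F)).inter
      (MeasurableSet.iInter fun γ' => MeasurableSet.iInter fun _ =>
        measurableSet_le (measurable_ballAvg γ' F) measurable_const)
  have hEinv : ∀ γ, ∀ x ∈ E γ, pball γ x ⊆ E γ := fun γ x hx y hy => by
    refine ⟨?_, fun γ' hγ' => ?_⟩
    · rw [ballAvg_eq_of_mem le_rfl F hy]; exact hx.1
    · rw [ballAvg_eq_of_mem (le_of_lt hγ') F hy]; exact hx.2 γ' hγ'
  have hEd : Pairwise (Function.onFun Disjoint E) := fun γ γ' hne => by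
    rw [Function.onFun, Set.disjoint_left]
    intro x hx hx'
    rcases lt_or_gt_of_ne hne with h | h
    · exact (hx.2 γ' h).not_gt hx'.1
    · exact (hx'.2 γ h).not_gt hx.1
  have hcover : {x | l < hlMax F x} ⊆ ⋃ γ, E γ := by
    intro x hx
    obtain ⟨γ₀, hγ₀⟩ := lt_iSup_iff.1 (show l < ⨆ γ, ballAvg γ F x from hx)
    -- The average at scale `γ` is at most the total integral over `ballVol p n γ`, and `ballVol p n
    -- N ≥ N`. So no scale beyond `N` has average above `l`, and a largest scale exists.
    obtain ⟨N, hN⟩ := ENNReal.exists_nat_gt (ENNReal.div_ne_top hI hl)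
    have hbdd : ∀ γ : ℤ, l < ballAvg γ F x → γ ≤ N := fun γ hγ => by
      by_contra! hlt
      refine absurd (hγ.trans_le (ballAvg_le_lintegral_div γ F x)) (not_lt.2 ?_)
      refine ENNReal.div_le_of_le_mul ?_
      rw [mul_comm]
      refine (ENNReal.div_le_iff_le_mul (Or.inl hl) (Or.inr (ballVol_ne_zero p n γ))).1 ?_
      exact hN.le.trans ((natCast_le_ballVol hn N).trans (ballVol_mono p n hlt.le))
    obtain ⟨γ, hγ, hmax⟩ := Int.exists_greatest_of_bdd ⟨N, hbdd⟩ ⟨γ₀, hγ₀⟩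
    refine Set.mem_iUnion.2 ⟨γ, hγ, fun γ' hγ' => ?_⟩
    by_contra! h
    exact absurd (hmax γ' h) (not_le.2 hγ')
  calc l * haar p n {x | l < hlMax F x} ≤ l * ∑' γ, haar p n (E γ) := by
        gcongr
        exact (measure_mono hcover).trans (measure_iUnion_le _)
    _ = ∑' γ, l * haar p n (E γ) := ENNReal.tsum_mul_left.symm
    _ ≤ ∑' γ, ∫⁻ x in E γ, F x ∂(haar p n) := by
        refine ENNReal.tsum_le_tsum fun γ => ?_
        rw [← setLIntegral_ballAvg hF (hEm γ) (hEinv γ), ← setLIntegral_const]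
        exact setLIntegral_mono' (hEm γ) fun x hx => hx.1.le
    _ = ∫⁻ x in ⋃ γ, E γ, F x ∂(haar p n) := (lintegral_iUnion hEm hEd F).symm
    _ ≤ ∫⁻ x, F x ∂(haar p n) := setLIntegral_le_lintegral _ _

/-- Where `hlMax F` is infinite it exceeds every level; the weak type inequality at a level above `∫
F / ε` bounds the measure of that set by `ε`. -/
lemma ae_hlMax_lt_top (hn : 0 < n) {F : Qpn p n → ℝ≥0∞} (hF : AEMeasurable F (haar p n))
    (hI : ∫⁻ x, F x ∂(haar p n) ≠ ∞) : ∀ᵐ x ∂(haar p n), hlMax F x < ∞ := by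
  rw [ae_iff]
  refine le_antisymm (ENNReal.le_of_forall_pos_le_add fun ε hε _ => ?_) zero_le
  have hε' : (ε : ℝ≥0∞) ≠ 0 := by exact_mod_cast hε.ne'
  obtain ⟨N, hN⟩ := ENNReal.exists_nat_gt (ENNReal.div_ne_top hI hε')
  have hN0 : (N : ℝ≥0∞) ≠ 0 := (zero_le.trans_lt hN).ne'
  have h := hlMax_weak_type hn hF hN0
  rw [zero_add]
  have h1 : haar p n {x | ¬ hlMax F x < ∞} ≤ haar p n {x | (N : ℝ≥0∞) < hlMax F x} := by
    refine measure_mono fun x hx => ?_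
    simp only [Set.mem_ofPred_eq, not_lt, top_le_iff] at hx ⊢
    rw [hx]; exact ENNReal.natCast_lt_top N
  refine h1.trans ?_
  have h2 := (ENNReal.div_le_iff_le_mul (Or.inl hε') (Or.inr hN0)).1 hN.le
  have h3 := h.trans h2
  exact (ENNReal.mul_le_mul_iff_right hN0 (ENNReal.natCast_ne_top N)).1 h3

end Averages

/-! ### The Hardy–Littlewood maximal theorem by the layer-cake formula. -/

section StrongType

variable {p : ℕ} [Fact p.Prime] {n : ℕ}

/-- The weak type inequality with only the large part of the function on the right. -/
lemma hlMax_weak_type_large (hn : 0 < n) {F : Qpn p n → ℝ≥0∞} (hF : AEMeasurable F (haar p n))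
    {l : ℝ≥0∞} (hl : l ≠ 0) :
    l * haar p n {x | l < hlMax F x} ≤
      2 * ∫⁻ x, {x | l < 2 * F x}.indicator F x ∂(haar p n) := by
  have hl2 : l / 2 ≠ 0 := by simp [hl]
  have hm : NullMeasurableSet {x | l < 2 * F x} (haar p n) :=
    nullMeasurableSet_lt aemeasurable_const (hF.const_mul 2)
  -- The values of `F` up to `l / 2` raise the maximal function by at most `l / 2`, so exceeding `l`
  -- forces the remaining part to exceed `l / 2`.
  have hle : F ≤ fun x => l / 2 + {x | l < 2 * F x}.indicator F x := fun x => by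
    by_cases hx : l < 2 * F x
    · change F x ≤ l / 2 + {x | l < 2 * F x}.indicator F x
      rw [Set.indicator_of_mem (show x ∈ {x | l < 2 * F x} from hx)]
      exact le_add_self
    · refine le_add_right ?_
      rw [ENNReal.le_div_iff_mul_le (by simp) (by simp), mul_comm]
      exact not_lt.1 hx
  have hsub : {x | l < hlMax F x} ⊆ {x | l / 2 < hlMax ({x | l < 2 * F x}.indicator F) x} := by
    intro x hx
    have h1 : l < l / 2 + hlMax ({x | l < 2 * F x}.indicator F) x :=
      lt_of_lt_of_le hx ((hlMax_mono hle x).trans (hlMax_add_const_le _ x))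
    by_contra h
    have h2 : hlMax ({x | l < 2 * F x}.indicator F) x ≤ l / 2 := not_lt.1 h
    have : l < l / 2 + l / 2 := h1.trans_le (by gcongr)
    rw [ENNReal.add_halves] at this
    exact this.false
  calc l * haar p n {x | l < hlMax F x}
      ≤ 2 * (l / 2) * haar p n {x | l / 2 < hlMax ({x | l < 2 * F x}.indicator F) x} := by
        rw [ENNReal.mul_div_cancel (by simp) (by simp)]
        gcongr
    _ ≤ _ := by
        rw [mul_assoc]
        gcongr
        exact hlMax_weak_type hn (hF.indicator₀ hm) hl2

/-- The inner integral of the layer-cake computation once the order of integration is exchanged,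
applied with `c = 2 * F x`. -/
lemma lintegral_rpow_lt_le {t : ℝ} (ht : 1 < t) (c : ℝ≥0∞) :
    ∫⁻ l in Set.Ioi (0 : ℝ), {l : ℝ | ENNReal.ofReal l < c}.indicator
      (fun l => ENNReal.ofReal (l ^ (t - 2))) l ≤ ENNReal.ofReal (t - 1)⁻¹ * c ^ (t - 1) := by
  have ht1 : 0 < t - 1 := sub_pos.2 ht
  rcases eq_or_ne c ∞ with rfl | hc
  · rw [ENNReal.top_rpow_of_pos ht1, ENNReal.mul_top]
    · exact le_top
    · simpa using ht
  lift c to ℝ≥0 using hc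
  have hset : ∀ l ∈ Set.Ioi (0 : ℝ), {l : ℝ | ENNReal.ofReal l < c}.indicator
      (fun l => ENNReal.ofReal (l ^ (t - 2))) l = (Set.Ioo 0 (c : ℝ)).indicator
      (fun l => ENNReal.ofReal (l ^ (t - 2))) l := fun l hl => by
    classical
    rw [Set.indicator_apply, Set.indicator_apply]
    refine if_congr ?_ rfl rfl
    have hl' : 0 < l := hl
    change ENNReal.ofReal l < c ↔ l ∈ Set.Ioo 0 (c : ℝ)
    rw [Set.mem_Ioo, and_iff_right hl', ← ENNReal.ofReal_coe_nnreal]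
    exact ENNReal.ofReal_lt_ofReal_iff'.trans (and_iff_left_of_imp fun h => hl'.trans h)
  rw [setLIntegral_congr_fun measurableSet_Ioi hset, setLIntegral_indicator measurableSet_Ioo,
    Set.inter_eq_left.2 Set.Ioo_subset_Ioi_self]
  have hintegrable : IntervalIntegrable (fun l : ℝ => l ^ (t - 2)) volume 0 c :=
    intervalIntegral.intervalIntegrable_rpow' (by linarith)
  rw [intervalIntegrable_iff_integrableOn_Ioo_of_le c.coe_nonneg] at hintegrable
  rw [← ofReal_integral_eq_lintegral_ofReal hintegrable ?_]
  · rw [← integral_Ioc_eq_integral_Ioo, ← intervalIntegral.integral_of_le c.coe_nonneg,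
      integral_rpow (Or.inl (by linarith))]
    have e : t - 2 + 1 = t - 1 := by ring
    rw [e, Real.zero_rpow ht1.ne', sub_zero, div_eq_inv_mul, ENNReal.ofReal_mul (by positivity),
      ← ENNReal.ofReal_rpow_of_nonneg c.coe_nonneg ht1.le, ENNReal.ofReal_coe_nnreal]
  · filter_upwards [ae_restrict_mem measurableSet_Ioo] with l hl
    exact Real.rpow_nonneg hl.1.le _

/-- The Hardy–Littlewood maximal theorem. -/
lemma lintegral_hlMax_rpow_le (hn : 0 < n) {t : ℝ} (ht : 1 < t) :
    ∃ C : ℝ≥0∞, C ≠ ∞ ∧ ∀ F : Qpn p n → ℝ≥0∞, AEMeasurable F (haar p n) →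
      ∫⁻ x, hlMax F x ^ t ∂(haar p n) ≤ C * ∫⁻ x, F x ^ t ∂(haar p n) := by
  have ht0 : 0 < t := zero_lt_one.trans ht
  have ht1 : 0 < t - 1 := sub_pos.2 ht
  let K : ℝ≥0∞ := ENNReal.ofReal t * (2 * (ENNReal.ofReal (t - 1)⁻¹ * 2 ^ (t - 1)))
  have hK0 : K ≠ 0 := by simp [K, ht0, ht1]
  have hKt : K ≠ ∞ := by
    refine ENNReal.mul_ne_top ENNReal.ofReal_ne_top (ENNReal.mul_ne_top (by simp)
      (ENNReal.mul_ne_top ENNReal.ofReal_ne_top (ENNReal.rpow_ne_top_of_nonneg ht1.le (by simp))))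
  refine ⟨K, hKt, fun F hF => ?_⟩
  rcases eq_or_ne (∫⁻ x, F x ^ t ∂(haar p n)) ∞ with hI | hI
  · rw [hI, ENNReal.mul_top hK0]; exact le_top
  have hFt : AEMeasurable (fun x => F x ^ t) (haar p n) := hF.pow_const t
  -- The layer-cake formula needs a real-valued function, so finiteness of `hlMax F` comes first.
  -- This bound reduces it to the integrable function `F ^ t`.
  have hle : F ≤ fun x => 1 + F x ^ t := fun x => by
    rcases le_total (F x) 1 with h | h
    · exact h.trans (le_self_add)
    · refine le_add_left ?_
      simpa using ENNReal.rpow_le_rpow_of_exponent_le h ht.le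
  have hfin : ∀ᵐ x ∂(haar p n), hlMax F x < ∞ := by
    filter_upwards [ae_hlMax_lt_top hn hFt hI] with x hx
    exact ((hlMax_mono hle x).trans (hlMax_add_const_le _ x)).trans_lt (by simp [hx])
  have h1 : ∫⁻ x, hlMax F x ^ t ∂(haar p n) =
      ∫⁻ x, ENNReal.ofReal ((hlMax F x).toReal ^ t) ∂(haar p n) := by
    refine lintegral_congr_ae ?_
    filter_upwards [hfin] with x hx
    rw [← ENNReal.ofReal_rpow_of_nonneg ENNReal.toReal_nonneg ht0.le, ENNReal.ofReal_toReal hx.ne]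
  rw [h1, lintegral_rpow_eq_lintegral_meas_lt_mul _
    (Filter.Eventually.of_forall fun x => ENNReal.toReal_nonneg)
    (measurable_hlMax F).ennreal_toReal.aemeasurable ht0]
  have h2 : ∀ l ∈ Set.Ioi (0 : ℝ), haar p n {x | l < (hlMax F x).toReal} *
      ENNReal.ofReal (l ^ (t - 1)) ≤
      2 * ∫⁻ x, {z : ℝ × Qpn p n | ENNReal.ofReal z.1 < 2 * F z.2}.indicator
        (fun z => ENNReal.ofReal (z.1 ^ (t - 2)) * F z.2) (l, x) ∂(haar p n) := fun l hl => by
    have hl0 : 0 < l := hl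
    have hw := hlMax_weak_type_large hn hF (l := ENNReal.ofReal l) (by simpa using hl0)
    -- One factor `l` is spent on the weak type inequality; `l ^ (t - 2)` is left and is integrable
    -- at `0` because `t > 1`.
    have e1 : ENNReal.ofReal (l ^ (t - 1)) = ENNReal.ofReal (l ^ (t - 2)) * ENNReal.ofReal l := by
      rw [← ENNReal.ofReal_mul (Real.rpow_nonneg hl0.le _)]
      nth_rw 3 [← Real.rpow_one l]
      rw [← Real.rpow_add hl0]
      congr 2; ring
    have e2 : {x | l < (hlMax F x).toReal} ⊆ {x | ENNReal.ofReal l < hlMax F x} := fun x hx =>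
      (ENNReal.ofReal_lt_iff_lt_toReal hl0.le fun h => by
        have hx' : l < (hlMax F x).toReal := hx
        rw [h, ENNReal.toReal_top] at hx'
        exact hx'.not_ge hl0.le).2 hx
    have e3 : ∀ x, {z : ℝ × Qpn p n | ENNReal.ofReal z.1 < 2 * F z.2}.indicator
        (fun z => ENNReal.ofReal (z.1 ^ (t - 2)) * F z.2) (l, x) = ENNReal.ofReal (l ^ (t - 2)) *
          {x | ENNReal.ofReal l < 2 * F x}.indicator F x := fun x => by
      by_cases hx : ENNReal.ofReal l < 2 * F x <;> simp [Set.indicator, hx]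
    simp_rw [e3]
    rw [lintegral_const_mul' _ _ ENNReal.ofReal_ne_top]
    calc haar p n {x | l < (hlMax F x).toReal} * ENNReal.ofReal (l ^ (t - 1))
        ≤ ENNReal.ofReal (l ^ (t - 2)) *
          (ENNReal.ofReal l * haar p n {x | ENNReal.ofReal l < hlMax F x}) := by
          rw [e1, mul_comm, mul_assoc]
          gcongr
      _ ≤ ENNReal.ofReal (l ^ (t - 2)) *
          (2 * ∫⁻ x, {x | ENNReal.ofReal l < 2 * F x}.indicator F x ∂(haar p n)) := by gcongr
      _ = _ := by ring
  have hmeas : AEMeasurable (fun z => {z : ℝ × Qpn p n | ENNReal.ofReal z.1 < 2 * F z.2}.indicator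
        (fun z => ENNReal.ofReal (z.1 ^ (t - 2)) * F z.2) z)
      ((volume.restrict (Set.Ioi (0 : ℝ))).prod (haar p n)) := by
    refine AEMeasurable.indicator₀ ?_ ?_
    · exact (by fun_prop : Measurable fun z : ℝ × Qpn p n =>
        ENNReal.ofReal (z.1 ^ (t - 2))).aemeasurable.mul hF.comp_snd
    · exact nullMeasurableSet_lt (by fun_prop) (hF.comp_snd.const_mul 2)
  calc ENNReal.ofReal t * ∫⁻ l in Set.Ioi 0, haar p n {x | l < (hlMax F x).toReal} *
        ENNReal.ofReal (l ^ (t - 1))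
      ≤ ENNReal.ofReal t * (2 * ∫⁻ l in Set.Ioi (0 : ℝ), ∫⁻ x,
        {z : ℝ × Qpn p n | ENNReal.ofReal z.1 < 2 * F z.2}.indicator
        (fun z => ENNReal.ofReal (z.1 ^ (t - 2)) * F z.2) (l, x) ∂(haar p n)) := by
        rw [← lintegral_const_mul' _ _ (by simp : (2 : ℝ≥0∞) ≠ ∞)]
        exact mul_le_mul_right (setLIntegral_mono' measurableSet_Ioi h2) _
    _ = ENNReal.ofReal t * (2 * ∫⁻ x, (∫⁻ l in Set.Ioi (0 : ℝ),
        {z : ℝ × Qpn p n | ENNReal.ofReal z.1 < 2 * F z.2}.indicator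
        (fun z => ENNReal.ofReal (z.1 ^ (t - 2)) * F z.2) (l, x)) ∂(haar p n)) := by
        rw [lintegral_lintegral_swap hmeas]
    _ ≤ ENNReal.ofReal t * (2 * ∫⁻ x, (ENNReal.ofReal (t - 1)⁻¹ * 2 ^ (t - 1)) * F x ^ t
          ∂(haar p n)) := by
        gcongr with x
        have e : ∀ l : ℝ, {z : ℝ × Qpn p n | ENNReal.ofReal z.1 < 2 * F z.2}.indicator
            (fun z => ENNReal.ofReal (z.1 ^ (t - 2)) * F z.2) (l, x) =
            {l : ℝ | ENNReal.ofReal l < 2 * F x}.indicator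
              (fun l => ENNReal.ofReal (l ^ (t - 2))) l * F x := fun l => by
          by_cases hx : ENNReal.ofReal l < 2 * F x <;> simp [Set.indicator, hx]
        simp_rw [e]
        have hms : Measurable fun l : ℝ => {l : ℝ | ENNReal.ofReal l < 2 * F x}.indicator
              (fun l => ENNReal.ofReal (l ^ (t - 2))) l :=
          (by fun_prop : Measurable fun l : ℝ => ENNReal.ofReal (l ^ (t - 2))).indicator
            (measurableSet_lt (by fun_prop) measurable_const)
        rw [lintegral_mul_const _ hms]
        calc _ ≤ ENNReal.ofReal (t - 1)⁻¹ * (2 * F x) ^ (t - 1) * F x := by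
              gcongr
              exact lintegral_rpow_lt_le ht _
          _ = _ := by
              rw [ENNReal.mul_rpow_of_nonneg _ _ ht1.le]
              have : F x ^ t = F x ^ (t - 1) * F x := by
                conv_lhs => rw [← sub_add_cancel t 1]
                rw [ENNReal.rpow_add_of_nonneg _ _ ht1.le zero_le_one, ENNReal.rpow_one]
              rw [this]; ring
    _ = K * ∫⁻ x, F x ^ t ∂(haar p n) := by
        rw [lintegral_const_mul'' _ hFt]; ring

end StrongType

/-! ### Log-Hölder exponents at infinity and at small scales. -/

section Exponents

variable {p : ℕ} [Fact p.Prime] {n : ℕ}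

lemma MemP.one_lt_apply {q : Qpn p n → ℝ} (h : MemP q) (x : Qpn p n) : 1 < q x :=
  h.one_lt.trans_le (h.le_apply x)

/-- The integrable weight `(p + |x|) ^ (-(n + 1))`. -/
noncomputable def decay (x : Qpn p n) : ℝ≥0∞ := ENNReal.ofReal ((p + ‖x‖) ^ (-(n + 1) : ℝ))

lemma prime_add_norm_pos (x : Qpn p n) : 0 < (p : ℝ) + ‖x‖ :=
  add_pos_of_pos_of_nonneg (prime_real_pos p) (norm_nonneg x)

/-- The term of the least `k` with `x ∈ B_k(0)` already dominates, since then `p ^ (k - 1) ≤ p +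
|x|`. The terms integrate to a geometric series of ratio `1 / p`. -/
lemma decay_le_tsum (x : Qpn p n) :
    decay x ≤ ∑' k : ℕ, (pball (k : ℤ) (0 : Qpn p n)).indicator
      (fun _ => (p : ℝ≥0∞) ^ (((k : ℝ) - 1) * (-(n + 1)))) x := by
  classical
  have hex : ∃ k : ℕ, x ∈ pball (k : ℤ) (0 : Qpn p n) := by
    obtain ⟨k, hk⟩ := pow_unbounded_of_one_lt ‖x‖ (one_lt_prime_real p)
    exact ⟨k, by rw [mem_pball, sub_zero, zpow_natCast]; exact hk.le⟩
  refine le_trans ?_ (ENNReal.le_tsum (Nat.find hex))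
  rw [Set.indicator_of_mem (Nat.find_spec hex), decay]
  have hb : (p : ℝ) ^ ((Nat.find hex : ℝ) - 1) ≤ p + ‖x‖ := by
    rcases Nat.eq_zero_or_pos (Nat.find hex) with h | h
    · rw [h, Nat.cast_zero, zero_sub, Real.rpow_neg_one]
      have h1 := inv_le_one_of_one_le₀ (one_lt_prime_real p).le
      linarith [one_lt_prime_real p, norm_nonneg x]
    · have h1 := Nat.find_min hex (Nat.sub_lt h one_pos)
      rw [mem_pball, sub_zero, not_le, zpow_natCast, ← Real.rpow_natCast,
        Nat.cast_pred h] at h1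
      linarith [prime_real_pos p]
  have h2 : (p + ‖x‖) ^ (-(n + 1) : ℝ) ≤
      ((p : ℝ) ^ ((Nat.find hex : ℝ) - 1)) ^ (-(n + 1) : ℝ) :=
    Real.rpow_le_rpow_of_nonpos (Real.rpow_pos_of_pos (prime_real_pos p) _) hb
      (by linarith [n.cast_nonneg (α := ℝ)])
  refine (ENNReal.ofReal_le_ofReal h2).trans ?_
  rw [← Real.rpow_mul (prime_real_pos p).le, ← ENNReal.ofReal_rpow_of_pos (prime_real_pos p),
    ENNReal.ofReal_natCast]

variable (p n) in
lemma lintegral_decay_ne_top : ∫⁻ x : Qpn p n, decay x ∂(haar p n) ≠ ∞ := by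
  have h1 : ∫⁻ x : Qpn p n, decay x ∂(haar p n) ≤
      ∑' k : ℕ, (p : ℝ≥0∞) ^ ((n : ℝ) + 1) * ((p : ℝ≥0∞)⁻¹) ^ k := by
    refine (lintegral_mono decay_le_tsum).trans ?_
    rw [lintegral_tsum fun k => (measurable_const.indicator (measurableSet_pball _ _)).aemeasurable]
    refine ENNReal.tsum_le_tsum fun k => ?_
    rw [lintegral_indicator_const (measurableSet_pball _ _), haar_pball, ballVol,
      ← ENNReal.rpow_natCast, ← ENNReal.rpow_neg_one, ← ENNReal.rpow_mul,
      ← ENNReal.rpow_add _ _ (prime_ne_zero p) (ENNReal.natCast_ne_top p),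
      ← ENNReal.rpow_add _ _ (prime_ne_zero p) (ENNReal.natCast_ne_top p)]
    apply le_of_eq
    congr 1; push_cast; ring
  refine (h1.trans_lt ?_).ne
  rw [ENNReal.tsum_mul_left, ENNReal.tsum_geometric]
  refine ENNReal.mul_lt_top (ENNReal.rpow_lt_top_of_nonneg (by positivity) (by simp)) ?_
  rw [ENNReal.inv_lt_top, tsub_pos_iff_lt, ENNReal.inv_lt_one]
  exact_mod_cast (Fact.out : p.Prime).one_lt

lemma one_le_logb_prime_add {t : ℝ} (ht : 0 ≤ t) : 1 ≤ Real.logb p (p + t) := by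
  rw [Real.le_logb_iff_rpow_le (one_lt_prime_real p) (by linarith [prime_real_pos p]),
    Real.rpow_one]
  linarith

/-- Changing an exponent within the decay rate at infinity costs a constant factor and an
integrable error. -/
lemma rpow_le_rpow_add_decay {C a b : ℝ} {x : Qpn p n} {u : ℝ≥0∞} (hu : u ≤ 1) (ha : 1 ≤ a)
    (hab : |a - b| ≤ C / Real.logb p (p + ‖x‖)) :
    u ^ a ≤ ENNReal.ofReal ((p : ℝ) ^ ((n + 1) * C)) * u ^ b + decay x := by
  have hP := prime_add_norm_pos x
  -- If `u` is below the weight, then `u ^ a ≤ u` is part of the error. Otherwise `u ^ (a - b)` is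
  -- at most `(p + |x|) ^ ((n + 1) |a - b|)`, which the logarithmic rate bounds by `p ^ ((n + 1)
  -- C)`.
  rcases le_or_gt u (decay x) with h | h
  · refine le_add_left (le_trans ?_ h)
    simpa using ENNReal.rpow_le_rpow_of_exponent_ge hu ha
  · refine le_add_right ?_
    have hu0 : u ≠ 0 := (zero_le.trans_lt h).ne'
    have hut : u ≠ ∞ := (hu.trans_lt ENNReal.one_lt_top).ne
    have hL : 0 < Real.logb p (p + ‖x‖) :=
      zero_lt_one.trans_le (one_le_logb_prime_add (norm_nonneg x))
    calc u ^ a = u ^ (a - b) * u ^ b := by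
          rw [← ENNReal.rpow_add _ _ hu0 hut, sub_add_cancel]
      _ ≤ u ^ (-|a - b|) * u ^ b := by
          gcongr ?_ * _
          exact ENNReal.rpow_le_rpow_of_exponent_ge hu (neg_abs_le _)
      _ ≤ decay x ^ (-|a - b|) * u ^ b := by
          gcongr ?_ * _
          rw [ENNReal.rpow_neg, ENNReal.rpow_neg]
          gcongr
      _ ≤ _ := by
          gcongr ?_ * _
          rw [decay, ENNReal.ofReal_rpow_of_pos (Real.rpow_pos_of_pos hP _)]
          apply ENNReal.ofReal_le_ofReal
          rw [← Real.rpow_mul hP.le]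
          conv_lhs => rw [← Real.rpow_logb (prime_real_pos p) (one_lt_prime_real p).ne' hP]
          rw [← Real.rpow_mul (prime_real_pos p).le]
          apply Real.rpow_le_rpow_of_exponent_le (one_lt_prime_real p).le
          rw [le_div_iff₀ hL] at hab
          have hn : (0 : ℝ) ≤ n + 1 := by positivity
          nlinarith

/-- Compactness of `[t, T]` supplies a limit value along a sequence escaping to infinity; the
log-Hölder condition then makes it a limit exponent with a rate. -/
lemma exists_tendsto_infty (hn : 0 < n) {r : Qpn p n → ℝ} {t T : ℝ} (ht : ∀ x, t ≤ r x)
    (hT : ∀ x, r x ≤ T) : ∃ (X : ℕ → Qpn p n) (L : ℝ),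
      Filter.Tendsto (fun k => ‖X k‖) Filter.atTop Filter.atTop ∧ L ∈ Set.Icc t T ∧
      Filter.Tendsto (fun k => r (X k)) Filter.atTop (nhds L) := by
  have : Nonempty (Fin n) := ⟨⟨0, hn⟩⟩
  let Y : ℕ → Qpn p n := fun k _ => (p : ℚ_[p]) ^ (-(k : ℤ))
  have hY : ∀ k, ‖Y k‖ = (p : ℝ) ^ k := fun k => by
    simp only [Y]
    rw [pi_norm_const, Padic.norm_p_zpow, neg_neg, zpow_natCast]
  obtain ⟨L, hL, φ, hφ, hlim⟩ := isCompact_Icc.tendsto_subseq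
    (x := fun k => r (Y k)) (s := Set.Icc t T) fun k => ⟨ht _, hT _⟩
  refine ⟨Y ∘ φ, L, ?_, hL, hlim⟩
  simp only [Function.comp, hY]
  exact (tendsto_pow_atTop_atTop_of_one_lt (one_lt_prime_real p)).comp hφ.tendsto_atTop

lemma LogHolderInfty.limit {q : Qpn p n → ℝ} (h : LogHolderInfty q) {X : ℕ → Qpn p n} {L : ℝ}
    (hX : Filter.Tendsto (fun k => ‖X k‖) Filter.atTop Filter.atTop)
    (hL : Filter.Tendsto (fun k => q (X k)) Filter.atTop (nhds L)) :
    ∃ C : ℝ, 0 < C ∧ ∀ x, |q x - L| ≤ C / Real.logb p (p + ‖x‖) := by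
  obtain ⟨C, hC, hq⟩ := h
  refine ⟨C, hC, fun x => ?_⟩
  refine le_of_tendsto ((tendsto_const_nhds.sub hL).abs) ?_
  filter_upwards [hX.eventually_ge_atTop ‖x‖] with k hk
  have := hq x (X k)
  rwa [min_eq_left hk] at this

lemma ae_of_forall_ae_pball (γ : ℤ) {P : Qpn p n → Prop}
    (h : ∀ x, ∀ᵐ y ∂((haar p n).restrict (pball γ x)), P y) : ∀ᵐ y ∂(haar p n), P y := by
  rw [ae_iff]
  refine measure_null_of_locally_null _ fun x _ => ?_
  refine ⟨{y | ¬ P y} ∩ pball γ x, ?_, ?_⟩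
  · exact inter_mem_nhdsWithin _ (pball_mem_nhds γ x)
  · have := h x
    rwa [ae_iff, Measure.restrict_apply' (measurableSet_pball γ x)] at this

/-- The essential infimum of `q` over a ball. -/
noncomputable def ballInf (q : Qpn p n → ℝ) (γ : ℤ) (x : Qpn p n) : ℝ :=
  essInf q ((haar p n).restrict (pball γ x))

instance neBot_ae_pball (γ : ℤ) (x : Qpn p n) :
    (ae ((haar p n).restrict (pball γ x))).NeBot := by
  rw [ae_neBot, Ne, Measure.restrict_eq_zero, haar_pball]
  exact ballVol_ne_zero p n γ

lemma ballInf_eq_of_mem (q : Qpn p n → ℝ) {γ : ℤ} {x y : Qpn p n} (h : y ∈ pball γ x) :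
    ballInf q γ y = ballInf q γ x := by rw [ballInf, ballInf, pball_eq_of_mem h]

lemma MemP.essInf_le_ballInf {q : Qpn p n → ℝ} (hq : MemP q) (γ : ℤ) (x : Qpn p n) :
    essInf q (haar p n) ≤ ballInf q γ x := by
  refine Filter.le_liminf_of_le ?_ (Filter.Eventually.of_forall hq.le_apply)
  exact (Filter.isBoundedUnder_of ⟨_, hq.apply_le⟩).isCoboundedUnder_ge

/-- The local log-Hölder condition in terms of the values of `q`. -/
lemma MemClog.exists_local {q : Qpn p n → ℝ} (hq : MemClog q) :
    ∃ C : ℝ, 0 < C ∧ ∀ (k : ℕ) (x : Qpn p n),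
      ∀ᵐ y ∂((haar p n).restrict (pball (-(k : ℤ)) x)),
        ballInf q (-(k : ℤ)) x ≤ q y ∧ k * (q y - ballInf q (-(k : ℤ)) x) ≤ C := by
  obtain ⟨C, hC, h⟩ := hq.zero
  refine ⟨C, hC, fun k x => ?_⟩
  have hx := h (-(k : ℤ)) x
  have h1 := ae_essInf_le (f := q) (μ := (haar p n).restrict (pball (-(k : ℤ)) x))
    (Filter.isBoundedUnder_of ⟨_, hq.memP.le_apply⟩)
  have h2 := ae_le_essSup (f := q) (μ := (haar p n).restrict (pball (-(k : ℤ)) x))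
    (Filter.isBoundedUnder_of ⟨_, hq.memP.apply_le⟩)
  filter_upwards [h1, h2] with y hy1 hy2
  refine ⟨hy1, le_trans ?_ hx⟩
  push_cast
  rw [neg_mul, ← mul_neg, neg_sub]
  rw [ballInf]
  gcongr

/-- There are only countably many scales, and `ballInf` is constant on balls of its own scale, so
the exceptional null sets can be discarded together. -/
lemma MemClog.exists_local_ae {q : Qpn p n → ℝ} (hq : MemClog q) :
    ∃ C : ℝ, 0 < C ∧ ∀ᵐ x ∂(haar p n), ∀ k : ℕ,
      ballInf q (-(k : ℤ)) x ≤ q x ∧ k * (q x - ballInf q (-(k : ℤ)) x) ≤ C ∧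
      ∀ᵐ y ∂((haar p n).restrict (pball (-(k : ℤ)) x)), ballInf q (-(k : ℤ)) x ≤ q y := by
  obtain ⟨C, hC, h⟩ := hq.exists_local
  refine ⟨C, hC, ae_all_iff.2 fun k => ae_of_forall_ae_pball (-(k : ℤ)) fun x => ?_⟩
  filter_upwards [h k x, ae_restrict_mem (measurableSet_pball _ x)] with y hy hyx
  rw [ballInf_eq_of_mem q hyx, pball_eq_of_mem hyx]
  exact ⟨hy.1, hy.2, (h k x).mono fun z hz => hz.1⟩

end Exponents

/-! ### The fractional maximal operator on variable exponent spaces. -/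

section Fractional

variable {p : ℕ} [Fact p.Prime] {n : ℕ}

/-- The fractional maximal function of a function with values in `[0, ∞]`. -/
noncomputable def fracMaxE (s : ℝ) (F : Qpn p n → ℝ≥0∞) (x : Qpn p n) : ℝ≥0∞ :=
  ⨆ γ : ℤ, ballVol p n γ ^ (s / n) * ballAvg γ F x

lemma setLIntegral_div_rpow_eq (s : ℝ) (γ : ℤ) (F : Qpn p n → ℝ≥0∞) (x : Qpn p n) :
    (∫⁻ y in pball γ x, F y ∂(haar p n)) / (haar p n (pball γ x)) ^ (1 - s / n) =
      ballVol p n γ ^ (s / n) * ballAvg γ F x := by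
  have h0 := ballVol_ne_zero p n γ
  have ht := ballVol_ne_top p n γ
  rw [haar_pball, ballAvg, ENNReal.rpow_sub _ _ h0 ht, ENNReal.rpow_one]
  simp only [div_eq_mul_inv]
  rw [ENNReal.mul_inv (Or.inl h0) (Or.inl ht), inv_inv]
  ring

lemma fracMax_eq_fracMaxE (s : ℝ) (f : Qpn p n → ℝ) (x : Qpn p n) :
    fracMax s f x = fracMaxE s (fun y => ‖f y‖ₑ) x :=
  iSup_congr fun γ => setLIntegral_div_rpow_eq s γ _ x

lemma measurable_fracMaxE (s : ℝ) (F : Qpn p n → ℝ≥0∞) : Measurable (fracMaxE s F) :=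
  Measurable.iSup fun γ => (measurable_ballAvg γ F).const_mul _

lemma le_fracMaxE (s : ℝ) (γ : ℤ) (F : Qpn p n → ℝ≥0∞) (x : Qpn p n) :
    ballVol p n γ ^ (s / n) * ballAvg γ F x ≤ fracMaxE s F x :=
  le_iSup (fun γ => ballVol p n γ ^ (s / n) * ballAvg γ F x) γ

lemma iSup_rpow_le {ι : Sort*} {a : ι → ℝ≥0∞} {c : ℝ≥0∞} {q : ℝ} (hq : 0 < q)
    (h : ∀ i, a i ^ q ≤ c) : (⨆ i, a i) ^ q ≤ c := by
  rw [← ENNReal.le_rpow_inv_iff hq]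
  exact iSup_le fun i => (ENNReal.le_rpow_inv_iff hq).2 (h i)

/-- The algebraic identity behind Hedberg's inequality. -/
lemma rpow_mul_rpow_eq {V : ℝ≥0∞} {σ r q : ℝ} (hσ : 0 ≤ σ) (hr : 0 < r) (hq : 0 < q)
    (hrel : 1 / q = 1 / r - σ) (a : ℝ≥0∞) :
    (V ^ σ * a) ^ q = (V * a ^ r) ^ (q * σ) * a ^ r := by
  have hqσ : 0 ≤ q * σ := by positivity
  have e : q = r * (q * σ) + r := by
    field_simp at hrel
    linarith
  rw [ENNReal.mul_rpow_of_nonneg _ _ hq.le, ENNReal.mul_rpow_of_nonneg _ _ hqσ,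
    ← ENNReal.rpow_mul, ← ENNReal.rpow_mul, mul_assoc,
    ← ENNReal.rpow_add_of_nonneg _ _ (by positivity) hr.le, ← e, mul_comm σ q]

lemma ballVol_mul_ballAvg_rpow_le {G : Qpn p n → ℝ≥0∞} (hG : AEMeasurable G (haar p n)) {r : ℝ}
    (hr : 1 ≤ r) (γ : ℤ) (x : Qpn p n) :
    ballVol p n γ * ballAvg γ G x ^ r ≤ ∫⁻ y, G y ^ r ∂(haar p n) :=
  calc ballVol p n γ * ballAvg γ G x ^ r ≤ ballVol p n γ * ballAvg γ (fun y => G y ^ r) x := by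
        gcongr; exact ballAvg_rpow_le hG hr γ x
    _ = ∫⁻ y in pball γ x, G y ^ r ∂(haar p n) := by rw [mul_comm, ballAvg_mul_ballVol]
    _ ≤ _ := setLIntegral_le_lintegral _ _

/-- Hedberg's pointwise inequality. -/
lemma fracMaxE_rpow_le {s r q : ℝ} (hs : 0 ≤ s) (hr : 1 ≤ r) (hq : 0 < q)
    (hrel : 1 / q = 1 / r - s / n) {G : Qpn p n → ℝ≥0∞} (hG : AEMeasurable G (haar p n))
    (x : Qpn p n) :
    fracMaxE s G x ^ q ≤ (∫⁻ y, G y ^ r ∂(haar p n)) ^ (q * (s / n)) * hlMax G x ^ r := by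
  have hr0 : 0 < r := zero_lt_one.trans_le hr
  -- In the product form, `V * a ^ r` is controlled by the full `L^r` integral and the remaining `a
  -- ^ r` by the maximal function, uniformly in the scale.
  refine iSup_rpow_le hq fun γ => ?_
  rw [rpow_mul_rpow_eq (by positivity) hr0 hq hrel]
  gcongr
  · exact ballVol_mul_ballAvg_rpow_le hG hr γ x
  · exact ballAvg_le_hlMax γ G x

/-- The fractional maximal function of functions bounded by `1` which are bounded in
`L^{r_∞}`. -/
lemma exists_lintegral_fracMaxE_le_of_bounded (hn : 0 < n) {s r₀ q₀ C T : ℝ} {q : Qpn p n → ℝ}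
    (hs : 0 ≤ s) (hr : 1 < r₀) (hq₀ : 0 < q₀) (hrel : 1 / q₀ = 1 / r₀ - s / n)
    (hq : ∀ x, 1 ≤ q x) (hqT : ∀ x, q x ≤ T)
    (hlog : ∀ x, |q x - q₀| ≤ C / Real.logb p (p + ‖x‖)) {D : ℝ≥0∞} (hD1 : 1 ≤ D) (hD : D ≠ ∞) :
    ∃ K : ℝ≥0∞, K ≠ ∞ ∧ ∀ G : Qpn p n → ℝ≥0∞, AEMeasurable G (haar p n) → (∀ x, G x ≤ 1) →
      ∫⁻ x, G x ^ r₀ ∂(haar p n) ≤ D → ∫⁻ x, fracMaxE s G x ^ q x ∂(haar p n) ≤ K := by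
  obtain ⟨H, hH, hmax⟩ := lintegral_hlMax_rpow_le (p := p) hn hr
  have hσ : 0 ≤ s / n := by positivity
  have hT0 : 0 ≤ T := zero_le_one.trans ((hq 0).trans (hqT 0))
  -- By Hedberg's inequality and `hlMax G ≤ 1`, this bounds `fracMaxE s G` pointwise. Dividing by
  -- `A` gives a function at most `1`, for which `q x` may be exchanged for `q₀`.
  set A : ℝ≥0∞ := D ^ (s / n) with hA
  have hA1 : 1 ≤ A := by simpa using ENNReal.rpow_le_rpow hD1 hσ
  have hAt : A ≠ ∞ := ENNReal.rpow_ne_top_of_nonneg hσ hD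
  have hA0 : A ≠ 0 := (zero_lt_one.trans_le hA1).ne'
  set K₁ : ℝ≥0∞ := ENNReal.ofReal ((p : ℝ) ^ ((n + 1) * C)) with hK₁
  refine ⟨A ^ T * (K₁ * (D ^ (q₀ * (s / n)) * (H * D)) + ∫⁻ x, decay x ∂(haar p n)), ?_, ?_⟩
  · refine ENNReal.mul_ne_top (ENNReal.rpow_ne_top_of_nonneg hT0 hAt) (ENNReal.add_ne_top.2
      ⟨ENNReal.mul_ne_top ENNReal.ofReal_ne_top (ENNReal.mul_ne_top
        (ENNReal.rpow_ne_top_of_nonneg (by positivity) hD) (ENNReal.mul_ne_top hH hD)),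
        lintegral_decay_ne_top p n⟩)
  intro G hG hG1 hGD
  have hhed : ∀ x, fracMaxE s G x ^ q₀ ≤ D ^ (q₀ * (s / n)) * hlMax G x ^ r₀ := fun x =>
    (fracMaxE_rpow_le hs hr.le hq₀ hrel hG x).trans (by gcongr)
  have hM1 : ∀ x, hlMax G x ≤ 1 := fun x => by
    refine iSup_le fun γ => ?_
    rw [← ballAvg_const (p := p) (n := n) 1 γ x]
    exact ballAvg_mono hG1 γ x
  have hfA : ∀ x, fracMaxE s G x ≤ A := fun x => by
    rw [← ENNReal.rpow_le_rpow_iff hq₀, hA, ← ENNReal.rpow_mul, mul_comm]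
    refine (hhed x).trans (mul_le_of_le_one_right zero_le ?_)
    exact ENNReal.rpow_le_one (hM1 x) (by positivity)
  have hpt : ∀ x, fracMaxE s G x ^ q x ≤
      A ^ T * (K₁ * (D ^ (q₀ * (s / n)) * hlMax G x ^ r₀) + decay x) := fun x => by
    have hu : fracMaxE s G x / A ≤ 1 := ENNReal.div_le_of_le_mul (by rw [one_mul]; exact hfA x)
    have huf : fracMaxE s G x / A ≤ fracMaxE s G x :=
      ENNReal.div_le_of_le_mul (le_mul_of_one_le_right zero_le hA1)
    have h1 := rpow_le_rpow_add_decay hu (hq x) (hlog x)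
    calc fracMaxE s G x ^ q x = A ^ q x * (fracMaxE s G x / A) ^ q x := by
          rw [← ENNReal.mul_rpow_of_nonneg _ _ (zero_le_one.trans (hq x)),
            ENNReal.mul_div_cancel hA0 hAt]
      _ ≤ A ^ T * (K₁ * (fracMaxE s G x / A) ^ q₀ + decay x) := by
          gcongr
          exact hqT x
      _ ≤ A ^ T * (K₁ * fracMaxE s G x ^ q₀ + decay x) := by gcongr
      _ ≤ _ := by gcongr; exact hhed x
  refine (lintegral_mono hpt).trans ?_
  have hm : Measurable fun x => K₁ * (D ^ (q₀ * (s / n)) * hlMax G x ^ r₀) :=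
    (((measurable_hlMax G).pow_const _).const_mul _).const_mul _
  rw [lintegral_const_mul' _ _ (ENNReal.rpow_ne_top_of_nonneg hT0 hAt),
    lintegral_add_left hm, lintegral_const_mul' _ _ ENNReal.ofReal_ne_top,
    lintegral_const_mul' _ _ (ENNReal.rpow_ne_top_of_nonneg (by positivity) hD)]
  gcongr
  exact (hmax G hG).trans (by gcongr)

/-- The local part of the fractional maximal function of a function with values in
`{0} ∪ [1, ∞]`. -/
lemma exists_local_fracMaxE_le {s T : ℝ} {r q : Qpn p n → ℝ}
    (hs : 0 ≤ s) (hr : MemClog r) (hq : ∀ x, 0 < q x) (hqT : ∀ x, q x ≤ T)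
    (hrel : ∀ x, 1 / q x = 1 / r x - s / n) :
    ∃ K : ℝ≥0∞, K ≠ ∞ ∧ ∀ F : Qpn p n → ℝ≥0∞, AEMeasurable F (haar p n) →
      (∀ x, F x = 0 ∨ 1 ≤ F x) → ∫⁻ x, F x ^ r x ∂(haar p n) ≤ 1 →
      ∀ᵐ x ∂(haar p n), ∀ k : ℕ,
        (ballVol p n (-(k : ℤ)) ^ (s / n) * ballAvg (-(k : ℤ)) F x) ^ q x ≤
          K * hlMax (fun y => F y ^ (r y / essInf r (haar p n))) x ^ essInf r (haar p n) := by
  obtain ⟨C, hC, hloc⟩ := hr.exists_local_ae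
  have hσ : 0 ≤ s / n := by positivity
  have ht1 : 1 < essInf r (haar p n) := hr.memP.one_lt
  have hmono := hr.memP.le_apply
  have hge := hr.memP.essInf_le_ballInf
  have hrm := hr.memP.measurable
  set t := essInf r (haar p n)
  have ht0 : 0 < t := zero_lt_one.trans ht1
  have hT0 : 0 ≤ T := (hq 0).le.trans (hqT 0)
  set K₀ : ℝ≥0∞ := (p : ℝ≥0∞) ^ (n * C) with hK₀
  have hK1 : 1 ≤ K₀ := by
    simpa using ENNReal.rpow_le_rpow (one_le_prime p) (by positivity : 0 ≤ (n : ℝ) * C)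
  have hKt : K₀ ≠ ∞ := ENNReal.rpow_ne_top_of_nonneg (by positivity) (ENNReal.natCast_ne_top p)
  refine ⟨K₀ ^ (T * (s / n)) * K₀, ENNReal.mul_ne_top
    (ENNReal.rpow_ne_top_of_nonneg (by positivity) hKt) hKt, fun F hF h01 hI => ?_⟩
  filter_upwards [hloc] with x hx k
  obtain ⟨hex, hkx, hey⟩ := hx k
  have hte := hge (-(k : ℤ)) x
  set e := ballInf r (-(k : ℤ)) x
  have he0 : 0 < e := ht0.trans_le hte
  have hrx : 0 < r x := he0.trans_le hex
  set V := ballVol p n (-(k : ℤ)) with hV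
  have hV0 : V ≠ 0 := ballVol_ne_zero p n _
  have hVt : V ≠ ∞ := ballVol_ne_top p n _
  set a := ballAvg (-(k : ℤ)) F x
  set A := ballAvg (-(k : ℤ)) (fun y => F y ^ (r y / t)) x
  -- Jensen's inequality with `e / t ≥ 1`. Under the average the exponent `e` may be raised to `r y
  -- ≥ e` because `F` never takes values strictly between `0` and `1`.
  have haA : a ^ (e / t) ≤ A := by
    refine (ballAvg_rpow_le hF ((one_le_div ht0).2 hte) _ x).trans (ballAvg_mono_ae ?_)
    filter_upwards [hey] with y hy
    rcases h01 y with h | h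
    · rw [h, ENNReal.zero_rpow_of_pos (by positivity)]; exact zero_le
    · exact ENNReal.rpow_le_rpow_of_exponent_le h (by gcongr)
  have haA' : a ^ e ≤ A ^ t := by
    calc a ^ e = (a ^ (e / t)) ^ t := by rw [← ENNReal.rpow_mul, div_mul_cancel₀ _ ht0.ne']
      _ ≤ A ^ t := by gcongr
  have hVA : V * A ^ t ≤ 1 := by
    refine (ballVol_mul_ballAvg_rpow_le (hF.pow (hrm.div_const t).aemeasurable) ht1.le _ x).trans ?_
    refine le_trans (le_of_eq (lintegral_congr fun y => ?_)) hI
    rw [← ENNReal.rpow_mul, div_mul_cancel₀ _ ht0.ne']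
  have hAV : A ^ t ≤ V⁻¹ := by
    rw [ENNReal.le_inv_iff_mul_le, mul_comm]; exact hVA
  have hδ : 0 ≤ (r x - e) / e := div_nonneg (sub_nonneg.2 hex) he0.le
  -- The local log-Hölder condition enters here: `V⁻¹ = p ^ (n k)` while `k (r x - e) ≤ C`. This
  -- pays for passing from the exponent `e` to `r x`.
  have hVδ : V⁻¹ ^ ((r x - e) / e) ≤ K₀ := by
    rw [hV, ballVol, ← ENNReal.rpow_neg, ← ENNReal.rpow_mul]
    apply ENNReal.rpow_le_rpow_of_exponent_le (one_le_prime p)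
    push_cast
    have h1 : (k : ℝ) * ((r x - e) / e) ≤ C := by
      refine le_trans ?_ hkx
      gcongr
      exact div_le_self (sub_nonneg.2 hex) (ht1.le.trans hte)
    calc -((n : ℝ) * -k) * ((r x - e) / e) = n * (k * ((r x - e) / e)) := by ring
      _ ≤ n * C := by gcongr
  have har : a ^ r x ≤ K₀ * A ^ t := by
    calc a ^ r x = (a ^ e) ^ ((r x - e) / e + 1) := by
          rw [← ENNReal.rpow_mul]; congr 1; field_simp; ring
      _ ≤ (A ^ t) ^ ((r x - e) / e + 1) := by gcongr
      _ = (A ^ t) ^ ((r x - e) / e) * A ^ t := by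
          rw [ENNReal.rpow_add_of_nonneg _ _ hδ zero_le_one, ENNReal.rpow_one]
      _ ≤ V⁻¹ ^ ((r x - e) / e) * A ^ t := by gcongr
      _ ≤ K₀ * A ^ t := by gcongr
  have hVa : V * a ^ r x ≤ K₀ := by
    calc V * a ^ r x ≤ V * (K₀ * A ^ t) := by gcongr
      _ = K₀ * (V * A ^ t) := by ring
      _ ≤ K₀ := mul_le_of_le_one_right zero_le hVA
  rw [rpow_mul_rpow_eq hσ hrx (hq x) (hrel x)]
  calc (V * a ^ r x) ^ (q x * (s / n)) * a ^ r x
      ≤ K₀ ^ (q x * (s / n)) * (K₀ * A ^ t) := by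
        have := hq x
        gcongr
    _ ≤ K₀ ^ (T * (s / n)) * (K₀ * hlMax (fun y => F y ^ (r y / t)) x ^ t) := by
        gcongr
        · exact hqT x
        · exact ballAvg_le_hlMax _ _ x
    _ = _ := by ring

lemma add_add_rpow_le {q T : ℝ} (hq : 0 ≤ q) (hqT : q ≤ T) (a b c : ℝ≥0∞) :
    (a + b + c) ^ q ≤ 3 ^ T * (a ^ q + b ^ q + c ^ q) := by
  have h1 : a + b + c ≤ 3 * max (max a b) c := by
    calc a + b + c ≤ max (max a b) c + max (max a b) c + max (max a b) c := by
          gcongr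
          · exact (le_max_left a b).trans (le_max_left _ _)
          · exact (le_max_right a b).trans (le_max_left _ _)
          · exact le_max_right _ _
      _ = 3 * max (max a b) c := by ring
  have h2 : max (max a b) c ^ q ≤ a ^ q + b ^ q + c ^ q := by
    rcases max_choice (max a b) c with h | h <;> rw [h]
    · rcases max_choice a b with h | h <;> rw [h]
      · exact le_add_right le_self_add
      · exact le_add_right le_add_self
    · exact le_add_self
  calc (a + b + c) ^ q ≤ (3 * max (max a b) c) ^ q := by gcongr
    _ = 3 ^ q * max (max a b) c ^ q := ENNReal.mul_rpow_of_nonneg _ _ hq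
    _ ≤ _ := by
        gcongr
        norm_num

/-- Exponents at infinity of an admissible pair. -/
lemma AdmissiblePair.exists_exponents_infty (hn : 0 < n) {s : ℝ}
    {r q : Qpn p n → ℝ} (h : AdmissiblePair s r q) :
    ∃ r₀ q₀ C : ℝ, 1 < r₀ ∧ 0 < q₀ ∧ 1 / q₀ = 1 / r₀ - s / n ∧
      (∀ x, |r x - r₀| ≤ C / Real.logb p (p + ‖x‖)) ∧
      ∀ x, |q x - q₀| ≤ C / Real.logb p (p + ‖x‖) := by
  have hn' : (0 : ℝ) < n := by exact_mod_cast hn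
  obtain ⟨X, r₀, hX, hr₀, hlim⟩ := exists_tendsto_infty hn h.r_mem_P.le_apply h.r_mem_P.apply_le
  have hr1 : 1 < r₀ := h.r_mem_P.one_lt.trans_le hr₀.1
  have hr0 : 0 < r₀ := zero_lt_one.trans hr1
  have hrs : r₀ < n / s := hr₀.2.trans_lt h.r_lt
  have hpos : 0 < 1 / r₀ - s / n := by
    rw [sub_pos, ← one_div_div (n : ℝ) s]
    exact one_div_lt_one_div_of_lt hr0 hrs
  obtain ⟨C₁, hC₁, h₁⟩ := h.r_mem_Clog.infty.limit hX hlim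
  -- Using the sequence chosen for `r` lets the relation between the exponents pass to the limit;
  -- `r₊ < n / s` keeps the limit of `1 / q` positive.
  have hqlim : Filter.Tendsto (fun k => q (X k)) Filter.atTop (nhds (1 / (1 / r₀ - s / n))) := by
    have : ∀ k, q (X k) = 1 / (1 / r (X k) - s / n) := fun k => by
      rw [← h.rel, one_div_one_div]
    simp only [this]
    exact tendsto_const_nhds.div
      ((tendsto_const_nhds.div hlim hr0.ne').sub tendsto_const_nhds) hpos.ne'
  obtain ⟨C₂, hC₂, h₂⟩ := h.q_mem_Clog.infty.limit hX hqlim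
  have hL : ∀ x : Qpn p n, 0 < Real.logb p (p + ‖x‖) := fun x =>
    zero_lt_one.trans_le (one_le_logb_prime_add (norm_nonneg x))
  refine ⟨r₀, 1 / (1 / r₀ - s / n), max C₁ C₂, hr1, by positivity, by rw [one_div_one_div],
    fun x => (h₁ x).trans ?_, fun x => (h₂ x).trans ?_⟩
  · exact div_le_div_of_nonneg_right (le_max_left _ _) (hL x).le
  · exact div_le_div_of_nonneg_right (le_max_right _ _) (hL x).le

/-- For functions bounded by `1`, freezing the exponent at its limit at infinity costs a factor and
the integral of the decay weight. -/
lemma lintegral_rpow_le_of_le_one {C a₀ : ℝ} {a : Qpn p n → ℝ} (ha₀ : 1 ≤ a₀)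
    (ham : Measurable a) (hlog : ∀ x, |a x - a₀| ≤ C / Real.logb p (p + ‖x‖))
    {G : Qpn p n → ℝ≥0∞} (hG : AEMeasurable G (haar p n)) (hG1 : ∀ x, G x ≤ 1) :
    ∫⁻ x, G x ^ a₀ ∂(haar p n) ≤ ENNReal.ofReal ((p : ℝ) ^ ((n + 1) * C)) *
      ∫⁻ x, G x ^ a x ∂(haar p n) + ∫⁻ x : Qpn p n, decay x ∂(haar p n) := by
  rw [← lintegral_const_mul' _ _ ENNReal.ofReal_ne_top, ← lintegral_add_left'
    ((hG.pow ham.aemeasurable).const_mul _)]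
  exact lintegral_mono fun x => rpow_le_rpow_add_decay (hG1 x) ha₀ (by
    rw [abs_sub_comm]; exact hlog x)

/-- Splitting the fractional maximal function of `F = F₁ + F₂`: the part of `F₁` at scales below
`1`, the part of `F₁` at scales above `1`, which only depends on the averages of `F₁` over unit
balls, and `F₂`. -/
lemma fracMaxE_add_le (s : ℝ) {F₁ F₂ : Qpn p n → ℝ≥0∞} (h₁ : AEMeasurable F₁ (haar p n))
    (x : Qpn p n) :
    fracMaxE s (fun y => F₁ y + F₂ y) x ≤
      (⨆ k : ℕ, ballVol p n (-(k : ℤ)) ^ (s / n) * ballAvg (-(k : ℤ)) F₁ x) +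
        fracMaxE s (ballAvg 0 F₁) x + fracMaxE s F₂ x := by
  refine iSup_le fun γ => ?_
  rw [ballAvg_add h₁, mul_add]
  refine add_le_add ?_ (le_fracMaxE s γ F₂ x)
  rcases le_total 0 γ with h | h
  · refine le_add_left (le_trans (le_of_eq ?_) (le_fracMaxE s γ _ x))
    congr 1
    rw [ballAvg, ballAvg, setLIntegral_ballAvg h₁ (measurableSet_pball γ x)]
    intro y hy
    rw [← pball_eq_of_mem hy]
    exact pball_mono h y
  · obtain ⟨k, rfl⟩ := Int.exists_eq_neg_ofNat h
    exact le_add_right (le_iSup (fun k : ℕ =>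
      ballVol p n (-(k : ℤ)) ^ (s / n) * ballAvg (-(k : ℤ)) F₁ x) k)

/-- The fractional maximal operator is bounded from `L^{r(·)}` to `L^{q(·)}`, in modular form. -/
theorem AdmissiblePair.exists_lintegral_fracMaxE_le (hn : 0 < n) {s : ℝ} (hs : 0 < s)
    {r q : Qpn p n → ℝ} (h : AdmissiblePair s r q) :
    ∃ K : ℝ≥0∞, K ≠ ∞ ∧ ∀ F : Qpn p n → ℝ≥0∞, AEMeasurable F (haar p n) →
      ∫⁻ x, F x ^ r x ∂(haar p n) ≤ 1 → ∫⁻ x, fracMaxE s F x ^ q x ∂(haar p n) ≤ K := by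
  obtain ⟨r₀, q₀, C, hr₀, hq₀, hrel₀, hrlog, hqlog⟩ := h.exists_exponents_infty hn
  have hq1 : ∀ x, 1 ≤ q x := fun x => (h.q_mem_Clog.memP.one_lt_apply x).le
  have hq0 : ∀ x, 0 < q x := fun x => zero_lt_one.trans_le (hq1 x)
  have hr1 : ∀ x, 1 ≤ r x := fun x => (h.r_mem_P.one_lt_apply x).le
  have hr0 : ∀ x, 0 < r x := fun x => zero_lt_one.trans_le (hr1 x)
  have ht1 := h.r_mem_P.one_lt
  have hrm := h.r_mem_P.measurable
  have hqm := h.q_mem_Clog.memP.measurable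
  set T := essSup q (haar p n)
  have hqT : ∀ x, q x ≤ T := h.q_mem_Clog.memP.apply_le
  have hT0 : 0 ≤ T := (hq0 0).le.trans (hqT 0)
  -- The bound for the small part after its exponent is frozen at `r₀`. The added `1` gives `1 ≤ D`,
  -- which also covers the unit averages of the large part.
  set D : ℝ≥0∞ := ENNReal.ofReal ((p : ℝ) ^ ((n + 1) * C)) * 1 + ∫⁻ x, decay x ∂(haar p n) + 1
  have hD1 : 1 ≤ D := le_add_self
  have hDt : D ≠ ∞ := ENNReal.add_ne_top.2 ⟨ENNReal.add_ne_top.2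
    ⟨ENNReal.mul_ne_top ENNReal.ofReal_ne_top ENNReal.one_ne_top, lintegral_decay_ne_top p n⟩,
    ENNReal.one_ne_top⟩
  obtain ⟨K₁, hK₁, hbdd⟩ := exists_lintegral_fracMaxE_le_of_bounded hn hs.le hr₀ hq₀ hrel₀ hq1 hqT
    hqlog hD1 hDt
  obtain ⟨K₂, hK₂, hloc⟩ := exists_local_fracMaxE_le hs.le h.r_mem_Clog hq0 hqT h.rel
  obtain ⟨H, hH, hmax⟩ := lintegral_hlMax_rpow_le (p := p) hn ht1
  set t := essInf r (haar p n)
  have ht0 : 0 < t := zero_lt_one.trans ht1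
  refine ⟨3 ^ T * (K₂ * (H * 1) + K₁ + K₁), ENNReal.mul_ne_top (ENNReal.rpow_ne_top_of_nonneg hT0
    (by simp)) (ENNReal.add_ne_top.2 ⟨ENNReal.add_ne_top.2 ⟨ENNReal.mul_ne_top hK₂
      (ENNReal.mul_ne_top hH ENNReal.one_ne_top), hK₁⟩, hK₁⟩), fun F hF hI => ?_⟩
  -- The cut at height `1`: the part above is integrable, since there `F ≤ F ^ r`, and the part
  -- below is bounded by `1`.
  have hS : NullMeasurableSet {x | 1 < F x} (haar p n) := nullMeasurableSet_lt aemeasurable_const hF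
  set F₁ : Qpn p n → ℝ≥0∞ := {x | 1 < F x}.indicator F with hF₁
  set F₂ : Qpn p n → ℝ≥0∞ := {x | 1 < F x}ᶜ.indicator F with hF₂
  have hm₁ : AEMeasurable F₁ (haar p n) := hF.indicator₀ hS
  have hm₂ : AEMeasurable F₂ (haar p n) := hF.indicator₀ hS.compl
  have hsum : F = fun y => F₁ y + F₂ y := (Set.indicator_self_add_compl _ F).symm
  have h01 : ∀ x, F₁ x = 0 ∨ 1 ≤ F₁ x := fun x => by
    by_cases hx : x ∈ {x | 1 < F x}
    · right; rw [hF₁, Set.indicator_of_mem hx]; exact le_of_lt hx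
    · left; rw [hF₁, Set.indicator_of_notMem hx]
  have hF₂1 : ∀ x, F₂ x ≤ 1 := fun x => by
    by_cases hx : x ∈ {x | 1 < F x}
    · rw [hF₂, Set.indicator_of_notMem (by simpa using hx)]; exact zero_le
    · rw [hF₂, Set.indicator_of_mem hx]; exact not_lt.1 hx
  have hI₁ : ∫⁻ x, F₁ x ^ r x ∂(haar p n) ≤ 1 := by
    refine (lintegral_mono fun x => ?_).trans hI
    exact ENNReal.rpow_le_rpow (Set.indicator_le_self _ F x) (hr0 x).le
  have hI₂ : ∫⁻ x, F₂ x ^ r x ∂(haar p n) ≤ 1 := by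
    refine (lintegral_mono fun x => ?_).trans hI
    exact ENNReal.rpow_le_rpow (Set.indicator_le_self _ F x) (hr0 x).le
  have hL₁ : ∫⁻ x, F₁ x ∂(haar p n) ≤ 1 := by
    refine (lintegral_mono fun x => ?_).trans hI₁
    rcases h01 x with h | h
    · rw [h]; exact zero_le
    · simpa using ENNReal.rpow_le_rpow_of_exponent_le h (hr1 x)
  have hb₂ : ∫⁻ x, fracMaxE s F₂ x ^ q x ∂(haar p n) ≤ K₁ := by
    refine hbdd F₂ hm₂ hF₂1 ?_
    refine (lintegral_rpow_le_of_le_one hr₀.le hrm hrlog hm₂ hF₂1).trans ?_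
    refine le_add_right ?_
    gcongr
  have hA1 : ∀ x, ballAvg 0 F₁ x ≤ 1 := fun x => by
    refine (ballAvg_le_lintegral_div 0 F₁ x).trans ?_
    simpa [ballVol] using hL₁
  have hb₁ : ∫⁻ x, fracMaxE s (ballAvg 0 F₁) x ^ q x ∂(haar p n) ≤ K₁ := by
    refine hbdd _ (measurable_ballAvg 0 F₁).aemeasurable hA1 (le_trans ?_ hD1)
    have h1 : ∫⁻ x, ballAvg 0 F₁ x ∂(haar p n) = ∫⁻ x, F₁ x ∂(haar p n) := by
      simpa using setLIntegral_ballAvg (γ := 0) hm₁ MeasurableSet.univ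
        fun x _ => Set.subset_univ _
    refine le_trans (lintegral_mono fun x => ?_) (h1.trans_le hL₁)
    simpa using ENNReal.rpow_le_rpow_of_exponent_ge (hA1 x) hr₀.le
  have hb₀ : ∫⁻ x, (⨆ k : ℕ, ballVol p n (-(k : ℤ)) ^ (s / n) * ballAvg (-(k : ℤ)) F₁ x) ^ q x
      ∂(haar p n) ≤ K₂ * (H * 1) := by
    calc _ ≤ ∫⁻ x, K₂ * hlMax (fun y => F₁ y ^ (r y / t)) x ^ t ∂(haar p n) := by
          refine lintegral_mono_ae ?_
          filter_upwards [hloc F₁ hm₁ h01 hI₁] with x hx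
          exact iSup_rpow_le (hq0 x) hx
      _ ≤ K₂ * (H * 1) := by
          rw [lintegral_const_mul' _ _ hK₂]
          gcongr
          refine (hmax _ (hm₁.pow (hrm.div_const t).aemeasurable)).trans ?_
          gcongr
          refine le_trans (le_of_eq (lintegral_congr fun y => ?_)) hI₁
          rw [← ENNReal.rpow_mul, div_mul_cancel₀ _ ht0.ne']
  have hmeas₀ : Measurable fun x =>
      ⨆ k : ℕ, ballVol p n (-(k : ℤ)) ^ (s / n) * ballAvg (-(k : ℤ)) F₁ x :=
    Measurable.iSup fun k => (measurable_ballAvg _ F₁).const_mul _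
  calc ∫⁻ x, fracMaxE s F x ^ q x ∂(haar p n)
      ≤ ∫⁻ x, 3 ^ T * ((⨆ k : ℕ, ballVol p n (-(k : ℤ)) ^ (s / n) *
          ballAvg (-(k : ℤ)) F₁ x) ^ q x + fracMaxE s (ballAvg 0 F₁) x ^ q x +
          fracMaxE s F₂ x ^ q x) ∂(haar p n) := by
        refine lintegral_mono fun x => ?_
        refine le_trans ?_ (add_add_rpow_le (hq0 x).le (hqT x) _ _ _)
        refine ENNReal.rpow_le_rpow ?_ (hq0 x).le
        conv_lhs => rw [hsum]
        exact fracMaxE_add_le s hm₁ x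
    _ ≤ _ := by
        rw [lintegral_const_mul' _ _ (ENNReal.rpow_ne_top_of_nonneg hT0 (by simp)),
          lintegral_add_right _ ((measurable_fracMaxE s F₂).pow hqm),
          lintegral_add_left (hmeas₀.pow hqm)]
        gcongr

end Fractional

/-! ### Modulars, Luxemburg norms and characteristic functions of balls. -/

section Luxemburg

variable {p : ℕ} [Fact p.Prime] {n : ℕ}

lemma modular_eq_lintegral {q : Qpn p n → ℝ} (hq : ∀ x, 1 < q x) (f : Qpn p n → ℝ) {η : ℝ}
    (hη : 0 < η) :
    modular q f η = ∫⁻ x, (‖f x‖ₑ / ENNReal.ofReal η) ^ q x ∂(haar p n) := by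
  refine lintegral_congr fun x => ?_
  rw [← ENNReal.ofReal_rpow_of_nonneg (by positivity) (zero_lt_one.trans (hq x)).le,
    ENNReal.ofReal_div_of_pos hη, Real.enorm_eq_ofReal_abs]

lemma luxNorm_le {q f : Qpn p n → ℝ} {η : ℝ} (hη : 0 < η) (h : modular q f η ≤ 1) :
    luxNorm q f ≤ ENNReal.ofReal η := iInf₂_le η ⟨hη, h⟩

lemma luxNorm_le_mul {q r f g : Qpn p n → ℝ} {C : ℝ} (hC : 0 < C)
    (h : ∀ η, 0 < η → modular r f η ≤ 1 → modular q g (C * η) ≤ 1) :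
    luxNorm q g ≤ ENNReal.ofReal C * luxNorm r f := by
  rw [mul_comm, ← ENNReal.div_le_iff_le_mul (Or.inl (by simpa using hC))
    (Or.inl ENNReal.ofReal_ne_top)]
  refine le_iInf₂ fun η hη => ?_
  rw [ENNReal.div_le_iff_le_mul (Or.inl (by simpa using hC)) (Or.inl ENNReal.ofReal_ne_top),
    mul_comm, ← ENNReal.ofReal_mul hC.le]
  exact luxNorm_le (mul_pos hC hη.1) (h η hη.1 hη.2)

/-- A bound for the modular by `K` becomes a bound by `1` after division by `K`. -/
lemma lintegral_div_rpow_le_one {q : Qpn p n → ℝ} (hq : ∀ x, 1 < q x) {G : Qpn p n → ℝ≥0∞}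
    {K : ℝ≥0∞} (hK1 : 1 ≤ K) (hK : K ≠ ∞) (h : ∫⁻ x, G x ^ q x ∂(haar p n) ≤ K) :
    ∫⁻ x, (G x / K) ^ q x ∂(haar p n) ≤ 1 := by
  have hK0 : K ≠ 0 := (zero_lt_one.trans_le hK1).ne'
  calc ∫⁻ x, (G x / K) ^ q x ∂(haar p n) ≤ ∫⁻ x, K⁻¹ * G x ^ q x ∂(haar p n) := by
        refine lintegral_mono fun x => ?_
        have hq0 := (zero_lt_one.trans (hq x)).le
        rw [div_eq_mul_inv, ENNReal.mul_rpow_of_nonneg _ _ hq0, mul_comm]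
        gcongr
        simpa using ENNReal.rpow_le_rpow_of_exponent_ge (ENNReal.inv_le_one.2 hK1) (hq x).le
    _ ≤ K⁻¹ * K := by
        rw [lintegral_const_mul' _ _ (ENNReal.inv_ne_top.2 hK0)]
        gcongr
    _ = 1 := ENNReal.inv_mul_cancel hK0 hK

lemma modular_mul_le_one {q : Qpn p n → ℝ} (hq : ∀ x, 1 < q x) {f : Qpn p n → ℝ} {η K : ℝ}
    (hη : 0 < η) (hK : 1 ≤ K) (h : modular q f η ≤ ENNReal.ofReal K) :
    modular q f (K * η) ≤ 1 := by
  have hK0 : 0 < K := zero_lt_one.trans_le hK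
  rw [modular_eq_lintegral hq f hη] at h
  rw [modular_eq_lintegral hq f (mul_pos hK0 hη)]
  refine le_trans (le_of_eq (lintegral_congr fun x => ?_)) (lintegral_div_rpow_le_one hq
    (ENNReal.one_le_ofReal.2 hK) ENNReal.ofReal_ne_top h)
  rw [ENNReal.ofReal_mul hK0.le, div_eq_mul_inv, div_eq_mul_inv, div_eq_mul_inv, mul_assoc,
    ENNReal.mul_inv (Or.inl (by simpa using hK0)) (Or.inl ENNReal.ofReal_ne_top), mul_comm (_⁻¹)]

lemma MemLvar.exists_modular_le_one {q f : Qpn p n → ℝ} (hq : ∀ x, 1 < q x) (h : MemLvar q f) :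
    ∃ η : ℝ, 0 < η ∧ modular q f η ≤ 1 := by
  obtain ⟨_, η, hη, hfin⟩ := h
  refine ⟨max 1 (modular q f η).toReal * η, by positivity,
    modular_mul_le_one hq hη (le_max_left _ _) ?_⟩
  rw [← ENNReal.ofReal_toReal hfin.ne]
  exact ENNReal.ofReal_le_ofReal (by simp)

lemma modular_indicator_one {q : Qpn p n → ℝ} (hq : ∀ x, 1 < q x) {B : Set (Qpn p n)}
    (hB : MeasurableSet B) {η : ℝ} (hη : 0 < η) :
    modular q (B.indicator fun _ => 1) η = ∫⁻ x in B, (ENNReal.ofReal η)⁻¹ ^ q x ∂(haar p n) := by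
  rw [modular_eq_lintegral hq _ hη, ← lintegral_indicator hB]
  refine lintegral_congr fun x => ?_
  by_cases hx : x ∈ B
  · simp [hx]
  · simp [hx, zero_lt_one.trans (hq x)]

lemma memLvar_indicator_pball {q : Qpn p n → ℝ} (hq : ∀ x, 1 < q x) (γ : ℤ) (a : Qpn p n) :
    MemLvar q ((pball γ a).indicator fun _ => 1) := by
  refine ⟨(measurable_const.indicator (measurableSet_pball γ a)).aestronglyMeasurable, 1, one_pos,
    ?_⟩
  rw [modular_indicator_one hq (measurableSet_pball γ a) one_pos]
  simp [haar_pball, (ballVol_ne_top p n γ).lt_top]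

/-- Hölder's inequality for characteristic functions of balls. -/
lemma AdmissiblePair.luxNorm_indicator_le {s : ℝ} (hn : 0 < n) (hs : 0 < s) {r q : Qpn p n → ℝ}
    (h : AdmissiblePair s r q) (γ : ℤ) (a : Qpn p n) :
    luxNorm r ((pball γ a).indicator fun _ => 1) ≤
      2 * ballVol p n γ ^ (s / n) * luxNorm q ((pball γ a).indicator fun _ => 1) := by
  have hn' : (0 : ℝ) < n := by exact_mod_cast hn
  have hr1 := h.r_mem_P.one_lt_apply
  have hq1 := h.q_mem_Clog.memP.one_lt_apply
  have hB := measurableSet_pball γ a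
  have hV0 := ballVol_ne_zero p n γ
  have hVt := ballVol_ne_top p n γ
  set V := ballVol p n γ with hV
  set σ : ℝ := s / n with hσ
  have hσ0 : 0 < σ := by positivity
  have hVσ0 : V ^ σ ≠ 0 := (ENNReal.rpow_pos (pos_iff_ne_zero.2 hV0) hVt).ne'
  have hVσt : V ^ σ ≠ ∞ := ENNReal.rpow_ne_top_of_nonneg hσ0.le hVt
  have hc0 : 0 < (2 * V ^ σ).toReal :=
    ENNReal.toReal_pos (mul_ne_zero two_ne_zero hVσ0) (ENNReal.mul_ne_top (by simp) hVσt)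
  have hc : ENNReal.ofReal (2 * V ^ σ).toReal = 2 * V ^ σ :=
    ENNReal.ofReal_toReal (ENNReal.mul_ne_top (by simp) hVσt)
  rw [← hc]
  refine luxNorm_le_mul hc0 fun η hη hmod => ?_
  rw [modular_indicator_one hq1 hB hη] at hmod
  rw [modular_indicator_one hr1 hB (mul_pos hc0 hη), ENNReal.ofReal_mul hc0.le, hc]
  set u : ℝ≥0∞ := (ENNReal.ofReal η)⁻¹
  -- With `M` the larger of `V⁻¹` and `u ^ q x`, the relation `σ + 1 / q x = 1 / r x` bounds the
  -- product by `M`. Both terms integrate to at most `1` over the ball, and the factor `2` in the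
  -- constant halves their sum.
  have hpt : ∀ x, (2 * V ^ σ * ENNReal.ofReal η)⁻¹ ^ r x ≤ 2⁻¹ * (V⁻¹ + u ^ q x) := fun x => by
    have hr0 : 0 < r x := zero_lt_one.trans (hr1 x)
    have hq0 : 0 < q x := zero_lt_one.trans (hq1 x)
    have e1 : (2 * V ^ σ * ENNReal.ofReal η)⁻¹ = 2⁻¹ * ((V⁻¹) ^ σ * u) := by
      rw [mul_assoc, ENNReal.mul_inv (Or.inl (by simp)) (Or.inl (by simp)),
        ENNReal.mul_inv (Or.inl hVσ0) (Or.inl hVσt), ENNReal.inv_rpow]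
    set M := max V⁻¹ (u ^ q x)
    have h1 : (V⁻¹) ^ σ ≤ M ^ σ := ENNReal.rpow_le_rpow (le_max_left _ _) hσ0.le
    have h2 : u ≤ M ^ (1 / q x) := by
      rw [one_div, ENNReal.le_rpow_inv_iff hq0]; exact le_max_right _ _
    have h3 : ((V⁻¹) ^ σ * u) ^ r x ≤ M := by
      calc ((V⁻¹) ^ σ * u) ^ r x ≤ (M ^ σ * M ^ (1 / q x)) ^ r x := by gcongr
        _ = M := by
            rw [← ENNReal.rpow_add_of_nonneg _ _ hσ0.le (by positivity), ← ENNReal.rpow_mul]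
            have : (σ + 1 / q x) * r x = 1 := by
              rw [h.rel x, ← hσ, add_sub_cancel, one_div_mul_cancel hr0.ne']
            rw [this, ENNReal.rpow_one]
    rw [e1, ENNReal.mul_rpow_of_nonneg _ _ hr0.le]
    have h4 : (2⁻¹ : ℝ≥0∞) ^ r x ≤ 2⁻¹ := by
      simpa using ENNReal.rpow_le_rpow_of_exponent_ge
        (ENNReal.inv_le_one.2 one_le_two : (2⁻¹ : ℝ≥0∞) ≤ 1) (hr1 x).le
    gcongr
    exact h3.trans (max_le le_self_add le_add_self)
  calc _ ≤ ∫⁻ x in pball γ a, 2⁻¹ * (V⁻¹ + u ^ q x) ∂(haar p n) := lintegral_mono hpt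
    _ ≤ 2⁻¹ * (1 + 1) := by
        rw [lintegral_const_mul' _ _ (by simp), lintegral_add_left measurable_const,
          setLIntegral_const, haar_pball, ← hV, ENNReal.inv_mul_cancel hV0 hVt]
        gcongr
    _ = 1 := by rw [one_add_one_eq_two, ENNReal.inv_mul_cancel (by simp) (by simp)]

lemma memClog_const {c : ℝ} (hc : 1 < c) : MemClog (fun _ : Qpn p n => c) := by
  have h0 : haar p n ≠ 0 := (inferInstance : NeZero (haar p n)).out
  have hB : ∀ (γ : ℤ) (x : Qpn p n), (haar p n).restrict (pball γ x) ≠ 0 := fun γ x => by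
    rw [Ne, Measure.restrict_eq_zero, haar_pball]; exact ballVol_ne_zero p n γ
  refine ⟨⟨measurable_const, ?_, ?_, ?_⟩, ⟨1, one_pos, ?_⟩, ⟨1, one_pos, ?_⟩⟩
  · rwa [essInf_const c h0]
  · intro x; rw [essInf_const c h0]
  · intro x; rw [essSup_const c h0]
  · intro γ x
    rw [essInf_const c (hB γ x), essSup_const c (hB γ x)]
    simp
  · intro x y
    rw [sub_self, abs_zero]
    have := one_le_logb_prime_add (p := p) (le_min (norm_nonneg x) (norm_nonneg y))
    positivity

variable (p n) in
-- Constant exponents suffice: any `c` strictly between `1` and `n / s` will do for `r`.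
lemma exists_admissiblePair {s : ℝ} (hs : 0 < s) (hsn : s < n) :
    ∃ r q : Qpn p n → ℝ, AdmissiblePair s r q := by
  have hn : (0 : ℝ) < n := hs.trans hsn
  have h1 : 1 < n / s := (one_lt_div hs).2 hsn
  obtain ⟨c, hc1, hc2⟩ := exists_between h1
  have hc0 : 0 < c := zero_lt_one.trans hc1
  have hpos : 0 < 1 / c - s / n := by
    rw [sub_pos, ← one_div_div (n : ℝ) s]
    exact one_div_lt_one_div_of_lt hc0 hc2
  have hlt : 1 / c - s / n < 1 := by
    have : 1 / c < 1 := (div_lt_one hc0).2 hc1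
    have : 0 < s / n := by positivity
    linarith
  refine ⟨fun _ => c, fun _ => 1 / (1 / c - s / n), memClog_const hc1,
    memClog_const ((one_lt_div hpos).2 hlt), (memClog_const hc1).memP, ?_, fun _ => ?_⟩
  · rwa [essSup_const c (inferInstance : NeZero (haar p n)).out]
  · rw [one_div_one_div]

end Luxemburg

/-! ### Lipschitz functions give bounded commutators. -/

section Commutator

variable {p : ℕ} [Fact p.Prime] {n : ℕ}

lemma ballAvg_const_mul {c : ℝ≥0∞} (hc : c ≠ ∞) (γ : ℤ) (F : Qpn p n → ℝ≥0∞) (x : Qpn p n) :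
    ballAvg γ (fun y => c * F y) x = c * ballAvg γ F x := by
  rw [ballAvg, ballAvg, lintegral_const_mul' _ _ hc, mul_div_assoc]

lemma fracMaxE_const_mul {c : ℝ≥0∞} (hc : c ≠ ∞) (s : ℝ) (F : Qpn p n → ℝ≥0∞) (x : Qpn p n) :
    fracMaxE s (fun y => c * F y) x = c * fracMaxE s F x := by
  rw [fracMaxE, fracMaxE, ENNReal.mul_iSup]
  refine iSup_congr fun γ => ?_
  rw [ballAvg_const_mul hc, mul_left_comm]

lemma ballVol_rpow_div (hn : 0 < n) (γ : ℤ) (β : ℝ) :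
    ballVol p n γ ^ (β / n) = ENNReal.ofReal (((p : ℝ) ^ γ) ^ β) := by
  have hn' : (n : ℝ) ≠ 0 := by exact_mod_cast hn.ne'
  rw [ballVol, ← ENNReal.rpow_mul, ← Real.rpow_intCast, ← Real.rpow_mul (prime_real_pos p).le,
    ← ENNReal.ofReal_rpow_of_pos (prime_real_pos p), ENNReal.ofReal_natCast]
  congr 1; field_simp

lemma enorm_sub_le_lipNorm {β : ℝ} (hn : 0 < n) (hβ : 0 < β) (b : Qpn p n → ℝ) {γ : ℤ}
    {x y : Qpn p n} (h : y ∈ pball γ x) :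
    ‖b x - b y‖ₑ ≤ lipNorm β b * ballVol p n γ ^ (β / n) := by
  rcases eq_or_ne x y with rfl | hne
  · simp
  have hpos : 0 < ‖x - y‖ := norm_pos_iff.2 (sub_ne_zero.2 hne)
  have h1 : ENNReal.ofReal (|b x - b y| / ‖x - y‖ ^ β) ≤ lipNorm β b :=
    le_iSup_of_le x (le_iSup_of_le y (le_iSup_of_le hne le_rfl))
  have h2 : ‖x - y‖ ≤ (p : ℝ) ^ γ := mem_pball.1 (mem_pball_comm.1 h)
  calc ‖b x - b y‖ₑ = ENNReal.ofReal (|b x - b y| / ‖x - y‖ ^ β) *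
        ENNReal.ofReal (‖x - y‖ ^ β) := by
        rw [← ENNReal.ofReal_mul (by positivity), div_mul_cancel₀ _ (by positivity),
          Real.enorm_eq_ofReal_abs]
    _ ≤ lipNorm β b * ballVol p n γ ^ (β / n) := by
        rw [ballVol_rpow_div hn]
        gcongr

lemma ballVol_rpow_add (γ : ℤ) (α β : ℝ) :
    ballVol p n γ ^ ((α + β) / n) = ballVol p n γ ^ (α / n) * ballVol p n γ ^ (β / n) := by
  rw [add_div, ENNReal.rpow_add _ _ (ballVol_ne_zero p n γ) (ballVol_ne_top p n γ)]

/-- Multiplication by a Lipschitz function almost commutes with the maximal function. -/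
lemma fracMaxE_mul_le {α β : ℝ} (hn : 0 < n) (hβ : 0 < β) {b : Qpn p n → ℝ}
    (hb : lipNorm β b ≠ ∞) (F : Qpn p n → ℝ≥0∞) (x : Qpn p n) :
    fracMaxE α (fun y => ‖b y‖ₑ * F y) x ≤
      ‖b x‖ₑ * fracMaxE α F x + lipNorm β b * fracMaxE (α + β) F x := by
  refine iSup_le fun γ => ?_
  set L := lipNorm β b
  set V := ballVol p n γ
  have hVt : V ^ (β / n) ≠ ∞ := by rw [ballVol_rpow_div hn]; exact ENNReal.ofReal_ne_top
  have hc : ‖b x‖ₑ + L * V ^ (β / n) ≠ ∞ :=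
    ENNReal.add_ne_top.2 ⟨enorm_ne_top, ENNReal.mul_ne_top hb hVt⟩
  have h1 : ballAvg γ (fun y => ‖b y‖ₑ * F y) x ≤ (‖b x‖ₑ + L * V ^ (β / n)) * ballAvg γ F x := by
    rw [← ballAvg_const_mul hc]
    refine ballAvg_mono_ae ?_
    filter_upwards [ae_restrict_mem (measurableSet_pball γ x)] with y hy
    gcongr
    have h2 := enorm_sub_le_lipNorm hn hβ b (mem_pball_comm.1 hy)
    calc ‖b y‖ₑ = ‖b x + (b y - b x)‖ₑ := by congr 1; ring
      _ ≤ ‖b x‖ₑ + ‖b y - b x‖ₑ := enorm_add_le _ _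
      _ ≤ _ := by gcongr
  calc V ^ (α / n) * ballAvg γ (fun y => ‖b y‖ₑ * F y) x
      ≤ V ^ (α / n) * ((‖b x‖ₑ + L * V ^ (β / n)) * ballAvg γ F x) := by gcongr
    _ = ‖b x‖ₑ * (V ^ (α / n) * ballAvg γ F x) + L * (V ^ ((α + β) / n) * ballAvg γ F x) := by
        rw [ballVol_rpow_add]; ring
    _ ≤ _ := by
        gcongr
        · exact le_fracMaxE α γ F x
        · exact le_fracMaxE (α + β) γ F x

/-- The reverse comparison to `fracMaxE_mul_le`. Here the error is added inside the average, and
additivity of averages is what calls for measurability. -/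
lemma mul_fracMaxE_le {α β : ℝ} (hn : 0 < n) (hβ : 0 < β) {b : Qpn p n → ℝ}
    (hb : lipNorm β b ≠ ∞) (hbm : Measurable b) {F : Qpn p n → ℝ≥0∞}
    (hF : AEMeasurable F (haar p n)) (x : Qpn p n) :
    ‖b x‖ₑ * fracMaxE α F x ≤
      fracMaxE α (fun y => ‖b y‖ₑ * F y) x + lipNorm β b * fracMaxE (α + β) F x := by
  rw [fracMaxE, ENNReal.mul_iSup]
  refine iSup_le fun γ => ?_
  set L := lipNorm β b
  set V := ballVol p n γ
  have hVt : V ^ (β / n) ≠ ∞ := by rw [ballVol_rpow_div hn]; exact ENNReal.ofReal_ne_top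
  have h1 : ‖b x‖ₑ * ballAvg γ F x ≤ ballAvg γ (fun y => ‖b y‖ₑ * F y) x +
      L * V ^ (β / n) * ballAvg γ F x := by
    rw [← ballAvg_const_mul (ENNReal.mul_ne_top hb hVt), ← ballAvg_const_mul enorm_ne_top,
      ← ballAvg_add (F := fun y => ‖b y‖ₑ * F y) (hbm.enorm.aemeasurable.mul hF)]
    refine ballAvg_mono_ae ?_
    filter_upwards [ae_restrict_mem (measurableSet_pball γ x)] with y hy
    rw [← add_mul]
    gcongr
    have h2 := enorm_sub_le_lipNorm hn hβ b hy
    calc ‖b x‖ₑ = ‖b y + (b x - b y)‖ₑ := by congr 1; ring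
      _ ≤ ‖b y‖ₑ + ‖b x - b y‖ₑ := enorm_add_le _ _
      _ ≤ _ := by gcongr
  calc ‖b x‖ₑ * (V ^ (α / n) * ballAvg γ F x) = V ^ (α / n) * (‖b x‖ₑ * ballAvg γ F x) := by ring
    _ ≤ V ^ (α / n) * (ballAvg γ (fun y => ‖b y‖ₑ * F y) x +
          L * V ^ (β / n) * ballAvg γ F x) := by gcongr
    _ = V ^ (α / n) * ballAvg γ (fun y => ‖b y‖ₑ * F y) x +
          L * (V ^ ((α + β) / n) * ballAvg γ F x) := by rw [ballVol_rpow_add]; ring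
    _ ≤ _ := by
        gcongr
        · exact le_fracMaxE α γ _ x
        · exact le_fracMaxE (α + β) γ F x

/-- Scales of volume at least `1` only gain from the higher order, and smaller ones only gain from
order `0`. The bound serves to show finiteness almost everywhere. -/
lemma fracMaxE_le_add_hlMax {α β : ℝ} (hα : 0 ≤ α) (hβ : 0 ≤ β) (F : Qpn p n → ℝ≥0∞)
    (x : Qpn p n) : fracMaxE α F x ≤ fracMaxE (α + β) F x + hlMax F x := by
  refine iSup_le fun γ => ?_
  have h0 : ballVol p n 0 = 1 := by simp [ballVol]
  rcases le_total 0 γ with h | h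
  · refine le_add_right (le_trans ?_ (le_fracMaxE (α + β) γ F x))
    gcongr
    · rw [← h0]; exact ballVol_mono p n h
    · linarith
  · refine le_add_left (le_trans (mul_le_of_le_one_left zero_le ?_) (ballAvg_le_hlMax γ F x))
    refine ENNReal.rpow_le_one ?_ (by positivity)
    rw [← h0]; exact ballVol_mono p n h

lemma fracMaxE_congr_ae {s : ℝ} {F G : Qpn p n → ℝ≥0∞} (h : F =ᵐ[haar p n] G) (x : Qpn p n) :
    fracMaxE s F x = fracMaxE s G x :=
  iSup_congr fun γ => by rw [ballAvg_congr_ae h]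

/-- The commutator with a nonnegative Lipschitz function is dominated by a fractional maximal
function. -/
lemma enorm_commutator_le {α β : ℝ} (hn : 0 < n) (hβ : 0 < β) {b f : Qpn p n → ℝ}
    (hb0 : ∀ x, 0 ≤ b x) (hb : lipNorm β b ≠ ∞) (hbm : Measurable b)
    (hf : AEStronglyMeasurable f (haar p n)) {x : Qpn p n} (hfin : fracMax α f x < ∞)
    (hfin' : fracMax α (fun y => b y * f y) x < ∞) :
    ‖commutator α b f x‖ₑ ≤ lipNorm β b * fracMaxE (α + β) (fun y => ‖f y‖ₑ) x := by
  have e : fracMax α (fun y => b y * f y) x = fracMaxE α (fun y => ‖b y‖ₑ * ‖f y‖ₑ) x := by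
    rw [fracMax_eq_fracMaxE]; simp only [enorm_mul]
  have h1 := fracMaxE_mul_le (α := α) hn hβ hb (fun y => ‖f y‖ₑ) x
  have h2 := mul_fracMaxE_le (α := α) hn hβ hb hbm hf.enorm x
  rw [← e, ← fracMax_eq_fracMaxE] at h1 h2
  set R := lipNorm β b * fracMaxE (α + β) (fun y => ‖f y‖ₑ) x
  rcases eq_or_ne R ∞ with hR | hR
  · rw [hR]; exact le_top
  have hbx : ‖b x‖ₑ ≠ ∞ := enorm_ne_top
  -- Nonnegativity is essential here: the two comparisons involve `|b x|`, the commutator involves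
  -- `b x`.
  have hbr : ‖b x‖ₑ.toReal = b x := by rw [toReal_enorm, Real.norm_of_nonneg (hb0 x)]
  have h1' := ENNReal.toReal_mono (ENNReal.add_ne_top.2 ⟨ENNReal.mul_ne_top hbx hfin.ne, hR⟩) h1
  have h2' := ENNReal.toReal_mono (ENNReal.add_ne_top.2 ⟨hfin'.ne, hR⟩) h2
  rw [ENNReal.toReal_add (ENNReal.mul_ne_top hbx hfin.ne) hR, ENNReal.toReal_mul, hbr] at h1'
  rw [ENNReal.toReal_add hfin'.ne hR, ENNReal.toReal_mul, hbr] at h2'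
  rw [Real.enorm_eq_ofReal_abs, ← ENNReal.ofReal_toReal hR]
  refine ENNReal.ofReal_le_ofReal (abs_le.2 ⟨?_, ?_⟩) <;> rw [commutator] <;> linarith

lemma commutator_congr_ae {α : ℝ} {b b₀ f : Qpn p n → ℝ} (h : b =ᵐ[haar p n] b₀) :
    commutator α b f =ᵐ[haar p n] commutator α b₀ f := by
  have e : ∀ x, fracMax α (fun y => b y * f y) x = fracMax α (fun y => b₀ y * f y) x := fun x => by
    rw [fracMax_eq_fracMaxE, fracMax_eq_fracMaxE]
    refine fracMaxE_congr_ae ?_ x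
    filter_upwards [h] with y hy
    rw [hy]
  filter_upwards [h] with x hx
  rw [commutator, commutator, hx, e]

/-- The norm bound is the pointwise domination by `fracMaxE (α + β)`. Much of the proof secures
finiteness almost everywhere, without which `toReal` in the commutator would return default values.
-/
theorem commutatorBounded_of_memLip {α β : ℝ} (hn : 0 < n) (hα : 0 < α) (hβ : 0 < β)
    {b b₀ r q : Qpn p n → ℝ} (hbb : b =ᵐ[haar p n] b₀) (hb : MemLip β b₀) (hb0 : ∀ x, 0 ≤ b₀ x)
    (h : AdmissiblePair (α + β) r q) : CommutatorBounded α b r q := by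
  obtain ⟨K, hK, hmax⟩ := h.exists_lintegral_fracMaxE_le hn (add_pos hα hβ)
  have hr1 := h.r_mem_P.one_lt_apply
  have hq1 := h.q_mem_Clog.memP.one_lt_apply
  have hrm := h.r_mem_P.measurable
  have hqm := h.q_mem_Clog.memP.measurable
  have hLt : lipNorm β b₀ ≠ ∞ := hb.2.ne
  set L := lipNorm β b₀
  -- `K` comes from the maximal theorem and `L` is the Lipschitz constant; adding `1` makes both
  -- factors at least `1`, as the passage from modular to norm requires of the first.
  set c : ℝ := (K + 1).toReal * (L + 1).toReal with hc
  have hK1 : (1 : ℝ) ≤ (K + 1).toReal := by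
    rw [ENNReal.toReal_add hK ENNReal.one_ne_top]; simp
  have hL1 : (1 : ℝ) ≤ (L + 1).toReal := by
    rw [ENNReal.toReal_add hLt ENNReal.one_ne_top]; simp
  have hc0 : 0 < c := by positivity
  have hKe : ENNReal.ofReal (K + 1).toReal = K + 1 :=
    ENNReal.ofReal_toReal (ENNReal.add_ne_top.2 ⟨hK, ENNReal.one_ne_top⟩)
  have hLe : ENNReal.ofReal (L + 1).toReal = L + 1 :=
    ENNReal.ofReal_toReal (ENNReal.add_ne_top.2 ⟨hLt, ENNReal.one_ne_top⟩)
  refine ⟨c.toNNReal, fun f hf => ?_⟩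
  have hF : AEMeasurable (fun y => ‖f y‖ₑ) (haar p n) := hf.1.enorm
  set F : Qpn p n → ℝ≥0∞ := fun y => ‖f y‖ₑ with hFdef
  have key : ∀ η, 0 < η → modular r f η ≤ 1 →
      ∫⁻ x, (fracMaxE (α + β) F x / ENNReal.ofReal η) ^ q x ∂(haar p n) ≤ K := fun η hη hmod => by
    rw [modular_eq_lintegral hr1 f hη] at hmod
    have hη' : (ENNReal.ofReal η)⁻¹ ≠ ∞ := ENNReal.inv_ne_top.2 (by simpa using hη)
    have h1 := hmax (fun y => (ENNReal.ofReal η)⁻¹ * F y) (hF.const_mul _) (by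
      simpa only [div_eq_mul_inv, mul_comm, hFdef] using hmod)
    refine le_trans (le_of_eq (lintegral_congr fun x => ?_)) h1
    rw [fracMaxE_const_mul hη', div_eq_mul_inv, mul_comm]
  obtain ⟨η₀, hη₀, hmod₀⟩ := hf.exists_modular_le_one hr1
  have hη₀' : ENNReal.ofReal η₀ ≠ 0 := by simpa using hη₀
  have hs_fin : ∀ᵐ x ∂(haar p n), fracMaxE (α + β) F x < ∞ := by
    have h1 := key η₀ hη₀ hmod₀
    have h2 : ∀ᵐ x ∂(haar p n), (fracMaxE (α + β) F x / ENNReal.ofReal η₀) ^ q x < ∞ :=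
      ae_lt_top (((measurable_fracMaxE _ F).div_const _).pow hqm) (h1.trans_lt hK.lt_top).ne
    filter_upwards [h2] with x hx
    have h3 := (ENNReal.rpow_lt_top_iff_of_pos (zero_lt_one.trans (hq1 x))).1 hx
    by_contra h4
    rw [not_lt, top_le_iff] at h4
    rw [h4, ENNReal.top_div_of_ne_top ENNReal.ofReal_ne_top] at h3
    exact h3.false
  -- After scaling by `η₀`, `F` is at most `1` plus its own modular integrand, which is integrable.
  have hl_fin : ∀ᵐ x ∂(haar p n), hlMax F x < ∞ := by
    rw [modular_eq_lintegral hr1 f hη₀] at hmod₀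
    have h1 := ae_hlMax_lt_top hn (F := fun x => (F x / ENNReal.ofReal η₀) ^ r x)
      ((hF.div_const _).pow hrm.aemeasurable) (hmod₀.trans_lt ENNReal.one_lt_top).ne
    filter_upwards [h1] with x hx
    have hle : F ≤ fun y => ENNReal.ofReal η₀ * (1 + (F y / ENNReal.ofReal η₀) ^ r y) := fun y => by
      have h2 : F y / ENNReal.ofReal η₀ ≤ 1 + (F y / ENNReal.ofReal η₀) ^ r y := by
        rcases le_total (F y / ENNReal.ofReal η₀) 1 with h | h
        · exact h.trans le_self_add
        · refine le_add_left ?_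
          simpa using ENNReal.rpow_le_rpow_of_exponent_le h (hr1 y).le
      calc F y = ENNReal.ofReal η₀ * (F y / ENNReal.ofReal η₀) :=
            (ENNReal.mul_div_cancel hη₀' ENNReal.ofReal_ne_top).symm
        _ ≤ _ := mul_le_mul' le_rfl h2
    refine (hlMax_mono hle x).trans_lt ?_
    refine lt_of_le_of_lt (b := ENNReal.ofReal η₀ * (1 + hlMax _ x)) (iSup_le fun γ => ?_)
      (ENNReal.mul_lt_top ENNReal.ofReal_lt_top (ENNReal.add_lt_top.2 ⟨ENNReal.one_lt_top, hx⟩))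
    rw [ballAvg_const_mul ENNReal.ofReal_ne_top]
    gcongr
    exact (ballAvg_le_hlMax γ _ x).trans (hlMax_add_const_le 1 x)
  have hfin : ∀ᵐ x ∂(haar p n), fracMax α f x < ∞ := by
    filter_upwards [hs_fin, hl_fin] with x h1 h2
    rw [fracMax_eq_fracMaxE]
    exact (fracMaxE_le_add_hlMax hα.le hβ.le F x).trans_lt (ENNReal.add_lt_top.2 ⟨h1, h2⟩)
  have e₀ : ∀ x, fracMax α (fun y => b y * f y) x = fracMax α (fun y => b₀ y * f y) x := fun x => by
    rw [fracMax_eq_fracMaxE, fracMax_eq_fracMaxE]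
    refine fracMaxE_congr_ae ?_ x
    filter_upwards [hbb] with y hy
    rw [hy]
  have hfin' : ∀ᵐ x ∂(haar p n), fracMax α (fun y => b₀ y * f y) x < ∞ := by
    filter_upwards [hfin, hs_fin] with x h1 h2
    rw [fracMax_eq_fracMaxE] at h1 ⊢
    simp only [enorm_mul]
    exact (fracMaxE_mul_le hn hβ hLt F x).trans_lt (ENNReal.add_lt_top.2
      ⟨ENNReal.mul_lt_top enorm_lt_top h1, ENNReal.mul_lt_top hLt.lt_top h2⟩)
  have hcomm : ∀ᵐ x ∂(haar p n), ‖commutator α b f x‖ₑ ≤ L * fracMaxE (α + β) F x := by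
    filter_upwards [hfin, hfin', commutator_congr_ae hbb] with x h1 h2 h3
    rw [h3]
    exact enorm_commutator_le hn hβ hb0 hLt hb.1 hf.1 h1 h2
  have hbound : ∀ η, 0 < η → modular r f η ≤ 1 → modular q (commutator α b f) (c * η) ≤ 1 := by
    intro η hη hmod
    have hLη : 0 < (L + 1).toReal * η := by positivity
    rw [hc, mul_assoc]
    refine modular_mul_le_one hq1 hLη hK1 ?_
    rw [modular_eq_lintegral hq1 _ hLη, hKe]
    refine le_trans (lintegral_mono_ae ?_) ((key η hη hmod).trans le_self_add)
    filter_upwards [hcomm] with x hx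
    refine ENNReal.rpow_le_rpow ?_ (zero_lt_one.trans (hq1 x)).le
    rw [ENNReal.ofReal_mul (by positivity), hLe]
    have hL0 : L + 1 ≠ 0 := by simp
    have hLt' : L + 1 ≠ ∞ := ENNReal.add_ne_top.2 ⟨hLt, ENNReal.one_ne_top⟩
    calc ‖commutator α b f x‖ₑ / ((L + 1) * ENNReal.ofReal η)
        ≤ (L + 1) * fracMaxE (α + β) F x / ((L + 1) * ENNReal.ofReal η) := by
          gcongr
          exact hx.trans (by gcongr; exact le_self_add)
      _ = _ := ENNReal.mul_div_mul_left _ _ hL0 hLt'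
  have hmeas : AEStronglyMeasurable (commutator α b f) (haar p n) := by
    have h1 : ∀ g : Qpn p n → ℝ, Measurable fun x => (fracMax α g x).toReal := fun g => by
      simp only [fracMax_eq_fracMaxE]
      exact (measurable_fracMaxE α _).ennreal_toReal
    refine (AEStronglyMeasurable.congr ?_ (commutator_congr_ae hbb).symm)
    exact ((hb.1.mul (h1 f)).sub (h1 _)).aestronglyMeasurable
  refine ⟨?_, ⟨hmeas, c * η₀, by positivity,
    (hbound η₀ hη₀ hmod₀).trans_lt ENNReal.one_lt_top⟩, luxNorm_le_mul hc0 hbound⟩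
  filter_upwards [hfin, hfin'] with x h1 h2
  exact ⟨h1, by rw [e₀]; exact h2⟩

end Commutator

/-! ### Testing on balls, and means controlled by Luxemburg norms. -/

section Oscillation

variable {p : ℕ} [Fact p.Prime] {n : ℕ}

/-- On a ball `B`, the maximal function of a function supported in `B` only involves balls
contained in `B`. -/
lemma fracMax_indicator_eq {α : ℝ} (hα : α ≤ n) (g : Qpn p n → ℝ) (γ : ℤ) {a x : Qpn p n}
    (hx : x ∈ pball γ a) :
    fracMax α ((pball γ a).indicator g) x = fracMaxOn α (pball γ a) g x := by
  have hexp : 0 ≤ 1 - α / n := sub_nonneg.2 (div_le_one_of_le₀ hα n.cast_nonneg)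
  have hB : pball γ a = pball γ x := (pball_eq_of_mem hx).symm
  have hind : ∀ y, ‖(pball γ a).indicator g y‖ₑ = (pball γ a).indicator (fun y => ‖g y‖ₑ) y :=
    fun y => enorm_indicator_eq_indicator_enorm g y
  have hsub : ∀ γ', pball γ' x ⊆ pball γ a →
      ∫⁻ y in pball γ' x, ‖(pball γ a).indicator g y‖ₑ ∂(haar p n) =
        ∫⁻ y in pball γ' x, ‖g y‖ₑ ∂(haar p n) := fun γ' h =>
    setLIntegral_congr_fun (measurableSet_pball γ' x) fun y hy => by
      rw [Set.indicator_of_mem (h hy)]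
  apply le_antisymm
  · refine iSup_le fun γ' => ?_
    rcases le_total γ' γ with h | h
    · have h1 : pball γ' x ⊆ pball γ a := by rw [hB]; exact pball_mono h x
      rw [hsub γ' h1]
      exact le_iSup₂ (f := fun (γ : ℤ) (_ : pball γ x ⊆ pball _ a) =>
        (∫⁻ y in pball γ x, ‖g y‖ₑ ∂(haar p n)) / (haar p n (pball γ x)) ^ (1 - α / n)) γ' h1
    -- A ball larger than `B` captures no more of the integral but has larger volume, so it loses to
    -- `B` itself; `α ≤ n` gives the sign of the power.
    · refine le_trans ?_ (le_iSup₂ (f := fun (γ : ℤ) (_ : pball γ x ⊆ pball _ a) =>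
        (∫⁻ y in pball γ x, ‖g y‖ₑ ∂(haar p n)) / (haar p n (pball γ x)) ^ (1 - α / n)) γ hB.ge)
      have h1 : ∫⁻ y in pball γ' x, ‖(pball γ a).indicator g y‖ₑ ∂(haar p n) ≤
          ∫⁻ y in pball γ x, ‖g y‖ₑ ∂(haar p n) := by
        refine (setLIntegral_le_lintegral _ _).trans ?_
        simp only [hind]
        rw [lintegral_indicator (measurableSet_pball γ a), hB]
      refine ENNReal.div_le_div h1 (ENNReal.rpow_le_rpow ?_ hexp)
      exact measure_mono (pball_mono h x)
  · refine iSup₂_le fun γ' h => ?_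
    rw [← hsub γ' h]
    exact le_iSup (fun γ : ℤ => (∫⁻ y in pball γ x, ‖(pball _ a).indicator g y‖ₑ ∂(haar p n)) /
      (haar p n (pball γ x)) ^ (1 - α / n)) γ'

lemma fracMax_indicator_one {α : ℝ} (hα0 : 0 ≤ α) (hα : α ≤ n) (γ : ℤ) {a x : Qpn p n}
    (hx : x ∈ pball γ a) :
    fracMax α ((pball γ a).indicator fun _ => 1) x = ballVol p n γ ^ (α / n) := by
  rw [fracMax_indicator_eq hα _ γ hx]
  have hterm : ∀ γ', (∫⁻ _ in pball γ' x, ‖(1 : ℝ)‖ₑ ∂(haar p n)) /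
      (haar p n (pball γ' x)) ^ (1 - α / n) = ballVol p n γ' ^ (α / n) := fun γ' => by
    rw [setLIntegral_div_rpow_eq, ballAvg_const]; simp
  have hB : pball γ a = pball γ x := (pball_eq_of_mem hx).symm
  apply le_antisymm
  · refine iSup₂_le fun γ' h => ?_
    rw [hterm]
    refine ENNReal.rpow_le_rpow ?_ (by positivity)
    rw [← haar_pball γ' x, ← haar_pball γ a]
    exact measure_mono h
  · rw [← hterm γ]
    exact le_iSup₂ (f := fun (γ' : ℤ) (_ : pball γ' x ⊆ pball γ a) =>
      (∫⁻ _ in pball γ' x, ‖(1 : ℝ)‖ₑ ∂(haar p n)) / (haar p n (pball γ' x)) ^ (1 - α / n)) γ hB.ge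

/-- On the ball the two sides agree, by the values there of the maximal functions of `χ_B` and `b
χ_B`; off the ball the left side is zero. -/
lemma abs_oscFun_le {α : ℝ} (hα0 : 0 ≤ α) (hα : α ≤ n) (b : Qpn p n → ℝ) (γ : ℤ)
    (a x : Qpn p n) :
    |oscFun α b (pball γ a) x| ≤ (ballVol p n γ).toReal ^ (-α / n) *
      |commutator α b ((pball γ a).indicator fun _ => 1) x| := by
  have hv : 0 < (ballVol p n γ).toReal :=
    ENNReal.toReal_pos (ballVol_ne_zero p n γ) (ballVol_ne_top p n γ)
  have hw : 0 < (ballVol p n γ).toReal ^ (-α / n) := Real.rpow_pos_of_pos hv _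
  by_cases hx : x ∈ pball γ a
  · have e : (fun y => b y * (pball γ a).indicator (fun _ => 1) y) = (pball γ a).indicator b := by
      ext y
      by_cases hy : y ∈ pball γ a <;> simp [hy]
    rw [oscFun, Set.indicator_of_mem hx, commutator, e, fracMax_indicator_one hα0 hα γ hx,
      fracMax_indicator_eq hα b γ hx, haar_pball, ← abs_of_pos hw, ← abs_mul, mul_sub,
      abs_of_pos hw, mul_left_comm, ← ENNReal.toReal_rpow, ← Real.rpow_add hv]
    simp [neg_div]
  · rw [oscFun, Set.indicator_of_notMem hx, abs_zero]
    positivity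

/-- Testing the commutator on characteristic functions of balls. -/
theorem oscSup_lt_top_of_commutatorBounded {α β : ℝ} (hn : 0 < n) (hα : 0 < α) (hβ : 0 < β)
    (hαβ : α + β < n) {b r q : Qpn p n → ℝ} (h : AdmissiblePair (α + β) r q)
    (hC : CommutatorBounded α b r q) : oscSup α β b q < ∞ := by
  obtain ⟨C, hC⟩ := hC
  have hr1 := h.r_mem_P.one_lt_apply
  have hq1 := h.q_mem_Clog.memP.one_lt_apply
  refine lt_of_le_of_lt (b := 2 * (C : ℝ≥0∞)) (iSup₂_le fun γ a => ?_)
    (ENNReal.mul_lt_top (by simp) ENNReal.coe_lt_top)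
  obtain ⟨-, -, hnorm⟩ := hC _ (memLvar_indicator_pball hr1 γ a)
  have hV0 := ballVol_ne_zero p n γ
  have hVt := ballVol_ne_top p n γ
  have hv : 0 < (ballVol p n γ).toReal := ENNReal.toReal_pos hV0 hVt
  have hw : 0 < (ballVol p n γ).toReal ^ (-α / n) := Real.rpow_pos_of_pos hv _
  have hwe : ENNReal.ofReal ((ballVol p n γ).toReal ^ (-α / n)) = ballVol p n γ ^ (-α / n) := by
    rw [← ENNReal.ofReal_rpow_of_pos hv, ENNReal.ofReal_toReal hVt]
  have h1 : luxNorm q (oscFun α b (pball γ a)) ≤ ballVol p n γ ^ (-α / n) *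
      luxNorm q (commutator α b ((pball γ a).indicator fun _ => 1)) := by
    rw [← hwe]
    refine luxNorm_le_mul hw fun η hη hmod => le_trans ?_ hmod
    refine lintegral_mono fun x => ENNReal.ofReal_le_ofReal ?_
    refine Real.rpow_le_rpow (by positivity) ?_ (zero_lt_one.trans (hq1 x)).le
    rw [div_le_div_iff₀ (by positivity) hη]
    have h2 := abs_oscFun_le hα.le (by linarith) b γ a x
    calc |oscFun α b (pball γ a) x| * η ≤ ((ballVol p n γ).toReal ^ (-α / n) *
          |commutator α b ((pball γ a).indicator fun _ => 1) x|) * η := by gcongr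
      _ = _ := by ring
  set N := luxNorm q ((pball γ a).indicator fun _ => 1)
  rw [haar_pball]
  set V := ballVol p n γ
  have h2 : luxNorm q (oscFun α b (pball γ a)) ≤ (2 * C * V ^ (β / n)) * N := by
    calc _ ≤ V ^ (-α / n) * (C * (2 * V ^ ((α + β) / n) * N)) := by
          refine h1.trans ?_
          gcongr
          refine hnorm.trans ?_
          gcongr
          exact h.luxNorm_indicator_le hn (add_pos hα hβ) γ a
      _ = 2 * C * (V ^ (-α / n) * V ^ ((α + β) / n)) * N := by ring
      _ = _ := by
          rw [← ENNReal.rpow_add _ _ hV0 hVt]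
          congr 3
          ring
  have hVβ0 : V ^ (β / n) ≠ 0 := (ENNReal.rpow_pos (pos_iff_ne_zero.2 hV0) hVt).ne'
  have hVβt : V ^ (β / n) ≠ ∞ := ENNReal.rpow_ne_top_of_nonneg (by positivity) hVt
  calc 1 / V ^ (β / n) * (luxNorm q (oscFun α b (pball γ a)) / N)
      ≤ 1 / V ^ (β / n) * (2 * C * V ^ (β / n)) := by
        gcongr
        exact ENNReal.div_le_of_le_mul h2
    _ = 2 * C := by
        rw [one_div, mul_left_comm, ENNReal.inv_mul_cancel hVβ0 hVβt, mul_one]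

/-- For a log-Hölder exponent, each ball `B` has a weight `w` comparable to the inverse of the
norm of its characteristic function and to the largest mean over `B` of functions in the unit
ball of `L^{q(·)}`. -/
lemma exists_ball_weight (hn : 0 < n) {q : Qpn p n → ℝ} (hq : MemClog q) :
    ∃ K : ℝ≥0∞, 1 ≤ K ∧ K ≠ ∞ ∧ ∀ (γ : ℤ) (a : Qpn p n), ∃ w : ℝ≥0∞, w ≠ 0 ∧ w ≠ ∞ ∧
      (∀ G : Qpn p n → ℝ≥0∞, AEMeasurable G (haar p n) → ∫⁻ x, G x ^ q x ∂(haar p n) ≤ 1 →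
        ballAvg γ G a ≤ K * w) ∧
      ∫⁻ x in pball γ a, w ^ q x ∂(haar p n) ≤ K := by
  have hq1 := hq.memP.one_lt_apply
  have hqm := hq.memP.measurable
  obtain ⟨C, hC, hloc⟩ := hq.exists_local
  obtain ⟨X, q₀, hX, hq₀, hlim⟩ := exists_tendsto_infty hn hq.memP.le_apply hq.memP.apply_le
  have hq₀1 : 1 < q₀ := hq.memP.one_lt.trans_le hq₀.1
  have hq₀0 : 0 < q₀ := zero_lt_one.trans hq₀1
  obtain ⟨C', hC', hlog⟩ := hq.infty.limit hX hlim
  set P : ℝ≥0∞ := (p : ℝ≥0∞) ^ (n * C) with hP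
  have hPt : P ≠ ∞ := ENNReal.rpow_ne_top_of_nonneg (by positivity) (ENNReal.natCast_ne_top p)
  set K₁ : ℝ≥0∞ := ENNReal.ofReal ((p : ℝ) ^ ((n + 1) * C'))
  set I : ℝ≥0∞ := ∫⁻ x : Qpn p n, decay x ∂(haar p n)
  have hIt : I ≠ ∞ := lintegral_decay_ne_top p n
  set D : ℝ≥0∞ := K₁ * 1 + I
  have hDt : D ≠ ∞ := ENNReal.add_ne_top.2
    ⟨ENNReal.mul_ne_top ENNReal.ofReal_ne_top ENNReal.one_ne_top, hIt⟩
  set K : ℝ≥0∞ := 2 + P + D + D ^ (1 / q₀)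
  have hK1 : 1 ≤ K := by
    calc (1 : ℝ≥0∞) ≤ 2 := one_le_two
      _ ≤ 2 + (P + D + D ^ (1 / q₀)) := le_self_add
      _ = K := by simp only [K]; ring
  have hKt : K ≠ ∞ := by
    simp only [K, ENNReal.add_ne_top]
    exact ⟨⟨⟨by simp, hPt⟩, hDt⟩, ENNReal.rpow_ne_top_of_nonneg (by positivity) hDt⟩
  have hK2 : 2 ≤ K := by
    calc (2 : ℝ≥0∞) ≤ 2 + (P + D + D ^ (1 / q₀)) := le_self_add
      _ = K := by simp only [K]; ring
  refine ⟨K, hK1, hKt, fun γ a => ?_⟩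
  have hV0 := ballVol_ne_zero p n γ
  have hVt := ballVol_ne_top p n γ
  have hvol0 : ballVol p n 0 = 1 := by simp [ballVol]
  set V := ballVol p n γ with hV
  have hVi0 : V⁻¹ ≠ 0 := ENNReal.inv_ne_zero.2 hVt
  have hVit : V⁻¹ ≠ ∞ := ENNReal.inv_ne_top.2 hV0
  have hle : ∀ {u : ℝ≥0∞} {c d : ℝ}, 1 ≤ c → c ≤ d → u ^ c ≤ 1 + u ^ d := by
    intro u c d hc hcd
    rcases le_total u 1 with h | h
    · exact (ENNReal.rpow_le_one h (by linarith)).trans le_self_add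
    · exact le_add_left (ENNReal.rpow_le_rpow_of_exponent_le h hcd)
  -- Small balls use `e`, the essential infimum of `q` on the ball, with weight `V ^ (-1 / e)` and
  -- the local condition. Large balls use the limit exponent `q₀`, with weight `V ^ (-1 / q₀) ≤ 1`
  -- and the condition at infinity.
  rcases le_total γ 0 with h | h
  · obtain ⟨k, hk⟩ := Int.exists_eq_neg_ofNat h
    have hloc' := hloc k a
    rw [← hk] at hloc'
    have he1 : 1 < ballInf q γ a := hq.memP.one_lt.trans_le (hq.memP.essInf_le_ballInf γ a)
    set e := ballInf q γ a
    have he0 : 0 < e := zero_lt_one.trans he1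
    have hV1 : 1 ≤ V⁻¹ := by
      rw [ENNReal.one_le_inv, ← hvol0]; exact ballVol_mono p n h
    refine ⟨V⁻¹ ^ (1 / e), (ENNReal.rpow_pos (pos_iff_ne_zero.2 hVi0) hVit).ne',
      ENNReal.rpow_ne_top_of_nonneg (by positivity) hVit, fun G hG hI => ?_, ?_⟩
    · have h1 : ballAvg γ G a ^ e ≤ 2 * V⁻¹ := by
        calc ballAvg γ G a ^ e ≤ ballAvg γ (fun y => G y ^ e) a := ballAvg_rpow_le hG he1.le γ a
          _ ≤ ballAvg γ (fun y => 1 + G y ^ q y) a := by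
              refine ballAvg_mono_ae ?_
              filter_upwards [hloc'] with y hy
              exact hle he1.le hy.1
          _ ≤ 1 + 1 / V := by
              rw [ballAvg_add aemeasurable_const, ballAvg_const]
              gcongr
              exact (ballAvg_le_lintegral_div γ _ a).trans (by gcongr)
          _ ≤ V⁻¹ + V⁻¹ := by rw [one_div]; gcongr
          _ = 2 * V⁻¹ := (two_mul _).symm
      calc ballAvg γ G a ≤ (2 * V⁻¹) ^ (1 / e) := by
            rw [one_div, ENNReal.le_rpow_inv_iff he0]; exact h1
        _ = 2 ^ (1 / e) * V⁻¹ ^ (1 / e) := ENNReal.mul_rpow_of_nonneg _ _ (by positivity)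
        _ ≤ K * V⁻¹ ^ (1 / e) := by
            gcongr
            refine le_trans ?_ hK2
            conv_rhs => rw [← ENNReal.rpow_one 2]
            exact ENNReal.rpow_le_rpow_of_exponent_le one_le_two ((div_le_one he0).2 he1.le)
    · calc ∫⁻ x in pball γ a, (V⁻¹ ^ (1 / e)) ^ q x ∂(haar p n)
          ≤ ∫⁻ _ in pball γ a, V⁻¹ * P ∂(haar p n) := by
            refine lintegral_mono_ae ?_
            filter_upwards [hloc'] with y hy
            have e1 : 1 / e * q y = 1 + (q y - e) / e := by field_simp; ring
            rw [← ENNReal.rpow_mul, e1, ENNReal.rpow_add _ _ hVi0 hVit, ENNReal.rpow_one]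
            gcongr
            rw [hV, hk, ballVol, ← ENNReal.rpow_neg, ← ENNReal.rpow_mul]
            apply ENNReal.rpow_le_rpow_of_exponent_le (one_le_prime p)
            push_cast
            have h1 : (k : ℝ) * ((q y - e) / e) ≤ C := by
              refine le_trans ?_ hy.2
              gcongr
              exact div_le_self (sub_nonneg.2 hy.1) he1.le
            calc -((n : ℝ) * -k) * ((q y - e) / e) = n * (k * ((q y - e) / e)) := by ring
              _ ≤ n * C := by gcongr
        _ = P := by
            rw [setLIntegral_const, haar_pball, ← hV, mul_right_comm,
              ENNReal.inv_mul_cancel hV0 hVt, one_mul]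
        _ ≤ 2 + P := le_add_self
        _ ≤ K := by simp only [K, add_assoc]; gcongr; exact le_self_add
  · have hV1 : V⁻¹ ≤ 1 := by
      rw [ENNReal.inv_le_one, ← hvol0]; exact ballVol_mono p n h
    set w := V⁻¹ ^ (1 / q₀) with hw
    have hw1 : w ≤ 1 := ENNReal.rpow_le_one hV1 (by positivity)
    have hwq : w ^ q₀ = V⁻¹ := by
      rw [hw, ← ENNReal.rpow_mul, one_div_mul_cancel hq₀0.ne', ENNReal.rpow_one]
    refine ⟨w, (ENNReal.rpow_pos (pos_iff_ne_zero.2 hVi0) hVit).ne',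
      ENNReal.rpow_ne_top_of_nonneg (by positivity) hVit, fun G hG hI => ?_, ?_⟩
    -- The truncation can be measured with the constant exponent `q₀`. The excess is dominated by `G
    -- ^ q`, whose mean is at most `V⁻¹ ≤ w`.
    · have hGle : G ≤ fun y => min (G y) 1 + G y ^ q y := fun y => by
        rcases le_total (G y) 1 with h | h
        · simp only [min_eq_left h]; exact le_self_add
        · refine le_add_left ?_
          simpa using ENNReal.rpow_le_rpow_of_exponent_le h (hq1 y).le
      have hm : AEMeasurable (fun y => min (G y) 1) (haar p n) := hG.min aemeasurable_const
      have h1 : ∫⁻ x, min (G x) 1 ^ q₀ ∂(haar p n) ≤ D := by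
        refine (lintegral_rpow_le_of_le_one hq₀1.le hqm hlog hm fun x => min_le_right _ _).trans ?_
        refine add_le_add (mul_le_mul' le_rfl ?_) le_rfl
        refine (lintegral_mono fun x => ?_).trans hI
        exact ENNReal.rpow_le_rpow (min_le_left _ _) (zero_lt_one.trans (hq1 x)).le
      have h2 : ballAvg γ (fun y => min (G y) 1) a ≤ D ^ (1 / q₀) * w := by
        have h3 := (ballVol_mul_ballAvg_rpow_le hm hq₀1.le γ a).trans h1
        rw [hw, ← ENNReal.mul_rpow_of_nonneg _ _ (by positivity), one_div,
          ENNReal.le_rpow_inv_iff hq₀0, ← div_eq_mul_inv,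
          ENNReal.le_div_iff_mul_le (Or.inl hV0) (Or.inl hVt), mul_comm]
        exact h3
      have h4 : ballAvg γ (fun y => G y ^ q y) a ≤ w := by
        refine (ballAvg_le_lintegral_div γ _ a).trans ?_
        calc _ ≤ 1 / V := by gcongr
          _ = V⁻¹ ^ (1 : ℝ) := by rw [one_div, ENNReal.rpow_one]
          _ ≤ w := ENNReal.rpow_le_rpow_of_exponent_ge hV1 ((div_le_one hq₀0).2 hq₀1.le)
      calc ballAvg γ G a ≤ D ^ (1 / q₀) * w + w := by
            refine (ballAvg_mono hGle γ a).trans ?_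
            rw [ballAvg_add hm]
            gcongr
        _ = (1 + D ^ (1 / q₀)) * w := by ring
        _ ≤ K * w := by
            gcongr
            simp only [K]
            gcongr
            rw [add_assoc]
            exact one_le_two.trans le_self_add
    · have hB := measurableSet_pball γ a
      calc ∫⁻ x in pball γ a, w ^ q x ∂(haar p n)
          ≤ ∫⁻ x in pball γ a, (K₁ * V⁻¹ + decay x) ∂(haar p n) := by
            refine lintegral_mono fun x => ?_
            rw [← hwq]
            exact rpow_le_rpow_add_decay hw1 (hq1 x).le (hlog x)
        _ ≤ K₁ * 1 + I := by
            rw [lintegral_add_left measurable_const, setLIntegral_const, haar_pball, ← hV,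
              mul_assoc, ENNReal.inv_mul_cancel hV0 hVt]
            gcongr
            exact setLIntegral_le_lintegral _ _
        _ ≤ 2 + P + D := le_add_self
        _ ≤ K := le_self_add

/-- Means over a ball are controlled by the norm in `L^{q(·)}`. -/
lemma exists_ballAvg_mul_luxNorm_le (hn : 0 < n) {q : Qpn p n → ℝ} (hq : MemClog q) :
    ∃ K : ℝ≥0∞, K ≠ ∞ ∧ ∀ (γ : ℤ) (a : Qpn p n) (g : Qpn p n → ℝ),
      AEStronglyMeasurable g (haar p n) →
      ballAvg γ (fun y => ‖g y‖ₑ) a * luxNorm q ((pball γ a).indicator fun _ => 1) ≤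
        K * luxNorm q g := by
  obtain ⟨K, hK1, hKt, h⟩ := exists_ball_weight hn hq
  have hq1 := hq.memP.one_lt_apply
  have hK0 : K ≠ 0 := (zero_lt_one.trans_le hK1).ne'
  refine ⟨K * K, ENNReal.mul_ne_top hKt hKt, fun γ a g hg => ?_⟩
  -- The weight cancels: the norm of the characteristic function is at most `K / w`, the mean of
  -- `|g|` at most `K w` times the norm of `g`.
  obtain ⟨w, hw0, hwt, hmean, hmod⟩ := h γ a
  have hKw0 : K * w⁻¹ ≠ 0 := mul_ne_zero hK0 (ENNReal.inv_ne_zero.2 hwt)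
  have hKwt : K * w⁻¹ ≠ ∞ := ENNReal.mul_ne_top hKt (ENNReal.inv_ne_top.2 hw0)
  have h1 : luxNorm q ((pball γ a).indicator fun _ => 1) ≤ K * w⁻¹ := by
    have hpos : 0 < (K * w⁻¹).toReal := ENNReal.toReal_pos hKw0 hKwt
    rw [← ENNReal.ofReal_toReal hKwt]
    refine luxNorm_le hpos ?_
    rw [modular_indicator_one hq1 (measurableSet_pball γ a) hpos, ENNReal.ofReal_toReal hKwt]
    have hB := measurableSet_pball γ a
    have h2 := lintegral_div_rpow_le_one hq1 (G := (pball γ a).indicator fun _ => w) hK1 hKt (by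
      refine le_trans (le_of_eq ?_) hmod
      rw [← lintegral_indicator hB]
      refine lintegral_congr fun x => ?_
      by_cases hx : x ∈ pball γ a
      · simp [hx]
      · simp [hx, zero_lt_one.trans (hq1 x)])
    refine le_trans ?_ h2
    rw [← lintegral_indicator hB]
    refine lintegral_mono fun x => ?_
    by_cases hx : x ∈ pball γ a
    · simp only [Set.indicator_of_mem hx]
      rw [ENNReal.mul_inv (Or.inl hK0) (Or.inl hKt), inv_inv, div_eq_mul_inv, mul_comm]
    · simp only [Set.indicator_of_notMem hx]
      exact zero_le
  have hKw0' : K * w ≠ 0 := mul_ne_zero hK0 hw0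
  have hKwt' : K * w ≠ ∞ := ENNReal.mul_ne_top hKt hwt
  have h2 : ballAvg γ (fun y => ‖g y‖ₑ) a ≤ K * w * luxNorm q g := by
    rw [mul_comm, ← ENNReal.div_le_iff_le_mul (Or.inl hKw0') (Or.inl hKwt')]
    refine le_iInf₂ fun η hη => ?_
    rw [ENNReal.div_le_iff_le_mul (Or.inl hKw0') (Or.inl hKwt')]
    have hη0 : ENNReal.ofReal η ≠ 0 := by simpa using hη.1
    have hηi : (ENNReal.ofReal η)⁻¹ ≠ ∞ := ENNReal.inv_ne_top.2 hη0
    have hm := hη.2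
    rw [modular_eq_lintegral hq1 g hη.1] at hm
    have h3 := hmean (fun y => (ENNReal.ofReal η)⁻¹ * ‖g y‖ₑ) (hg.enorm.const_mul _) (by
      simpa only [div_eq_mul_inv, mul_comm] using hm)
    rw [ballAvg_const_mul hηi] at h3
    calc ballAvg γ (fun y => ‖g y‖ₑ) a
        = ENNReal.ofReal η * ((ENNReal.ofReal η)⁻¹ * ballAvg γ (fun y => ‖g y‖ₑ) a) := by
          rw [← mul_assoc, ENNReal.mul_inv_cancel hη0 ENNReal.ofReal_ne_top, one_mul]
      _ ≤ ENNReal.ofReal η * (K * w) := by gcongr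
  calc _ ≤ (K * w * luxNorm q g) * (K * w⁻¹) := by gcongr
    _ = K * K * luxNorm q g * (w * w⁻¹) := by ring
    _ = _ := by rw [ENNReal.mul_inv_cancel hw0 hwt, mul_one]

lemma luxNorm_indicator_pball_ne_top {q : Qpn p n → ℝ} (hq : ∀ x, 1 < q x) (γ : ℤ)
    (a : Qpn p n) : luxNorm q ((pball γ a).indicator fun _ => 1) ≠ ∞ := by
  obtain ⟨η, hη, h⟩ := (memLvar_indicator_pball hq γ a).exists_modular_le_one hq
  exact ((luxNorm_le hη h).trans_lt ENNReal.ofReal_lt_top).ne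

lemma luxNorm_indicator_pball_ne_zero {q : Qpn p n → ℝ} (hq : ∀ x, 1 < q x) (γ : ℤ)
    (a : Qpn p n) : luxNorm q ((pball γ a).indicator fun _ => 1) ≠ 0 := by
  have hV0 := ballVol_ne_zero p n γ
  have hpos : 0 < min 1 (ballVol p n γ) := lt_min one_pos (pos_iff_ne_zero.2 hV0)
  refine (hpos.trans_le (le_iInf₂ fun η hη => ?_)).ne'
  have hm := hη.2
  rw [modular_indicator_one hq (measurableSet_pball γ a) hη.1] at hm
  rcases le_total 1 (ENNReal.ofReal η) with h | h
  · exact (min_le_left _ _).trans h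
  · refine (min_le_right _ _).trans ?_
    have hη0 : ENNReal.ofReal η ≠ 0 := by simpa using hη.1
    have h1 : ∫⁻ _ in pball γ a, (ENNReal.ofReal η)⁻¹ ∂(haar p n) ≤ 1 := by
      refine (lintegral_mono fun x => ?_).trans hm
      simpa using ENNReal.rpow_le_rpow_of_exponent_le (ENNReal.one_le_inv.2 h) (hq x).le
    rw [setLIntegral_const, haar_pball, mul_comm, ← div_eq_mul_inv,
      ENNReal.div_le_iff_le_mul (Or.inl hη0) (Or.inl ENNReal.ofReal_ne_top), one_mul] at h1
    exact h1

end Oscillation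

/-! ### From the oscillation condition to a Lipschitz representative. -/

section Campanato

variable {p : ℕ} [Fact p.Prime] {n : ℕ}

lemma ballAvg_enorm_lt_top {b : Qpn p n → ℝ} (hb : LocallyIntegrable b (haar p n)) (γ : ℤ)
    (a : Qpn p n) : ballAvg γ (fun y => ‖b y‖ₑ) a < ∞ :=
  ENNReal.div_lt_top (hb.integrableOn_isCompact (isCompact_pball γ a)).2.ne (ballVol_ne_zero p n γ)

/-- The mean of `|b|` over a ball, as a real number. -/
noncomputable def ballMean (b : Qpn p n → ℝ) (γ : ℤ) (a : Qpn p n) : ℝ :=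
  (ballAvg γ (fun y => ‖b y‖ₑ) a).toReal

lemma ballMean_nonneg (b : Qpn p n → ℝ) (γ : ℤ) (a : Qpn p n) : 0 ≤ ballMean b γ a :=
  ENNReal.toReal_nonneg

lemma ofReal_ballMean {b : Qpn p n → ℝ} (hb : LocallyIntegrable b (haar p n)) (γ : ℤ)
    (a : Qpn p n) : ENNReal.ofReal (ballMean b γ a) = ballAvg γ (fun y => ‖b y‖ₑ) a :=
  ENNReal.ofReal_toReal (ballAvg_enorm_lt_top hb γ a).ne

lemma measurable_ballMean (b : Qpn p n → ℝ) (γ : ℤ) : Measurable (ballMean b γ) :=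
  (measurable_ballAvg γ _).ennreal_toReal

lemma ballMean_eq_of_mem (b : Qpn p n → ℝ) {γ : ℤ} {x y : Qpn p n} (h : y ∈ pball γ x) :
    ballMean b γ y = ballMean b γ x := by
  rw [ballMean, ballMean, ballAvg_eq_of_mem le_rfl _ h]

/-- Balls inside `B` have volume at most `|B|`, so the Hardy–Littlewood maximal function of `|b|
χ_B` controls the supremum. Hence `toReal` in `oscFun` is a true value almost everywhere. -/
lemma ae_fracMaxOn_lt_top {α : ℝ} (hn : 0 < n) (hα : 0 ≤ α) {b : Qpn p n → ℝ}
    (hb : LocallyIntegrable b (haar p n)) (γ : ℤ) (a : Qpn p n) :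
    ∀ᵐ y ∂(haar p n), fracMaxOn α (pball γ a) b y < ∞ := by
  have hB := measurableSet_pball γ a
  have hi := hb.integrableOn_isCompact (isCompact_pball γ a)
  have h1 := ae_hlMax_lt_top hn (F := (pball γ a).indicator fun y => ‖b y‖ₑ)
    (hb.aestronglyMeasurable.enorm.indicator hB) (by
      rw [lintegral_indicator hB]; exact hi.2.ne)
  filter_upwards [h1] with y hy
  refine lt_of_le_of_lt (iSup₂_le fun γ' h => ?_) (ENNReal.mul_lt_top
    (ENNReal.rpow_lt_top_of_nonneg (by positivity : 0 ≤ α / n) (ballVol_ne_top p n γ)) hy)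
  rw [setLIntegral_div_rpow_eq]
  refine mul_le_mul' (ENNReal.rpow_le_rpow ?_ (by positivity)) ?_
  · rw [← haar_pball γ' y, ← haar_pball γ a]
    exact measure_mono h
  · refine le_trans (ballAvg_mono_ae ?_) (ballAvg_le_hlMax γ' _ y)
    filter_upwards [ae_restrict_mem (measurableSet_pball γ' y)] with z hz
    rw [Set.indicator_of_mem (h hz)]

lemma aestronglyMeasurable_oscFun {α : ℝ} (hα : α ≤ n) {b : Qpn p n → ℝ}
    (hb : LocallyIntegrable b (haar p n)) (γ : ℤ) (a : Qpn p n) :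
    AEStronglyMeasurable (oscFun α b (pball γ a)) (haar p n) := by
  have e : oscFun α b (pball γ a) = (pball γ a).indicator fun y => b y -
      (haar p n (pball γ a)).toReal ^ (-α / n) *
        (fracMaxE α (fun z => ‖(pball γ a).indicator b z‖ₑ) y).toReal := by
    refine Set.indicator_congr fun y hy => ?_
    rw [← fracMax_eq_fracMaxE, fracMax_indicator_eq hα b γ hy]
  rw [e]
  refine AEStronglyMeasurable.indicator (hb.aestronglyMeasurable.sub ?_) (measurableSet_pball γ a)
  exact ((measurable_fracMaxE α _).ennreal_toReal.const_mul _).aestronglyMeasurable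

/-- The ball itself competes in the restricted supremum, so the term subtracted from `b` in `oscFun`
is at least the mean of `|b|`. -/
lemma ofReal_ballMean_sub_le {α : ℝ} (hn : 0 < n) (hα : 0 ≤ α) {b : Qpn p n → ℝ}
    (hb : LocallyIntegrable b (haar p n)) (γ : ℤ) (a : Qpn p n) :
    ∀ᵐ y ∂((haar p n).restrict (pball γ a)),
      ENNReal.ofReal (ballMean b γ a - b y) ≤ ‖oscFun α b (pball γ a) y‖ₑ := by
  filter_upwards [ae_restrict_of_ae (ae_fracMaxOn_lt_top hn hα hb γ a),
    ae_restrict_mem (measurableSet_pball γ a)] with y hfin hy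
  have hV0 := ballVol_ne_zero p n γ
  have hVt := ballVol_ne_top p n γ
  have hv : 0 < (ballVol p n γ).toReal := ENNReal.toReal_pos hV0 hVt
  have hB : pball γ a = pball γ y := (pball_eq_of_mem hy).symm
  have h1 : ballVol p n γ ^ (α / n) * ballAvg γ (fun z => ‖b z‖ₑ) a ≤
      fracMaxOn α (pball γ a) b y := by
    rw [← ballAvg_eq_of_mem le_rfl _ hy, ← setLIntegral_div_rpow_eq]
    exact le_iSup₂ (f := fun (γ' : ℤ) (_ : pball γ' y ⊆ pball γ a) =>
      (∫⁻ z in pball γ' y, ‖b z‖ₑ ∂(haar p n)) / (haar p n (pball γ' y)) ^ (1 - α / n)) γ hB.ge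
  have h2 := ENNReal.toReal_mono hfin.ne h1
  rw [ENNReal.toReal_mul, ← ENNReal.toReal_rpow] at h2
  have h3 : ballMean b γ a ≤ (ballVol p n γ).toReal ^ (-α / n) *
      (fracMaxOn α (pball γ a) b y).toReal := by
    calc ballMean b γ a = (ballVol p n γ).toReal ^ (-α / n) *
          ((ballVol p n γ).toReal ^ (α / n) * ballMean b γ a) := by
          rw [← mul_assoc, ← Real.rpow_add hv, neg_div, neg_add_cancel, Real.rpow_zero, one_mul]
      _ ≤ _ := by
          have := Real.rpow_pos_of_pos hv (-α / n)
          gcongr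
          exact h2
  rw [oscFun, Set.indicator_of_mem hy, haar_pball, Real.enorm_eq_ofReal_abs]
  refine ENNReal.ofReal_le_ofReal (le_trans ?_ (neg_le_abs _))
  linarith

/-- The oscillation of `b` around the means of `|b|`. -/
lemma ballAvg_sub_ballMean_le {b : Qpn p n → ℝ} (hb : LocallyIntegrable b (haar p n)) (γ : ℤ)
    (a : Qpn p n) :
    ballAvg γ (fun y => ‖b y - ballMean b γ a‖ₑ) a ≤
      2 * ballAvg γ (fun y => ENNReal.ofReal (ballMean b γ a - b y)) a := by
  set c := ballMean b γ a with hc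
  have hc0 : 0 ≤ c := ballMean_nonneg b γ a
  have hbm : AEMeasurable b (haar p n) := hb.aestronglyMeasurable.aemeasurable
  have hm₁ : AEMeasurable (fun y => ENNReal.ofReal (c - b y)) (haar p n) :=
    (aemeasurable_const.sub hbm).ennreal_ofReal
  have hm₂ : AEMeasurable (fun y => ENNReal.ofReal (b y - c)) (haar p n) :=
    (hbm.sub aemeasurable_const).ennreal_ofReal
  have hsplit : ∀ y, ‖b y - c‖ₑ ≤ ENNReal.ofReal (b y - c) + ENNReal.ofReal (c - b y) := fun y => by
    rw [Real.enorm_eq_ofReal_abs]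
    rcases abs_cases (b y - c) with ⟨h, _⟩ | ⟨h, _⟩ <;> rw [h]
    · exact le_self_add
    · rw [neg_sub]; exact le_add_self
  -- Averaging and cancelling the finite mean `c` of `|b|` shows that the excess of `b` over `c` is
  -- on average at most its deficit.
  have hkey : ∀ y, ENNReal.ofReal (b y - c) + ENNReal.ofReal c ≤
      ‖b y‖ₑ + ENNReal.ofReal (c - b y) := fun y => by
    rw [Real.enorm_eq_ofReal_abs]
    rcases le_total c (b y) with h | h
    · rw [← ENNReal.ofReal_add (sub_nonneg.2 h) hc0, sub_add_cancel]
      exact le_add_right (ENNReal.ofReal_le_ofReal (le_abs_self _))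
    · rw [ENNReal.ofReal_of_nonpos (sub_nonpos.2 h), zero_add,
        ← ENNReal.ofReal_add (abs_nonneg _) (sub_nonneg.2 h)]
      exact ENNReal.ofReal_le_ofReal (by linarith [le_abs_self (b y)])
  have h1 := ballAvg_mono hkey γ a
  rw [ballAvg_add hm₂, ballAvg_add hbm.enorm, ballAvg_const, hc, ofReal_ballMean hb, ← hc,
    add_comm] at h1
  have h2 := (ENNReal.add_le_add_iff_left (ballAvg_enorm_lt_top hb γ a).ne).1 h1
  calc _ ≤ ballAvg γ (fun y => ENNReal.ofReal (b y - c) + ENNReal.ofReal (c - b y)) a :=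
        ballAvg_mono hsplit γ a
    _ ≤ _ := by
        rw [ballAvg_add hm₂, two_mul]
        gcongr

/-- The norm of the oscillation function controls its mean, and the norm of the characteristic
function cancels. -/
lemma exists_ballAvg_sub_le_of_oscSup {α β : ℝ} (hn : 0 < n) (hα : 0 < α) (hβ : 0 < β)
    (hαβ : α + β < n) {b q : Qpn p n → ℝ} (hb : LocallyIntegrable b (haar p n)) (hq : MemClog q)
    (hosc : oscSup α β b q < ∞) :
    ∃ M : ℝ≥0∞, M ≠ ∞ ∧ ∀ (γ : ℤ) (a : Qpn p n),
      ballAvg γ (fun y => ‖b y - ballMean b γ a‖ₑ) a ≤ M * ballVol p n γ ^ (β / n) := by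
  obtain ⟨K, hK, hmean⟩ := exists_ballAvg_mul_luxNorm_le hn hq
  have hq1 := hq.memP.one_lt_apply
  refine ⟨2 * (K * oscSup α β b q), ENNReal.mul_ne_top (by simp) (ENNReal.mul_ne_top hK hosc.ne),
    fun γ a => ?_⟩
  have hN0 := luxNorm_indicator_pball_ne_zero hq1 γ a
  have hNt := luxNorm_indicator_pball_ne_top hq1 γ a
  have h1 : 1 / ballVol p n γ ^ (β / n) * (luxNorm q (oscFun α b (pball γ a)) /
      luxNorm q ((pball γ a).indicator fun _ => 1)) ≤ oscSup α β b q := by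
    rw [← haar_pball γ a]
    exact le_iSup₂ (f := fun (γ : ℤ) (a : Qpn p n) => 1 / (haar p n (pball γ a)) ^ (β / n) *
      (luxNorm q (oscFun α b (pball γ a)) / luxNorm q ((pball γ a).indicator fun _ => 1))) γ a
  have h2 := hmean γ a _ (aestronglyMeasurable_oscFun (α := α) (by linarith) hb γ a)
  set V := ballVol p n γ
  set N := luxNorm q ((pball γ a).indicator fun _ => 1)
  set S := oscSup α β b q
  have hVβ0 : V ^ (β / n) ≠ 0 :=
    (ENNReal.rpow_pos (pos_iff_ne_zero.2 (ballVol_ne_zero p n γ)) (ballVol_ne_top p n γ)).ne'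
  have hVβt : V ^ (β / n) ≠ ∞ := ENNReal.rpow_ne_top_of_nonneg (by positivity) (ballVol_ne_top p n γ)
  have h3 : luxNorm q (oscFun α b (pball γ a)) ≤ S * V ^ (β / n) * N := by
    rw [← ENNReal.div_le_iff_le_mul (Or.inl hN0) (Or.inl hNt),
      ← ENNReal.div_le_iff_le_mul (Or.inl hVβ0) (Or.inl hVβt), ENNReal.div_eq_inv_mul, ← one_div]
    exact h1
  have h4 : ballAvg γ (fun y => ‖oscFun α b (pball γ a) y‖ₑ) a ≤ K * S * V ^ (β / n) := by
    refine (ENNReal.mul_le_mul_iff_left hN0 hNt).1 (h2.trans ?_)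
    calc K * luxNorm q (oscFun α b (pball γ a)) ≤ K * (S * V ^ (β / n) * N) := by gcongr
      _ = _ := by ring
  calc _ ≤ 2 * ballAvg γ (fun y => ENNReal.ofReal (ballMean b γ a - b y)) a :=
        ballAvg_sub_ballMean_le hb γ a
    _ ≤ 2 * (K * S * V ^ (β / n)) := by
        gcongr
        exact (ballAvg_mono_ae (ofReal_ballMean_sub_le hn hα.le hb γ a)).trans h4
    _ = _ := by ring

/-- A function whose means over balls tend to zero uniformly with the radius vanishes. -/
lemma ae_eq_zero_of_ballAvg_le {β : ℝ} (hn : 0 < n) (hβ : 0 < β) {g : Qpn p n → ℝ≥0∞}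
    (hg : AEMeasurable g (haar p n)) {M : ℝ≥0∞} (hM : M ≠ ∞)
    (h : ∀ (γ : ℤ) (a : Qpn p n), ballAvg γ g a ≤ M * ballVol p n γ ^ (β / n)) :
    ∀ᵐ x ∂(haar p n), g x = 0 := by
  refine ae_of_forall_ae_pball 0 fun a => ?_
  -- Averaging at scale `-k` preserves the integral over the unit ball, while the averages are of
  -- size `p ^ (-β k)`.
  have hle : ∀ k : ℕ, ∫⁻ x in pball 0 a, g x ∂(haar p n) ≤
      M * ENNReal.ofReal (((p : ℝ) ^ (-β)) ^ k) := fun k => by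
    have h1 := setLIntegral_ballAvg (γ := -(k : ℤ)) hg (measurableSet_pball 0 a) fun x hx => by
      rw [← pball_eq_of_mem hx]; exact pball_mono (by lia) x
    rw [← h1]
    calc ∫⁻ x in pball 0 a, ballAvg (-(k : ℤ)) g x ∂(haar p n)
        ≤ ∫⁻ _ in pball 0 a, M * ballVol p n (-(k : ℤ)) ^ (β / n) ∂(haar p n) :=
          lintegral_mono fun x => h _ x
      _ = M * ballVol p n (-(k : ℤ)) ^ (β / n) := by
          rw [setLIntegral_const, haar_pball]; simp [ballVol]
      _ = _ := by
          rw [ballVol_rpow_div hn, ← Real.rpow_intCast, ← Real.rpow_natCast,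
            ← Real.rpow_mul (prime_real_pos p).le, ← Real.rpow_mul (prime_real_pos p).le]
          congr 3; push_cast; ring
  have hr : (p : ℝ) ^ (-β) < 1 := Real.rpow_lt_one_of_one_lt_of_neg (one_lt_prime_real p) (by linarith)
  have hlim : Filter.Tendsto (fun k : ℕ => M * ENNReal.ofReal (((p : ℝ) ^ (-β)) ^ k))
      Filter.atTop (nhds 0) := by
    have h1 := ENNReal.tendsto_ofReal (tendsto_pow_atTop_nhds_zero_of_lt_one
      (Real.rpow_nonneg (prime_real_pos p).le (-β)) hr)
    rw [ENNReal.ofReal_zero] at h1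
    simpa using ENNReal.Tendsto.const_mul h1 (Or.inr hM)
  have h0 : ∫⁻ x in pball 0 a, g x ∂(haar p n) = 0 :=
    le_antisymm (ge_of_tendsto' hlim hle) zero_le
  exact (lintegral_eq_zero_iff' hg.restrict).1 h0

/-- For `c ≥ 0`, `|b|` is at least as close to `c` as `b` is. -/
lemma abs_ballMean_sub_le {b : Qpn p n → ℝ} (hb : LocallyIntegrable b (haar p n)) {γ : ℤ}
    {a : Qpn p n} {c : ℝ} (hc : 0 ≤ c) {R : ℝ} (hR : 0 ≤ R)
    (h : ballAvg γ (fun y => ‖b y - c‖ₑ) a ≤ ENNReal.ofReal R) : |ballMean b γ a - c| ≤ R := by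
  have hbm : AEMeasurable b (haar p n) := hb.aestronglyMeasurable.aemeasurable
  have hce : ‖c‖ₑ = ENNReal.ofReal c := by rw [Real.enorm_eq_ofReal_abs, abs_of_nonneg hc]
  have h1 : ballAvg γ (fun y => ‖b y‖ₑ) a ≤ ENNReal.ofReal c + ENNReal.ofReal R := by
    have : ∀ y, ‖b y‖ₑ ≤ ENNReal.ofReal c + ‖b y - c‖ₑ := fun y => by
      rw [← hce]
      simpa using enorm_add_le c (b y - c)
    refine (ballAvg_mono this γ a).trans ?_
    rw [ballAvg_add aemeasurable_const, ballAvg_const]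
    gcongr
  have h2 : ENNReal.ofReal c ≤ ballAvg γ (fun y => ‖b y‖ₑ) a + ENNReal.ofReal R := by
    have : ∀ y, ENNReal.ofReal c ≤ ‖b y‖ₑ + ‖b y - c‖ₑ := fun y => by
      rw [← hce]
      simpa using enorm_sub_le (a := b y) (b := b y - c)
    rw [← ballAvg_const (p := p) (n := n) (ENNReal.ofReal c) γ a]
    refine (ballAvg_mono this γ a).trans ?_
    rw [ballAvg_add hbm.enorm]
    gcongr
  have hnn := ballMean_nonneg b γ a
  rw [← ofReal_ballMean hb, ← ENNReal.ofReal_add hc hR,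
    ENNReal.ofReal_le_ofReal_iff (by positivity)] at h1
  rw [← ofReal_ballMean hb, ← ENNReal.ofReal_add hnn hR,
    ENNReal.ofReal_le_ofReal_iff (by positivity)] at h2
  rw [abs_le]
  constructor <;> linarith

lemma ballAvg_pred_le (γ : ℤ) (F : Qpn p n → ℝ≥0∞) (a : Qpn p n) :
    ballAvg (γ - 1) F a ≤ (p : ℝ≥0∞) ^ (n : ℝ) * ballAvg γ F a := by
  have hV : ballVol p n γ = (p : ℝ≥0∞) ^ (n : ℝ) * ballVol p n (γ - 1) := by
    rw [ballVol, ballVol, ← ENNReal.rpow_add _ _ (prime_ne_zero p) (ENNReal.natCast_ne_top p)]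
    congr 1; push_cast; ring
  have hp0 : (p : ℝ≥0∞) ^ (n : ℝ) ≠ 0 := by simp [(Fact.out : p.Prime).ne_zero]
  have hpt : (p : ℝ≥0∞) ^ (n : ℝ) ≠ ∞ := by simp
  rw [ballAvg, ballAvg, hV, ← mul_div_assoc, ENNReal.mul_div_mul_left _ _ hp0 hpt]
  gcongr
  exact pball_mono (by lia) a

/-- Campanato's characterization of Lipschitz functions: the means of `|b|` converge everywhere,
at a rate. -/
lemma exists_limit_ballMean {β : ℝ} (hn : 0 < n) (hβ : 0 < β) {b : Qpn p n → ℝ}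
    (hb : LocallyIntegrable b (haar p n)) {M : ℝ≥0∞} (hM : M ≠ ∞)
    (h : ∀ (γ : ℤ) (a : Qpn p n),
      ballAvg γ (fun y => ‖b y - ballMean b γ a‖ₑ) a ≤ M * ballVol p n γ ^ (β / n)) :
    ∃ (b₀ : Qpn p n → ℝ) (R : ℝ), 0 ≤ R ∧ Measurable b₀ ∧ (∀ x, 0 ≤ b₀ x) ∧
      ∀ (γ : ℤ) (x : Qpn p n), |ballMean b γ x - b₀ x| ≤ R * ((p : ℝ) ^ γ) ^ β := by
  -- The factor `p ^ n` is the price of averaging over a ball one scale smaller.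
  set R₀ : ℝ := ((p : ℝ≥0∞) ^ (n : ℝ) * M).toReal
  have hR₀ : 0 ≤ R₀ := ENNReal.toReal_nonneg
  have hRe : ENNReal.ofReal R₀ = (p : ℝ≥0∞) ^ (n : ℝ) * M :=
    ENNReal.ofReal_toReal (ENNReal.mul_ne_top (by simp) hM)
  set ρ : ℝ := (p : ℝ) ^ (-β)
  have hρ : ρ < 1 := Real.rpow_lt_one_of_one_lt_of_neg (one_lt_prime_real p) (by linarith)
  have hstep : ∀ (γ : ℤ) (x : Qpn p n),
      |ballMean b (γ - 1) x - ballMean b γ x| ≤ R₀ * ((p : ℝ) ^ γ) ^ β := fun γ x => by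
    refine abs_ballMean_sub_le hb (ballMean_nonneg b γ x) (by positivity) ?_
    refine (ballAvg_pred_le γ _ x).trans ?_
    rw [ENNReal.ofReal_mul hR₀, hRe, ← ballVol_rpow_div hn, mul_assoc]
    gcongr
    exact h γ x
  have hgeom : ∀ (γ : ℤ) (x : Qpn p n) (k : ℕ),
      dist (ballMean b (γ - k) x) (ballMean b (γ - (k + 1 : ℕ)) x) ≤
        R₀ * ((p : ℝ) ^ γ) ^ β * ρ ^ k := fun γ x k => by
    have h1 := hstep (γ - k) x
    have e1 : γ - (k + 1 : ℕ) = γ - k - 1 := by push_cast; ring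
    have e2 : ((p : ℝ) ^ (γ - (k : ℤ))) ^ β = ((p : ℝ) ^ γ) ^ β * ρ ^ k := by
      simp only [ρ]
      rw [← Real.rpow_intCast, ← Real.rpow_intCast, ← Real.rpow_natCast,
        ← Real.rpow_mul (prime_real_pos p).le, ← Real.rpow_mul (prime_real_pos p).le,
        ← Real.rpow_mul (prime_real_pos p).le, ← Real.rpow_add (prime_real_pos p)]
      congr 1; push_cast; ring
    rw [e1, dist_comm, Real.dist_eq, mul_assoc, ← e2]
    exact h1
  have hconv : ∀ x, ∃ l, Filter.Tendsto (fun k : ℕ => ballMean b (0 - (k : ℤ)) x) Filter.atTop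
      (nhds l) := fun x =>
    cauchySeq_tendsto_of_complete (cauchySeq_of_le_geometric ρ _ hρ (hgeom 0 x))
  choose b₀ hb₀ using hconv
  have hall : ∀ (γ : ℤ) (x : Qpn p n),
      Filter.Tendsto (fun k : ℕ => ballMean b (γ - (k : ℤ)) x) Filter.atTop (nhds (b₀ x)) := by
    intro γ x
    -- Shifted by the positive and negative parts of `γ`, the two sequences of scales coincide.
    rw [← Filter.tendsto_add_atTop_iff_nat γ.toNat]
    refine ((Filter.tendsto_add_atTop_iff_nat (-γ).toNat).2 (hb₀ x)).congr fun k => ?_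
    congr 1; lia
  refine ⟨b₀, R₀ / (1 - ρ), div_nonneg hR₀ (sub_nonneg.2 hρ.le), ?_, fun x => ?_, fun γ x => ?_⟩
  · exact measurable_of_tendsto_metrizable (fun k : ℕ => measurable_ballMean b (0 - (k : ℤ)))
      (tendsto_pi_nhds.2 hb₀)
  · exact ge_of_tendsto' (hb₀ x) fun k => ballMean_nonneg b _ x
  · have h1 := dist_le_of_le_geometric_of_tendsto₀ ρ _ hρ (hgeom γ x) (hall γ x)
    rw [Real.dist_eq, Nat.cast_zero, sub_zero] at h1
    exact h1.trans_eq (by ring)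

/-- The representative is the limit of the means of `|b|`. It is Lipschitz because two points of one
ball share the mean over that ball. -/
theorem exists_memLip_of_oscSup_lt_top {α β : ℝ} (hn : 0 < n) (hα : 0 < α) (hβ : 0 < β)
    (hαβ : α + β < n) {b q : Qpn p n → ℝ} (hb : LocallyIntegrable b (haar p n)) (hq : MemClog q)
    (hosc : oscSup α β b q < ∞) :
    ∃ b₀ : Qpn p n → ℝ, b =ᵐ[haar p n] b₀ ∧ MemLip β b₀ ∧ ∀ x, 0 ≤ b₀ x := by
  obtain ⟨M, hM, hmean⟩ := exists_ballAvg_sub_le_of_oscSup hn hα hβ hαβ hb hq hosc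
  obtain ⟨b₀, R, hR, hm, h0, hlim⟩ := exists_limit_ballMean hn hβ hb hM hmean
  have hbm : AEMeasurable b (haar p n) := hb.aestronglyMeasurable.aemeasurable
  refine ⟨b₀, ?_, ⟨hm, ?_⟩, h0⟩
  · have hz := ae_eq_zero_of_ballAvg_le hn hβ (g := fun y => ‖b y - b₀ y‖ₑ)
      (hbm.sub hm.aemeasurable).enorm (M := M + ENNReal.ofReal R)
      (ENNReal.add_ne_top.2 ⟨hM, ENNReal.ofReal_ne_top⟩) fun γ a => by
        rw [add_mul, ballVol_rpow_div hn, ← ENNReal.ofReal_mul hR, ← ballVol_rpow_div hn]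
        calc ballAvg γ (fun y => ‖b y - b₀ y‖ₑ) a
            ≤ ballAvg γ (fun y => ‖b y - ballMean b γ a‖ₑ +
                ENNReal.ofReal (R * ((p : ℝ) ^ γ) ^ β)) a := by
              refine ballAvg_mono_ae ?_
              filter_upwards [ae_restrict_mem (measurableSet_pball γ a)] with y hy
              have h1 := hlim γ y
              rw [ballMean_eq_of_mem b hy] at h1
              calc ‖b y - b₀ y‖ₑ = ‖(b y - ballMean b γ a) + (ballMean b γ a - b₀ y)‖ₑ := by
                    congr 1; ring
                _ ≤ ‖b y - ballMean b γ a‖ₑ + ‖ballMean b γ a - b₀ y‖ₑ := enorm_add_le _ _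
                _ ≤ _ := by
                    gcongr
                    rw [Real.enorm_eq_ofReal_abs]
                    exact ENNReal.ofReal_le_ofReal h1
          _ ≤ _ := by
              rw [ballAvg_add (F := fun y => ‖b y - ballMean b γ a‖ₑ)
                (hbm.sub aemeasurable_const).enorm, ballAvg_const]
              gcongr
              exact hmean γ a
    filter_upwards [hz] with x hx
    rwa [enorm_eq_zero, sub_eq_zero] at hx
  · refine lt_of_le_of_lt (iSup_le fun x => iSup₂_le fun y hne => ?_)
      (ENNReal.ofReal_lt_top (r := 2 * R * (p : ℝ) ^ β))
    have hpos : 0 < ‖x - y‖ := norm_pos_iff.2 (sub_ne_zero.2 hne)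
    -- The least ball around `y` containing `x` has radius `p ^ (γ + 1) < p ‖x - y‖`, whence the
    -- factor `p ^ β` in the constant.
    obtain ⟨γ, hγ1, hγ2⟩ := exists_mem_Ioc_zpow hpos (one_lt_prime_real p)
    have hx : x ∈ pball (γ + 1) y := mem_pball.2 hγ2
    have h1 := hlim (γ + 1) x
    have h2 := hlim (γ + 1) y
    rw [ballMean_eq_of_mem b hx] at h1
    have h3 : ((p : ℝ) ^ (γ + 1)) ^ β ≤ (p : ℝ) ^ β * ‖x - y‖ ^ β := by
      rw [← Real.mul_rpow (prime_real_pos p).le hpos.le,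
        zpow_add_one₀ (prime_real_pos p).ne', mul_comm]
      have := prime_real_pos p
      gcongr
    refine ENNReal.ofReal_le_ofReal ?_
    rw [div_le_iff₀ (Real.rpow_pos_of_pos hpos β)]
    have h4 : |b₀ x - b₀ y| ≤ 2 * (R * ((p : ℝ) ^ (γ + 1)) ^ β) := by
      rw [abs_le] at *
      constructor <;> linarith [h1.1, h1.2, h2.1, h2.2]
    calc |b₀ x - b₀ y| ≤ 2 * (R * ((p : ℝ) ^ (γ + 1)) ^ β) := h4
      _ ≤ 2 * (R * ((p : ℝ) ^ β * ‖x - y‖ ^ β)) := by gcongr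
      _ = _ := by ring

end Campanato

end PadicVar

/-! ### The equivalences. -/

theorem theorem1 (p : ℕ) [Fact p.Prime] (n : ℕ) (α β : ℝ)
    (hβ0 : 0 < β) (hβ1 : β < 1) (hα : 0 < α) (hαβ : α + β < n)
    (b : PadicVar.Qpn p n → ℝ) (hb : LocallyIntegrable b (PadicVar.haar p n)) :
    List.TFAE [
      -- `b ∈ Λ_β` and `b ≥ 0`, as an element of `L¹_loc` (functions modulo null sets)
      ∃ b₀ : PadicVar.Qpn p n → ℝ, b =ᵐ[PadicVar.haar p n] b₀ ∧ PadicVar.MemLip β b₀ ∧ ∀ x, 0 ≤ b₀ x,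
      ∀ r q : PadicVar.Qpn p n → ℝ, PadicVar.AdmissiblePair (α + β) r q →
        PadicVar.CommutatorBounded α b r q,
      ∃ r q : PadicVar.Qpn p n → ℝ, PadicVar.AdmissiblePair (α + β) r q ∧
        PadicVar.CommutatorBounded α b r q,
      ∃ r q : PadicVar.Qpn p n → ℝ, PadicVar.AdmissiblePair (α + β) r q ∧
        PadicVar.oscSup α β b q < ∞,
      ∀ r q : PadicVar.Qpn p n → ℝ, PadicVar.AdmissiblePair (α + β) r q →
        PadicVar.oscSup α β b q < ∞] := by
  have hn : 0 < n := by
    have : (0 : ℝ) < n := (add_pos hα hβ0).trans hαβ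
    exact_mod_cast this
  -- A concrete pair turns the assertions about all admissible pairs into assertions about some
  -- pair.
  obtain ⟨r₀, q₀, hpair⟩ := PadicVar.exists_admissiblePair p n (add_pos hα hβ0) hαβ
  tfae_have 1 → 2 := fun ⟨_, hbb, hlip, h0⟩ _ _ h =>
    PadicVar.commutatorBounded_of_memLip hn hα hβ0 hbb hlip h0 h
  tfae_have 2 → 3 := fun h => ⟨r₀, q₀, hpair, h r₀ q₀ hpair⟩
  tfae_have 3 → 4 := fun ⟨r, q, h, hC⟩ =>
    ⟨r, q, h, PadicVar.oscSup_lt_top_of_commutatorBounded hn hα hβ0 hαβ h hC⟩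
  tfae_have 4 → 1 := fun ⟨_, _, h, hosc⟩ =>
    PadicVar.exists_memLip_of_oscSup_lt_top hn hα hβ0 hαβ hb h.q_mem_Clog hosc
  tfae_have 2 → 5 := fun h r q hrq =>
    PadicVar.oscSup_lt_top_of_commutatorBounded hn hα hβ0 hαβ hrq (h r q hrq)
  tfae_have 5 → 4 := fun h => ⟨r₀, q₀, hpair, h r₀ q₀ hpair⟩
  tfae_finish
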